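/- Let $(\Omega,\mathcal F,\mathbb P,\{\mathcal F_t\}_{t\ge 0},W)$ be a stochastic basis, where $W=\{W^k\}_{k\ge 1}$ is a sequence of independent standard one-dimensional Brownian motions relative to $\{\mathcal F_t\}$. Let $A>0$ and let $\sigma_k\in H^2(0,1)\cap H^1_0(0,1)$, $k\ge1$, satisfy $\int_0^1\sum_{k}|(\sigma_k)_{xx}|^2\,dx<\infty$. Consider on $(0,1)$ the stochastic compressible Navier–Stokes system $$\rho_t+(\rho u)_x=0,\qquad d(\rho u)+(\rho u^2+A^2\rho)_x\,dt=u_{xx}\,dt+\sum_{k}\rho\,\sigma_k\,dW^k,\qquad u(t,0)=u(t,1)=0,$$ and the phase space $$\mathcal X=\Big\{(\rho,u)\in H^1(0,1)\times H^1_0(0,1):\ \int_0^1\rho\,dx=1,\ \rho>0 \text{ on } [0,1]\Big\}.$$ A strong solution with (deterministic) initial datum $(\rho_0,u_0)\in\mathcal X$ is an adapted process $(\rho,u)$ such that almost surely $(\rho(t),u(t))\in\mathcal X$ for all $t\ge0$, $(\rho(0),u(0))=(\rho_0,u_0)$, and, for every $T>0$, $$\rho\in L^\infty(0,T;H^1(0,1)),\qquad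 u\in L^\infty(0,T;H^1_0(0,1))\cap L^2(0,T;H^2(0,1)),$$ and such that both equations hold in the time-integrated sense: tested against any $\varphi\in C_c^\infty(0,1)$ and integrated over $[0,t]$, they hold almost surely for all $t\ge0$, the noise term being the Itô integral $\sum_k\int_0^t\big(\int_0^1\rho\,\sigma_k\varphi\,dx\big)\,dW^k$. **Theorem (uniqueness of strong solutions).** Let $(\rho,u)$ and $(r,v)$ be two strong solutions, on the same stochastic basis, with the same initial datum $(\rho_0,u_0)\in\mathcal X$. Then $$\mathbb P\big[(\rho(t),u(t))=(r(t),v(t))\ \text{ for all } t\ge0\big]=1.$$ -/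

import Mathlib

open MeasureTheory ProbabilityTheory Filter Set
open scoped NNReal ENNReal Topology

namespace StochCNS

/-! ### Sobolev spaces on the unit interval

Elements of `H¹(0,1)` are represented by their (absolutely) continuous representative on `[0,1]`;
a function `ℝ → ℝ` is only looked at on `[0,1]`. -/

/-- `f` is the continuous representative on `[0,1]` of an element of `H¹(0,1)` whose weak
derivative is `g ∈ L²(0,1)`. -/
def HasL2Deriv (f g : ℝ → ℝ) : Prop :=
  MemLp g 2 (volume.restrict (Ioo (0 : ℝ) 1)) ∧
    ∀ x ∈ Icc (0 : ℝ) 1, f x = f 0 + ∫ y in (0 : ℝ)..x, g y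

/-- `f ∈ H¹(0,1)`. -/
def MemH1 (f : ℝ → ℝ) : Prop := ∃ g, HasL2Deriv f g

/-- `f ∈ H¹₀(0,1)`. -/
def MemH10 (f : ℝ → ℝ) : Prop := MemH1 f ∧ f 0 = 0 ∧ f 1 = 0

/-- `f ∈ H¹(0,1)` and `‖f‖²_{L²} + ‖f_x‖²_{L²} ≤ C`. -/
def H1NormSqLE (f : ℝ → ℝ) (C : ℝ) : Prop :=
  ∃ g, HasL2Deriv f g ∧
    (∫ x in (0 : ℝ)..1, f x ^ 2) + (∫ x in (0 : ℝ)..1, g x ^ 2) ≤ C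

/-- The phase space: `(ρ, u) ∈ H¹(0,1) × H¹₀(0,1)` with `∫ ρ = 1` and `ρ > 0` on `[0,1]`. -/
structure MemX (ρ u : ℝ → ℝ) : Prop where
  density_memH1 : MemH1 ρ
  velocity_memH10 : MemH10 u
  mass : ∫ x in (0 : ℝ)..1, ρ x = 1
  pos : ∀ x ∈ Icc (0 : ℝ) 1, 0 < ρ x

/-- `f ∈ L^∞(0,T; H¹(0,1))` for all `T`. -/
def MemLinftyLocH1 (f : ℝ≥0 → ℝ → ℝ) : Prop :=
  AEStronglyMeasurable (fun p : ℝ × ℝ => f p.1.toNNReal p.2)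
      (volume.restrict (Ioi (0 : ℝ) ×ˢ Ioo (0 : ℝ) 1)) ∧
    ∀ T : ℝ, ∃ C : ℝ, ∀ᵐ s ∂(volume.restrict (Ioo (0 : ℝ) T)), H1NormSqLE (f s.toNNReal) C

/-- `f ∈ L²(0,T; H²(0,1))` for all `T`; here `v = f_x` and `w = f_xx`. -/
def MemL2LocH2 (f : ℝ≥0 → ℝ → ℝ) : Prop :=
  ∃ v w : ℝ → ℝ → ℝ,
    (∀ᵐ s ∂(volume.restrict (Ioi (0 : ℝ))),
      HasL2Deriv (f s.toNNReal) (v s) ∧ HasL2Deriv (v s) (w s)) ∧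
    ∀ T : ℝ,
      MemLp (fun p : ℝ × ℝ => f p.1.toNNReal p.2) 2
        (volume.restrict (Ioo (0 : ℝ) T ×ˢ Ioo (0 : ℝ) 1)) ∧
      MemLp (fun p : ℝ × ℝ => v p.1 p.2) 2
        (volume.restrict (Ioo (0 : ℝ) T ×ˢ Ioo (0 : ℝ) 1)) ∧
      MemLp (fun p : ℝ × ℝ => w p.1 p.2) 2
        (volume.restrict (Ioo (0 : ℝ) T ×ˢ Ioo (0 : ℝ) 1))

/-- `φ ∈ C_c^∞(0,1)`. -/
def IsTestFunction (φ : ℝ → ℝ) : Prop :=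
  ContDiff ℝ ((⊤ : ℕ∞) : WithTop ℕ∞) φ ∧ HasCompactSupport φ ∧ tsupport φ ⊆ Ioo (0 : ℝ) 1

/-! ### The noise -/

/-- The coefficients of the noise: `σ_k ∈ H² ∩ H¹₀` and `∫₀¹ ∑_k |(σ_k)_xx|² dx < ∞`. -/
def IsNoiseCoeff (σ : ℕ → ℝ → ℝ) : Prop :=
  ∃ σ' σ'' : ℕ → ℝ → ℝ,
    (∀ k, HasL2Deriv (σ k) (σ' k) ∧ HasL2Deriv (σ' k) (σ'' k) ∧ σ k 0 = 0 ∧ σ k 1 = 0) ∧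
    ∫⁻ x in Ioo (0 : ℝ) 1, ∑' k, ‖σ'' k x‖ₑ ^ 2 < ∞

section Probability

variable {Ω : Type*} [mΩ : MeasurableSpace Ω]

/-- `(Ω, P, F, W)` is a stochastic basis: `W` is a sequence of independent standard Brownian
motions, adapted to the filtration `F`, whose increments after time `s` are jointly independent
of `F s`. -/
structure IsStochasticBasis (P : Measure Ω) (F : Filtration ℝ≥0 mΩ) (W : ℕ → ℝ≥0 → Ω → ℝ) :
    Prop where
  brownian : ∀ k, IsBrownianReal (W k) P
  indep : iIndepFun (fun (k : ℕ) (ω : Ω) (t : ℝ≥0) => W k t ω) P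
  adapted : ∀ k, Adapted F (W k)
  indep_increment : ∀ s t : ℝ≥0, s ≤ t →
    Indep (⨆ k : ℕ, MeasurableSpace.comap (fun ω => W k t ω - W k s ω) inferInstance) (F s) P

/-- The left-endpoint sum `∑_{i<n} H(t_i) (B(t_{i+1}) - B(t_i))` over the partition `t_i = t i/n`
of `[0,t]`. -/
noncomputable def itoSum (H B : ℝ≥0 → Ω → ℝ) (t : ℝ≥0) (n : ℕ) (ω : Ω) : ℝ :=
  ∑ i ∈ Finset.range n, H (t * i / n) ω * (B (t * (i + 1) / n) ω - B (t * i / n) ω)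

/-- `I` is a continuous version of the Itô integral process `∫₀ᵗ H dB`. For integrands `H` which
are adapted with continuous paths (the only ones it is used for), the Itô integral is
the limit in probability of the left-endpoint Riemann sums. -/
def IsItoIntegral (P : Measure Ω) (H B I : ℝ≥0 → Ω → ℝ) : Prop :=
  (∀ᵐ ω ∂P, Continuous (fun t => I t ω)) ∧
    ∀ t : ℝ≥0, TendstoInMeasure P (fun n : ℕ => itoSum H B t n) atTop (I t)

/-- `M` is a continuous version of the stochastic integral `∑_k ∫₀ᵗ H_k dW^k`, the series being
convergent in probability. -/
def IsItoSeries (P : Measure Ω) (H W : ℕ → ℝ≥0 → Ω → ℝ) (M : ℝ≥0 → Ω → ℝ) : Prop :=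
  (∀ᵐ ω ∂P, Continuous (fun t => M t ω)) ∧
    ∃ I : ℕ → ℝ≥0 → Ω → ℝ, (∀ k, IsItoIntegral P (H k) (W k) (I k)) ∧
      ∀ t : ℝ≥0, TendstoInMeasure P
        (fun (N : ℕ) (ω : Ω) => ∑ k ∈ Finset.range N, I k t ω) atTop (M t)

/-! ### The equations -/

/-- `ρ_t + (ρ u)_x = 0`, integrated in time on `[0,t]` and tested with `φ ∈ C_c^∞(0,1)`. -/
def ContinuityEquation (ρ u : ℝ≥0 → ℝ → ℝ) : Prop :=
  ∀ φ, IsTestFunction φ → ∀ t : ℝ≥0,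
    ∫ x in (0 : ℝ)..1, ρ t x * φ x =
      (∫ x in (0 : ℝ)..1, ρ 0 x * φ x) +
        ∫ s in (0 : ℝ)..t, ∫ x in (0 : ℝ)..1, ρ s.toNNReal x * u s.toNNReal x * deriv φ x

/-- `d(ρ u) + (ρ u² + A² ρ)_x dt = u_xx dt + ∑_k ρ σ_k dW^k`, integrated in time on `[0,t]` and
tested with `φ ∈ C_c^∞(0,1)`. -/
def MomentumEquation (P : Measure Ω) (W : ℕ → ℝ≥0 → Ω → ℝ) (A : ℝ) (σ : ℕ → ℝ → ℝ)
    (ρ u : ℝ≥0 → Ω → ℝ → ℝ) : Prop :=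
  ∀ φ, IsTestFunction φ → ∃ M : ℝ≥0 → Ω → ℝ,
    IsItoSeries P (fun k s ω => ∫ x in (0 : ℝ)..1, ρ s ω x * σ k x * φ x) W M ∧
    ∀ᵐ ω ∂P, ∀ t : ℝ≥0,
      ∫ x in (0 : ℝ)..1, ρ t ω x * u t ω x * φ x =
        (∫ x in (0 : ℝ)..1, ρ 0 ω x * u 0 ω x * φ x) +
          (∫ s in (0 : ℝ)..t, ∫ x in (0 : ℝ)..1,
            ((ρ s.toNNReal ω x * u s.toNNReal ω x ^ 2 + A ^ 2 * ρ s.toNNReal ω x) * deriv φ x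
              + u s.toNNReal ω x * deriv (deriv φ) x)) +
          M t ω

/-- `(ρ, u)` is a strong solution, on the basis `(Ω, P, F, W)`, of the stochastic compressible
Navier-Stokes system on `(0,1)` with Dirichlet condition for `u` (contained in `MemX`) and initial
datum `(ρ₀, u₀)`. The value of the density at time `t` and at the point `x` is `ρ t ω x`. -/
structure IsStrongSolution (P : Measure Ω) (F : Filtration ℝ≥0 mΩ) (W : ℕ → ℝ≥0 → Ω → ℝ)
    (A : ℝ) (σ : ℕ → ℝ → ℝ) (ρ₀ u₀ : ℝ → ℝ) (ρ u : ℝ≥0 → Ω → ℝ → ℝ) : Prop where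
  adapted_density : ∀ x ∈ Icc (0 : ℝ) 1, Adapted F (fun t ω => ρ t ω x)
  adapted_velocity : ∀ x ∈ Icc (0 : ℝ) 1, Adapted F (fun t ω => u t ω x)
  mem_phaseSpace : ∀ᵐ ω ∂P, ∀ t : ℝ≥0, MemX (ρ t ω) (u t ω)
  density_regularity : ∀ᵐ ω ∂P, MemLinftyLocH1 (fun t => ρ t ω)
  velocity_regularity : ∀ᵐ ω ∂P,
    MemLinftyLocH1 (fun t => u t ω) ∧ MemL2LocH2 (fun t => u t ω)
  initial : ∀ᵐ ω ∂P, ∀ x ∈ Icc (0 : ℝ) 1, ρ 0 ω x = ρ₀ x ∧ u 0 ω x = u₀ x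
  continuity : ∀ᵐ ω ∂P, ContinuityEquation (fun t => ρ t ω) (fun t => u t ω)
  momentum : MomentumEquation P W A σ ρ u

end Probability

end StochCNS

/-! The density multiplies the noise in the momentum equation, so formally dividing by `ρ` leaves an
additive noise: the velocity satisfies `du = (-u u_x - A² ρ_x/ρ + u_xx/ρ) dt + dU` with `U = ∑ σ_k
W^k`. Two solutions on the same basis see the same `U`, so `w = u - v` has no martingale part and
uniqueness becomes a deterministic statement along almost every path.

Justifying this needs no Itô formula. By the continuity equation the integrand `∫ ρ σ_k φ` is
absolutely continuous in time, so its left-endpoint sums against `W^k` converge pathwise, by Abel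
summation (`tendsto_sum_mul_sub`). Along a fast subsequence the series `∑ σ_k W^k` converges almost
everywhere with a square integrable majorant (`exists_noise_dominated`), which identifies the whole
stochastic term (`IsStrongSolution.ae_series_eq`). Countably many test functions then turn the weak
equations into equations in time for almost every `x` (`IsStrongSolution.ae_equations`). The
division by `ρ` uses a density lower bound uniform in time (`exists_lower_bound`) and a linear
differential inequality (`RegularOn.ae_velocity_eq`).

The deterministic core is the energy `E = ∫ ρ w²/2 + η²/2` with `η = ρ - r`. Integrating by parts in
space, viscosity supplies `-∫ w_x²`, which absorbs the terms in `w_x` and, through `sup w² ≤ ∫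
w_x²`, the term `w η v_xx / r`. There remains `E' ≤ K (1 + ‖u_xx‖² + ‖v_xx‖²) E`
(`energy_production_le`). The coefficient is integrable in time and `E` starts from zero, so
Gronwall gives `E = 0` for almost every time (`RegularOn.unique`).

Finally the integrated equations, whose time integrals ignore null sets of times and whose
martingale terms are continuous, extend the equality to every time. -/

namespace StochCNS

/-! ### Absolutely continuous functions on `[0,T]` -/

/-- `f` is absolutely continuous on `[0,T]` with almost everywhere derivative `g`. -/
def IsPrimitiveOn (T : ℝ) (f g : ℝ → ℝ) : Prop :=
  IntervalIntegrable g volume 0 T ∧ ∀ t ∈ Icc 0 T, f t = f 0 + ∫ s in (0 : ℝ)..t, g s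

theorem HasL2Deriv.isPrimitiveOn {f g : ℝ → ℝ} (h : HasL2Deriv f g) : IsPrimitiveOn 1 f g := by
  refine ⟨?_, h.2⟩
  rw [intervalIntegrable_iff_integrableOn_Ioo_of_le zero_le_one]
  exact h.1.integrable (by norm_num)

namespace IsPrimitiveOn

variable {T : ℝ} {f g f' g' : ℝ → ℝ}

theorem intervalIntegrable (h : IsPrimitiveOn T f f') {a b : ℝ} (ha : a ∈ Icc 0 T)
    (hb : b ∈ Icc 0 T) : IntervalIntegrable f' volume a b := by
  refine h.1.mono_set ?_
  rw [uIcc_of_le (ha.1.trans ha.2)]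
  exact (convex_Icc 0 T).ordConnected.uIcc_subset ha hb

theorem integral_eq_sub (h : IsPrimitiveOn T f f') {a b : ℝ} (ha : a ∈ Icc 0 T)
    (hb : b ∈ Icc 0 T) : ∫ s in a..b, f' s = f b - f a := by
  have h0 : (0 : ℝ) ∈ Icc 0 T := ⟨le_rfl, ha.1.trans ha.2⟩
  rw [h.2 a ha, h.2 b hb, ← intervalIntegral.integral_interval_sub_left
    (h.intervalIntegrable h0 hb) (h.intervalIntegrable h0 ha)]
  ring

theorem absolutelyContinuousOnInterval (h : IsPrimitiveOn T f f') :
    AbsolutelyContinuousOnInterval (fun t => f 0 + ∫ s in (0 : ℝ)..t, f' s) 0 T := by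
  have h1 := h.1.absolutelyContinuousOnInterval_intervalIntegral (c := 0) (by simp)
  have h2 : AbsolutelyContinuousOnInterval (fun _ : ℝ => f 0) 0 T :=
    contDiffOn_const.absolutelyContinuousOnInterval
  exact h2.add h1

theorem continuousOn (h : IsPrimitiveOn T f f') : ContinuousOn f (Icc 0 T) := by
  rcases le_or_gt 0 T with hT | hT
  · have := (h.absolutelyContinuousOnInterval).continuousOn
    rw [uIcc_of_le hT] at this
    exact this.congr fun t ht => h.2 t ht
  · simp [Icc_eq_empty_of_lt hT]

theorem ae_deriv (h : IsPrimitiveOn T f f') :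
    ∀ᵐ t, t ∈ uIcc 0 T → deriv (fun t => f 0 + ∫ s in (0 : ℝ)..t, f' s) t = f' t := by
  filter_upwards [h.1.ae_hasDerivAt_integral] with t ht hm
  exact ((ht hm 0 (by simp)).const_add (f 0)).deriv

/-- Integration by parts is applied to the primitives representing `f` and `g`, because `f` and `g`
themselves are controlled only on `[0,T]`. -/
theorem mul (hT : 0 ≤ T) (hf : IsPrimitiveOn T f f') (hg : IsPrimitiveOn T g g') :
    IsPrimitiveOn T (fun t => f t * g t) (fun t => f' t * g t + f t * g' t) := by
  have hcf := hf.continuousOn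
  have hcg := hg.continuousOn
  rw [← uIcc_of_le hT] at hcf hcg
  refine ⟨(hf.1.mul_continuousOn hcg).add (hg.1.continuousOn_mul hcf), fun t ht => ?_⟩
  have hsub : uIcc 0 t ⊆ uIcc 0 T := by
    rw [uIcc_of_le ht.1, uIcc_of_le hT]; exact Icc_subset_Icc_right ht.2
  have h := AbsolutelyContinuousOnInterval.integral_deriv_mul_eq_sub
    ((hf.absolutelyContinuousOnInterval).mono hsub)
    ((hg.absolutelyContinuousOnInterval).mono hsub)
  have h0 : (0 : ℝ) ∈ Icc 0 T := ⟨le_rfl, hT⟩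
  simp only [← hf.2 t ht, ← hg.2 t ht, intervalIntegral.integral_same, add_zero] at h
  rw [← sub_eq_iff_eq_add', ← h]
  refine intervalIntegral.integral_congr_ae ?_
  filter_upwards [hf.ae_deriv, hg.ae_deriv] with s h1 h2 hs
  have hs' := hsub (uIoc_subset_uIcc hs)
  have hs'' := hs'
  rw [uIcc_of_le hT] at hs''
  rw [h1 hs', h2 hs', ← hf.2 s hs'', ← hg.2 s hs'']

theorem add (hf : IsPrimitiveOn T f f') (hg : IsPrimitiveOn T g g') :
    IsPrimitiveOn T (fun t => f t + g t) (fun t => f' t + g' t) := by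
  refine ⟨hf.1.add hg.1, fun t ht => ?_⟩
  have h0 : (0 : ℝ) ∈ Icc 0 T := ⟨le_rfl, ht.1.trans ht.2⟩
  rw [intervalIntegral.integral_add (hf.intervalIntegrable h0 ht) (hg.intervalIntegrable h0 ht)]
  beta_reduce
  rw [hf.2 t ht, hg.2 t ht]
  ring

theorem const_mul (hf : IsPrimitiveOn T f f') (c : ℝ) :
    IsPrimitiveOn T (fun t => c * f t) (fun t => c * f' t) := by
  refine ⟨hf.1.const_mul c, fun t ht => ?_⟩
  rw [intervalIntegral.integral_const_mul]
  beta_reduce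
  rw [hf.2 t ht]
  ring

theorem sub (hf : IsPrimitiveOn T f f') (hg : IsPrimitiveOn T g g') :
    IsPrimitiveOn T (fun t => f t - g t) (fun t => f' t - g' t) := by
  simpa [sub_eq_add_neg] using hf.add (hg.const_mul (-1))

/-- Lebesgue differentiation: almost everywhere both functions are the derivative of the same
primitive. -/
theorem ae_eq (hf : IsPrimitiveOn T f f') (hg : IsPrimitiveOn T f g') :
    ∀ᵐ t ∂(volume.restrict (Ioo 0 T)), f' t = g' t := by
  rcases le_or_gt 0 T with hT | hT
  · rw [ae_restrict_iff' measurableSet_Ioo]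
    filter_upwards [hf.1.ae_hasDerivAt_integral, hg.1.ae_hasDerivAt_integral] with t h1 h2 ht
    have htI : t ∈ uIcc 0 T := by rw [uIcc_of_le hT]; exact Ioo_subset_Icc_self ht
    refine (h1 htI 0 (by simp)).unique ((h2 htI 0 (by simp)).congr_of_eventuallyEq ?_)
    filter_upwards [Ioo_mem_nhds ht.1 ht.2] with s hs
    have e1 := hf.2 s (Ioo_subset_Icc_self hs)
    have e2 := hg.2 s (Ioo_subset_Icc_self hs)
    linarith
  · simp [Ioo_eq_empty_of_le hT.le]

end IsPrimitiveOn

theorem isPrimitiveOn_integral {T : ℝ} {g : ℝ → ℝ} (c : ℝ) (hg : IntervalIntegrable g volume 0 T) :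
    IsPrimitiveOn T (fun t => c + ∫ s in (0 : ℝ)..t, g s) g :=
  ⟨hg, fun t _ => by simp⟩

/-- A nonnegative function bounded by the integral of an integrable multiple of itself vanishes. -/
theorem ae_eq_zero_of_le_integral {T : ℝ} {E c : ℝ → ℝ} (hT : 0 ≤ T)
    (hc : IntervalIntegrable c volume 0 T) (hc0 : ∀ᵐ s ∂(volume.restrict (Ioo 0 T)), 0 ≤ c s)
    (hcE : IntervalIntegrable (fun s => c s * E s) volume 0 T)
    (hE0 : ∀ᵐ s ∂(volume.restrict (Ioo 0 T)), 0 ≤ E s)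
    (hE : ∀ᵐ t ∂(volume.restrict (Ioo 0 T)), E t ≤ ∫ s in (0 : ℝ)..t, c s * E s) :
    ∀ᵐ t ∂(volume.restrict (Ioo 0 T)), E t = 0 := by
  set Φ : ℝ → ℝ := fun t => ∫ s in (0 : ℝ)..t, c s * E s with hΦ
  have hP : IsPrimitiveOn T Φ (fun s => c s * E s) := by
    simpa [hΦ] using isPrimitiveOn_integral 0 hcE
  have hC : IsPrimitiveOn T (fun t => ∫ s in (0 : ℝ)..t, c s) c := by
    simpa using isPrimitiveOn_integral 0 hc
  have hae : ∀ᵐ s, s ∈ Ioo 0 T → 0 ≤ c s ∧ 0 ≤ E s ∧ E s ≤ Φ s := by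
    rw [← ae_restrict_iff' measurableSet_Ioo]
    filter_upwards [hc0, hE0, hE] with s h1 h2 h3 using ⟨h1, h2, h3⟩
  have hT' : ∀ᵐ s : ℝ, s ≠ T := by simp [ae_iff, measure_singleton]
  have hmono : ∀ a ∈ Icc 0 T, ∀ b ∈ Icc 0 T, a ≤ b → Φ a ≤ Φ b := by
    intro a ha b hb hab
    rw [← sub_nonneg, ← hP.integral_eq_sub ha hb]
    refine intervalIntegral.integral_nonneg_of_ae_restrict hab ?_
    rw [EventuallyLE, ae_restrict_iff' measurableSet_Icc]
    have h00 : ∀ᵐ s : ℝ, s ≠ 0 := by simp [ae_iff, measure_singleton]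
    filter_upwards [hae, hT', h00] with s hs hsT hs0 hsab
    have := hs ⟨lt_of_le_of_ne (ha.1.trans hsab.1) (Ne.symm hs0),
      lt_of_le_of_ne (hsab.2.trans hb.2) hsT⟩
    exact mul_nonneg this.1 this.2.1
  have h0T : (0 : ℝ) ∈ Icc 0 T := ⟨le_rfl, hT⟩
  have hΦ0 : Φ 0 = 0 := by simp [hΦ]
  -- Continuous induction along the closed set where `Φ` vanishes, replacing the exponential in
  -- Gronwall. If `Φ a = 0` and `t > a` is so close that `∫_a^t c < 1`, monotonicity of `Φ` gives `Φ
  -- t ≤ (∫_a^t c) Φ t`, which forces `Φ t = 0`.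
  have hzero : ∀ t ∈ Icc 0 T, Φ t = 0 := by
    have hclosed : IsClosed ({t | Φ t = 0} ∩ Icc 0 T) := by
      have := hP.continuousOn.preimage_isClosed_of_isClosed isClosed_Icc (isClosed_singleton (x := 0))
      rwa [inter_comm] at this
    refine fun t ht => IsClosed.Icc_subset_of_forall_exists_gt hclosed hΦ0 ?_ ht
    intro a ⟨ha, haT⟩ b hb
    have hcont : ContinuousWithinAt (fun t => ∫ s in (0 : ℝ)..t, c s) (Icc 0 T) a :=
      hC.continuousOn a (Ico_subset_Icc_self haT)
    have hev : ∀ᶠ t in 𝓝[>] a, (∫ s in (0 : ℝ)..t, c s) < (∫ s in (0 : ℝ)..a, c s) + 1 := by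
      have h1 : 𝓝[>] a ≤ 𝓝[Icc 0 T] a := by
        rw [← nhdsWithin_Ioo_eq_nhdsGT haT.2]
        exact nhdsWithin_mono _ fun x hx => ⟨haT.1.trans hx.1.le, hx.2.le⟩
      exact h1 (hcont.eventually_lt continuousWithinAt_const (by linarith))
    have hev2 : ∀ᶠ t in 𝓝[>] a, t ∈ Ioo a (min b T) :=
      Ioo_mem_nhdsGT (lt_min hb haT.2)
    obtain ⟨t, ht1, ht2⟩ := (hev.and hev2).exists
    have htT : t ∈ Icc 0 T := ⟨haT.1.trans ht2.1.le, ht2.2.le.trans (min_le_right _ _)⟩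
    have haT' := Ico_subset_Icc_self haT
    refine ⟨t, ?_, ht2.1, ht2.2.le.trans (min_le_left _ _)⟩
    have ha0 : Φ a = 0 := ha
    have key : Φ t ≤ (∫ s in a..t, c s) * Φ t := by
      have e1 := hP.integral_eq_sub haT' htT
      rw [ha0, sub_zero] at e1
      conv_lhs => rw [← e1]
      rw [← intervalIntegral.integral_mul_const]
      refine intervalIntegral.integral_mono_ae_restrict ht2.1.le
        (hP.intervalIntegrable haT' htT) ((hC.intervalIntegrable haT' htT).mul_const _) ?_
      rw [EventuallyLE, ae_restrict_iff' measurableSet_Icc]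
      have h00 : ∀ᵐ s : ℝ, s ≠ 0 := by simp [ae_iff, measure_singleton]
      filter_upwards [hae, hT', h00] with s hs hsT hs0 hsab
      have hsI : s ∈ Ioo 0 T := ⟨lt_of_le_of_ne (haT.1.trans hsab.1) (Ne.symm hs0),
        lt_of_le_of_ne (hsab.2.trans htT.2) hsT⟩
      have := hs hsI
      exact mul_le_mul_of_nonneg_left
        (this.2.2.trans (hmono s (Ioo_subset_Icc_self hsI) t htT hsab.2)) this.1
    rw [hC.integral_eq_sub haT' htT] at key
    have hΦt : 0 ≤ Φ t := by rw [← ha0]; exact hmono a haT' t htT ht2.1.le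
    rcases hΦt.eq_or_lt with h | h
    · exact h.symm
    · have : Φ t * ((∫ s in (0 : ℝ)..t, c s) - ∫ s in (0 : ℝ)..a, c s) < Φ t * 1 :=
        mul_lt_mul_of_pos_left (by linarith) h
      linarith
  rw [ae_restrict_iff' measurableSet_Ioo]
  filter_upwards [hae] with s hs hsI
  have := hs hsI
  rw [hzero s (Ioo_subset_Icc_self hsI)] at this
  exact le_antisymm this.2.2 this.2.1

/-! ### Elementary estimates in `H¹(0,1)` -/

theorem MemLp.intervalIntegrable_mul {f g : ℝ → ℝ}
    (hf : MemLp f 2 (volume.restrict (Ioo (0 : ℝ) 1)))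
    (hg : MemLp g 2 (volume.restrict (Ioo (0 : ℝ) 1))) :
    IntervalIntegrable (fun x => f x * g x) volume 0 1 := by
  rw [intervalIntegrable_iff_integrableOn_Ioo_of_le zero_le_one]
  exact hf.integrable_mul hg

theorem MemLp.intervalIntegrable_sq {f : ℝ → ℝ}
    (hf : MemLp f 2 (volume.restrict (Ioo (0 : ℝ) 1))) :
    IntervalIntegrable (fun x => f x ^ 2) volume 0 1 := by
  simpa [sq] using MemLp.intervalIntegrable_mul hf hf

theorem MemLp.intervalIntegrable_unit {f : ℝ → ℝ}
    (hf : MemLp f 2 (volume.restrict (Ioo (0 : ℝ) 1))) :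
    IntervalIntegrable f volume 0 1 := by
  rw [intervalIntegrable_iff_integrableOn_Ioo_of_le zero_le_one]
  exact hf.integrable (by norm_num)

theorem memLp_of_continuousOn_Icc {f : ℝ → ℝ} (hf : ContinuousOn f (Icc 0 1)) :
    MemLp f 2 (volume.restrict (Ioo (0 : ℝ) 1)) := by
  obtain ⟨C, hC⟩ := isCompact_Icc.exists_bound_of_continuousOn hf
  refine MemLp.of_bound
    ((hf.mono Ioo_subset_Icc_self).aestronglyMeasurable measurableSet_Ioo) C ?_
  rw [ae_restrict_iff' measurableSet_Ioo]
  exact Eventually.of_forall fun x hx => hC x (Ioo_subset_Icc_self hx)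

/-- Cauchy–Schwarz on an interval of length one, from the nonnegative variance of `|g|`. -/
theorem sq_intervalIntegral_abs_le {g : ℝ → ℝ}
    (hg : MemLp g 2 (volume.restrict (Ioo (0 : ℝ) 1))) :
    (∫ x in (0 : ℝ)..1, |g x|) ^ 2 ≤ ∫ x in (0 : ℝ)..1, g x ^ 2 := by
  set c := ∫ x in (0 : ℝ)..1, |g x| with hc
  have h1 := MemLp.intervalIntegrable_sq hg
  have h2 : IntervalIntegrable (fun x => |g x|) volume 0 1 :=
    (MemLp.intervalIntegrable_unit hg).abs
  have h3 : 0 ≤ ∫ x in (0 : ℝ)..1, (|g x| - c) ^ 2 :=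
    intervalIntegral.integral_nonneg zero_le_one fun x _ => sq_nonneg _
  have h4 : ∀ x, (|g x| - c) ^ 2 = g x ^ 2 - (2 * c) * |g x| + c ^ 2 := fun x => by
    rw [← sq_abs (g x)]; ring
  simp_rw [h4] at h3
  rw [intervalIntegral.integral_add (h1.sub (h2.const_mul _)) (by simp),
    intervalIntegral.integral_sub h1 (h2.const_mul _), intervalIntegral.integral_const_mul, ← hc,
    intervalIntegral.integral_const] at h3
  simp only [sub_zero, one_smul] at h3
  linarith

namespace HasL2Deriv

variable {f g h : ℝ → ℝ}

theorem continuousOn (hf : HasL2Deriv f g) : ContinuousOn f (Icc 0 1) :=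
  hf.isPrimitiveOn.continuousOn

theorem memLp (hf : HasL2Deriv f g) : MemLp f 2 (volume.restrict (Ioo (0 : ℝ) 1)) :=
  memLp_of_continuousOn_Icc hf.continuousOn

theorem sq_sub_le (hf : HasL2Deriv f g) {x y : ℝ} (hx : x ∈ Icc (0 : ℝ) 1)
    (hy : y ∈ Icc (0 : ℝ) 1) : (f x - f y) ^ 2 ≤ ∫ z in (0 : ℝ)..1, g z ^ 2 := by
  refine le_trans ?_ (sq_intervalIntegral_abs_le hf.1)
  rw [← hf.isPrimitiveOn.integral_eq_sub hy hx]
  refine sq_le_sq.2 ?_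
  rw [abs_of_nonneg (intervalIntegral.integral_nonneg zero_le_one fun x _ => abs_nonneg (g x))]
  refine (intervalIntegral.norm_integral_le_integral_norm_uIoc (f := g)).trans ?_
  rw [intervalIntegral.integral_of_le zero_le_one]
  refine setIntegral_mono_set ?_ (Eventually.of_forall fun x => abs_nonneg _) ?_
  · exact ((intervalIntegrable_iff_integrableOn_Ioc_of_le zero_le_one).1
      (MemLp.intervalIntegrable_unit hf.1)).norm
  · refine LE.le.eventuallyLE fun z hz => ?_
    rcases mem_uIoc.1 hz with h | h
    · exact ⟨hy.1.trans_lt h.1, h.2.trans hx.2⟩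
    · exact ⟨hx.1.trans_lt h.1, h.2.trans hy.2⟩

theorem sq_le (hf : HasL2Deriv f g) (h0 : f 0 = 0) {x : ℝ} (hx : x ∈ Icc (0 : ℝ) 1) :
    f x ^ 2 ≤ ∫ z in (0 : ℝ)..1, g z ^ 2 := by
  simpa [h0] using hf.sq_sub_le hx (left_mem_Icc.2 zero_le_one)

/-- A mean-zero `f` satisfies `f x = ∫ (f x - f y) dy`, and every increment is bounded by
`sq_sub_le`. -/
theorem sq_le_of_mean_zero (hf : HasL2Deriv f g) (hm : ∫ y in (0 : ℝ)..1, f y = 0) {x : ℝ}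
    (hx : x ∈ Icc (0 : ℝ) 1) : f x ^ 2 ≤ ∫ z in (0 : ℝ)..1, g z ^ 2 := by
  set c := ∫ z in (0 : ℝ)..1, g z ^ 2
  have h1 : f x = ∫ y in (0 : ℝ)..1, (f x - f y) := by
    rw [intervalIntegral.integral_sub (by simp) (MemLp.intervalIntegrable_unit hf.memLp), hm]
    simp
  have h2 : |f x| ≤ √c := by
    rw [h1]
    have := intervalIntegral.norm_integral_le_of_norm_le_const (a := 0) (b := 1)
      (f := fun y => f x - f y) (C := √c) fun y hy => by
        rw [uIoc_of_le zero_le_one] at hy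
        exact Real.abs_le_sqrt (hf.sq_sub_le hx (Ioc_subset_Icc_self hy))
    simpa using this
  have h3 : 0 ≤ c := intervalIntegral.integral_nonneg zero_le_one fun x _ => sq_nonneg _
  calc f x ^ 2 = |f x| ^ 2 := (sq_abs _).symm
    _ ≤ √c ^ 2 := by gcongr
    _ = c := Real.sq_sqrt h3

/-- Vanishing of `f` at both endpoints makes the mean of its derivative zero. -/
theorem sq_deriv_le (hf : HasL2Deriv f g) (hg : HasL2Deriv g h) (h0 : f 0 = 0) (h1 : f 1 = 0)
    {x : ℝ} (hx : x ∈ Icc (0 : ℝ) 1) : g x ^ 2 ≤ ∫ z in (0 : ℝ)..1, h z ^ 2 :=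
  hg.sq_le_of_mean_zero (by
    have := hf.2 1 (right_mem_Icc.2 zero_le_one)
    rw [h0, h1] at this; linarith) hx

theorem sub (hf : HasL2Deriv f g) {f₂ g₂ : ℝ → ℝ} (hf₂ : HasL2Deriv f₂ g₂) :
    HasL2Deriv (fun x => f x - f₂ x) (fun x => g x - g₂ x) :=
  ⟨hf.1.sub hf₂.1, (hf.isPrimitiveOn.sub hf₂.isPrimitiveOn).2⟩

end HasL2Deriv

/-! ### The energy estimate at a fixed time -/

/-- The left sides are the coefficients of `ρ w²/2` and `η²/2` collected in `energy_remainder_le`,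
with `a = A⁴`, `c = A⁴ C/δ²`, `d = 1/δ²`; a single Gronwall constant must dominate both. -/
theorem energy_coefficient_le {a c d C U V : ℝ} (ha : 0 ≤ a) (hc : 0 ≤ c) (hd : 0 ≤ d)
    (hC : 0 ≤ C) (hU : 0 ≤ U) (hV : 0 ≤ V) :
    2 * (1 + V) ≤ (8 + 4 * a + 6 * c + 6 * C + 6 * d + 4 * C ^ 2) * (1 + U + V) ∧
    4 * a + 2 * (3 * (c + V * d + C) + 1) + (1 + U) + 4 * C ^ 2 ≤
      (8 + 4 * a + 6 * c + 6 * C + 6 * d + 4 * C ^ 2) * (1 + U + V) := by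
  have h1 : 0 ≤ 6 + 8 * U + 6 * V +
      (4 * a + 6 * c + 6 * C + 6 * d + 4 * C ^ 2) * (1 + U + V) := by positivity
  have h2 : 0 ≤ 5 + 6 * d + 7 * U + 8 * V + (4 * a + 6 * c + 6 * C + 6 * d + 4 * C ^ 2) * U +
      (4 * a + 6 * c + 6 * C + 4 * C ^ 2) * V := by positivity
  constructor <;> linarith

/-- Young's inequality term by term. The two terms linear in `wx` cost `wx²/8` each, leaving `-(3/4)
wx²`. The variable `S` stands for `∫ wx²`, which bounds `w²` pointwise. The product of `w`, `η` and
the quantity `q` involving `vxx` is split with weight `Q`, chosen to bound the integral of the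
majorant `qh` of `q²`; after integration it costs at most `S/4`, which the remaining dissipation
absorbs. -/
theorem energy_remainder_le {A δ C S Q Uxx Vxx ρ r rx w wx η ux vx vxx : ℝ} (hδ : 0 < δ)
    (hρ : 0 ≤ ρ) (hr : δ ≤ r) (hrC : r ≤ C) (hw : w ^ 2 ≤ S) (hux : ux ^ 2 ≤ Uxx)
    (hvx : vx ^ 2 ≤ Vxx)
    (hQ : Q = 3 * (A ^ 4 * C / δ ^ 2 + Vxx / δ ^ 2 + C) + 1) (hC : 0 ≤ C) :
    -(ρ * w ^ 2 * vx) + A ^ 2 * wx * η + w * η * (A ^ 2 * rx / r - vxx / r - rx) - wx ^ 2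
        - η ^ 2 * ux / 2 - η * r * wx ≤
      (-(3 / 4) * wx ^ 2 +
        S / (4 * Q) * (3 * (A ^ 4 * rx ^ 2 / δ ^ 2 + vxx ^ 2 / δ ^ 2 + rx ^ 2))) +
      (8 + 4 * A ^ 4 + 6 * A ^ 4 * C / δ ^ 2 + 6 * C + 6 / δ ^ 2 + 4 * C ^ 2) *
        (1 + Uxx + Vxx) * (ρ * w ^ 2 / 2 + η ^ 2 / 2) := by
  have hU0 : 0 ≤ Uxx := (sq_nonneg _).trans hux
  have hV0 : 0 ≤ Vxx := (sq_nonneg _).trans hvx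
  have hQ0 : 0 < Q := by rw [hQ]; positivity
  have hr0 : 0 < r := hδ.trans_le hr
  have hS0 : 0 ≤ S := (sq_nonneg _).trans hw
  set q := A ^ 2 * rx / r - vxx / r - rx with hq
  set qh := 3 * (A ^ 4 * rx ^ 2 / δ ^ 2 + vxx ^ 2 / δ ^ 2 + rx ^ 2) with hqh
  have hq2 : q ^ 2 ≤ qh := by
    have e1 : (A ^ 2 * rx / r) ^ 2 ≤ A ^ 4 * rx ^ 2 / δ ^ 2 := by
      rw [div_pow, mul_pow, ← pow_mul]; gcongr
    have e2 : (vxx / r) ^ 2 ≤ vxx ^ 2 / δ ^ 2 := by rw [div_pow]; gcongr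
    rw [hq, hqh]
    nlinarith [sq_nonneg (A ^ 2 * rx / r + vxx / r), sq_nonneg (A ^ 2 * rx / r + rx),
      sq_nonneg (vxx / r - rx)]
  have t1 : -(ρ * w ^ 2 * vx) ≤ (1 + Vxx) * (ρ * w ^ 2) := by
    have : -vx ≤ 1 + Vxx := by nlinarith [sq_nonneg (vx + 1)]
    nlinarith [mul_le_mul_of_nonneg_left this (by positivity : 0 ≤ ρ * w ^ 2)]
  have t2 : A ^ 2 * wx * η ≤ wx ^ 2 / 8 + 2 * A ^ 4 * η ^ 2 := by
    nlinarith [sq_nonneg (wx - 4 * A ^ 2 * η)]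
  have t3 : w * η * q ≤ S / (4 * Q) * qh + Q * η ^ 2 := by
    have e1 : w * η * q ≤ w ^ 2 * q ^ 2 / (4 * Q) + Q * η ^ 2 := by
      have : 0 ≤ (w * q - 2 * Q * η) ^ 2 / (4 * Q) := by positivity
      have e : (w * q - 2 * Q * η) ^ 2 / (4 * Q) =
          w ^ 2 * q ^ 2 / (4 * Q) - w * η * q + Q * η ^ 2 := by field_simp; ring
      linarith
    have e2 : w ^ 2 * q ^ 2 / (4 * Q) ≤ S / (4 * Q) * qh := by
      rw [div_mul_eq_mul_div]; gcongr
    linarith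
  have t4 : -(η ^ 2 * ux / 2) ≤ (1 + Uxx) * (η ^ 2 / 2) := by
    have : -ux ≤ 1 + Uxx := by nlinarith [sq_nonneg (ux + 1)]
    nlinarith [mul_le_mul_of_nonneg_left this (by positivity : 0 ≤ η ^ 2 / 2)]
  have t5 : -(η * r * wx) ≤ wx ^ 2 / 8 + 2 * C ^ 2 * η ^ 2 := by
    have e1 : r ^ 2 ≤ C ^ 2 := by gcongr
    have e2 : (η * r) ^ 2 ≤ C ^ 2 * η ^ 2 := by
      rw [mul_pow, mul_comm]; exact mul_le_mul_of_nonneg_right e1 (sq_nonneg η)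
    have e3 : -(η * r * wx) ≤ wx ^ 2 / 8 + 2 * (η * r) ^ 2 := by
      have : 0 ≤ (wx + 4 * (η * r)) ^ 2 / 8 := by positivity
      linarith [show (wx + 4 * (η * r)) ^ 2 / 8 =
        wx ^ 2 / 8 + η * r * wx + 2 * (η * r) ^ 2 by ring]
    linarith
  obtain ⟨k1, k2⟩ := energy_coefficient_le (a := A ^ 4) (c := A ^ 4 * C / δ ^ 2) (d := 1 / δ ^ 2)
    (C := C) (by positivity) (by positivity) (by positivity) hC hU0 hV0
  have hK : 8 + 4 * A ^ 4 + 6 * A ^ 4 * C / δ ^ 2 + 6 * C + 6 / δ ^ 2 + 4 * C ^ 2 =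
      8 + 4 * A ^ 4 + 6 * (A ^ 4 * C / δ ^ 2) + 6 * C + 6 * (1 / δ ^ 2) + 4 * C ^ 2 := by ring
  have hQ' : 3 * (A ^ 4 * C / δ ^ 2 + Vxx * (1 / δ ^ 2) + C) + 1 = Q := by rw [hQ]; ring
  rw [hK]
  rw [hQ'] at k2
  have k1' := mul_le_mul_of_nonneg_right k1 (by positivity : 0 ≤ ρ * w ^ 2 / 2)
  have k2' := mul_le_mul_of_nonneg_right k2 (by positivity : 0 ≤ η ^ 2 / 2)
  rw [mul_add]
  refine le_trans ?_ (add_le_add_right (add_le_add k1' k2') _)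
  linarith

/-- The left integrand is the formal time derivative of the energy density, with the equations
substituted for the time derivatives. Modulo an exact space derivative it equals the left side of
`energy_remainder_le`. -/
theorem energy_production_le {A δ C : ℝ} (hδ : 0 < δ) (hC : 0 ≤ C)
    {ρ ρx r rx u ux uxx v vx vxx : ℝ → ℝ}
    (hρ : HasL2Deriv ρ ρx) (hr : HasL2Deriv r rx) (hu : HasL2Deriv u ux) (hux : HasL2Deriv ux uxx)
    (hv : HasL2Deriv v vx) (hvx : HasL2Deriv vx vxx)
    (hu0 : u 0 = 0) (hu1 : u 1 = 0) (hv0 : v 0 = 0) (hv1 : v 1 = 0)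
    (hρδ : ∀ x ∈ Icc (0 : ℝ) 1, δ ≤ ρ x) (hrδ : ∀ x ∈ Icc (0 : ℝ) 1, δ ≤ r x ∧ r x ≤ C)
    (hrx : ∫ x in (0 : ℝ)..1, rx x ^ 2 ≤ C) :
    ∫ x in (0 : ℝ)..1, (-(ρx x * u x + ρ x * ux x) * (u x - v x) ^ 2 / 2 +
        ρ x * (u x - v x) * ((-(u x * ux x) - A ^ 2 * ρx x / ρ x + uxx x / ρ x) -
          (-(v x * vx x) - A ^ 2 * rx x / r x + vxx x / r x)) +
        (ρ x - r x) * (-(ρx x * u x + ρ x * ux x) - -(rx x * v x + r x * vx x))) ≤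
      (8 + 4 * A ^ 4 + 6 * A ^ 4 * C / δ ^ 2 + 6 * C + 6 / δ ^ 2 + 4 * C ^ 2) *
        (1 + (∫ x in (0 : ℝ)..1, uxx x ^ 2) + ∫ x in (0 : ℝ)..1, vxx x ^ 2) *
        ∫ x in (0 : ℝ)..1, (ρ x * (u x - v x) ^ 2 / 2 + (ρ x - r x) ^ 2 / 2) := by
  set Uxx := ∫ x in (0 : ℝ)..1, uxx x ^ 2
  set Vxx := ∫ x in (0 : ℝ)..1, vxx x ^ 2
  set K := 8 + 4 * A ^ 4 + 6 * A ^ 4 * C / δ ^ 2 + 6 * C + 6 / δ ^ 2 + 4 * C ^ 2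
  have hw := hu.sub hv
  have hwx := hux.sub hvx
  have hη := hρ.sub hr
  set S := ∫ x in (0 : ℝ)..1, (ux x - vx x) ^ 2 with hS
  obtain ⟨Q, hQ⟩ : ∃ Q, Q = 3 * (A ^ 4 * C / δ ^ 2 + Vxx / δ ^ 2 + C) + 1 := ⟨_, rfl⟩
  have hVxx0 : 0 ≤ Vxx := intervalIntegral.integral_nonneg zero_le_one fun x _ => sq_nonneg _
  have hQ0 : 0 < Q := by rw [hQ]; positivity
  have hS0 : 0 ≤ S := intervalIntegral.integral_nonneg zero_le_one fun x _ => sq_nonneg _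
  have pw := hw.isPrimitiveOn
  have pu := hu.isPrimitiveOn
  have pη := hη.isPrimitiveOn
  have h01 : (0 : ℝ) ≤ 1 := zero_le_one
  -- The exact part is the derivative of `G = -ρ u w²/2 - A² w η + w w_x - η² u/2`. Every term of
  -- `G` contains `u` or `w`, so `G` vanishes at both endpoints and its derivative has integral
  -- zero.
  have hG := (((((((hρ.isPrimitiveOn.mul h01 pu).mul h01 pw).mul h01 pw).const_mul (-(1 / 2))).sub
    ((pw.mul h01 pη).const_mul (A ^ 2))).add (pw.mul h01 hwx.isPrimitiveOn)).sub
    (((pη.mul h01 pη).mul h01 pu).const_mul (1 / 2)))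
  have hGI := hG.2 1 (right_mem_Icc.2 zero_le_one)
  simp only [hu0, hu1, hv0, hv1, sub_zero, mul_zero, zero_mul, add_zero, zero_add] at hGI
  have m1 : IntervalIntegrable (fun x => (ux x - vx x) ^ 2) volume 0 1 :=
    MemLp.intervalIntegrable_sq hw.1
  have m2 : IntervalIntegrable (fun x => rx x ^ 2) volume 0 1 := MemLp.intervalIntegrable_sq hr.1
  have m3 : IntervalIntegrable (fun x => vxx x ^ 2) volume 0 1 :=
    MemLp.intervalIntegrable_sq hvx.1
  have mqh : IntervalIntegrable (fun x => 3 * (A ^ 4 * rx x ^ 2 / δ ^ 2 + vxx x ^ 2 / δ ^ 2 +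
      rx x ^ 2)) volume 0 1 :=
    ((((m2.const_mul _).div_const _).add (m3.div_const _)).add m2).const_mul _
  have mE : IntervalIntegrable (fun x => ρ x * (u x - v x) ^ 2 / 2 + (ρ x - r x) ^ 2 / 2)
      volume 0 1 := by
    apply ContinuousOn.intervalIntegrable
    rw [uIcc_of_le h01]
    have c1 := hρ.continuousOn
    have c2 := hw.continuousOn
    have c3 := hη.continuousOn
    exact ((c1.mul (c2.pow 2)).div_const 2).add ((c3.pow 2).div_const 2)
  have mR : IntervalIntegrable (fun x => (-(3 / 4) * (ux x - vx x) ^ 2 +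
      S / (4 * Q) * (3 * (A ^ 4 * rx x ^ 2 / δ ^ 2 + vxx x ^ 2 / δ ^ 2 + rx x ^ 2))) +
      K * (1 + Uxx + Vxx) * (ρ x * (u x - v x) ^ 2 / 2 + (ρ x - r x) ^ 2 / 2)) volume 0 1 :=
    ((m1.const_mul _).add (mqh.const_mul _)).add (mE.const_mul _)
  have hsum := hG.1.add mR
  have hRint : ∫ x in (0 : ℝ)..1, ((-(3 / 4) * (ux x - vx x) ^ 2 +
      S / (4 * Q) * (3 * (A ^ 4 * rx x ^ 2 / δ ^ 2 + vxx x ^ 2 / δ ^ 2 + rx x ^ 2))) +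
      K * (1 + Uxx + Vxx) * (ρ x * (u x - v x) ^ 2 / 2 + (ρ x - r x) ^ 2 / 2)) ≤
      K * (1 + Uxx + Vxx) *
        ∫ x in (0 : ℝ)..1, (ρ x * (u x - v x) ^ 2 / 2 + (ρ x - r x) ^ 2 / 2) := by
    rw [intervalIntegral.integral_add ((m1.const_mul _).add (mqh.const_mul _)) (mE.const_mul _),
      intervalIntegral.integral_add (m1.const_mul _) (mqh.const_mul _),
      intervalIntegral.integral_const_mul, intervalIntegral.integral_const_mul,
      intervalIntegral.integral_const_mul (K * _), ← hS]
    have hq : ∫ x in (0 : ℝ)..1, 3 * (A ^ 4 * rx x ^ 2 / δ ^ 2 + vxx x ^ 2 / δ ^ 2 + rx x ^ 2) ≤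
        Q := by
      rw [intervalIntegral.integral_const_mul, intervalIntegral.integral_add
        (((m2.const_mul _).div_const _).add (m3.div_const _)) m2,
        intervalIntegral.integral_add ((m2.const_mul _).div_const _) (m3.div_const _),
        intervalIntegral.integral_div, intervalIntegral.integral_div,
        intervalIntegral.integral_const_mul, hQ]
      have : A ^ 4 * (∫ x in (0 : ℝ)..1, rx x ^ 2) / δ ^ 2 ≤ A ^ 4 * C / δ ^ 2 := by gcongr
      linarith
    have : S / (4 * Q) * ∫ x in (0 : ℝ)..1, 3 * (A ^ 4 * rx x ^ 2 / δ ^ 2 + vxx x ^ 2 / δ ^ 2 +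
        rx x ^ 2) ≤ S / (4 * Q) * Q := by gcongr
    have e : S / (4 * Q) * Q = S / 4 := by field_simp
    linarith
  -- A non-integrable integrand has integral 0 by convention, while the right side is nonnegative,
  -- so integrability of the production needs no proof here.
  by_cases hint : IntervalIntegrable (fun x =>
    -(ρx x * u x + ρ x * ux x) * (u x - v x) ^ 2 / 2 +
        ρ x * (u x - v x) * ((-(u x * ux x) - A ^ 2 * ρx x / ρ x + uxx x / ρ x) -
          (-(v x * vx x) - A ^ 2 * rx x / r x + vxx x / r x)) +
        (ρ x - r x) * (-(ρx x * u x + ρ x * ux x) - -(rx x * v x + r x * vx x))) volume 0 1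
  swap
  · rw [intervalIntegral.integral_undef hint]
    have hUxx0 : 0 ≤ Uxx := intervalIntegral.integral_nonneg zero_le_one fun x _ => sq_nonneg _
    have : 0 ≤ ∫ x in (0 : ℝ)..1, (ρ x * (u x - v x) ^ 2 / 2 + (ρ x - r x) ^ 2 / 2) :=
      intervalIntegral.integral_nonneg zero_le_one fun x hx => by
        have := hδ.le.trans (hρδ x hx)
        positivity
    positivity
  refine le_trans ?_ hRint
  rw [← zero_add (∫ x in (0 : ℝ)..1, ((-(3 / 4) * (ux x - vx x) ^ 2 + _) + _))]
  conv_rhs => arg 1; rw [hGI]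
  rw [← intervalIntegral.integral_add hG.1 mR]
  refine intervalIntegral.integral_mono_on zero_le_one hint hsum fun x hx => ?_
  have hρ0 := hδ.trans_le (hρδ x hx)
  have hr0 := hδ.trans_le (hrδ x hx).1
  have := energy_remainder_le (A := A) (S := S) (wx := ux x - vx x) (η := ρ x - r x)
    (vxx := vxx x) (rx := rx x) hδ hρ0.le (hrδ x hx).1
    (hrδ x hx).2 (hw.sq_le (by simp [hu0, hv0]) hx) (hu.sq_deriv_le hux hu0 hu1 hx)
    (hv.sq_deriv_le hvx hv0 hv1 hx) hQ hC
  refine le_trans (le_of_eq ?_) (add_le_add_right this _)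
  field_simp
  ring

/-! ### Measurability in time and space -/

/-- Lebesgue measure on `(0,1)`. -/
noncomputable abbrev unitVol : Measure ℝ := volume.restrict (Ioo (0 : ℝ) 1)

/-- Lebesgue measure on `(0,T)`. -/
noncomputable abbrev timeVol (T : ℝ) : Measure ℝ := volume.restrict (Ioo (0 : ℝ) T)

/-- Lebesgue measure on `(0,T) × (0,1)`. -/
noncomputable abbrev stripVol (T : ℝ) : Measure (ℝ × ℝ) := (timeVol T).prod unitVol

theorem volume_restrict_strip (T : ℝ) :
    (volume : Measure (ℝ × ℝ)).restrict (Ioo (0 : ℝ) T ×ˢ Ioo (0 : ℝ) 1) = stripVol T := by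
  rw [stripVol, Measure.prod_restrict, Measure.volume_eq_prod]

/-- Fubini passes from iterated null sets to a product null set only for measurable sets, hence the
detour through measurable modifications. -/
theorem ae_eq_prod_of_ae_ae {α β γ : Type*} [MeasurableSpace α] [MeasurableSpace β]
    [TopologicalSpace γ] [TopologicalSpace.MetrizableSpace γ]
    {μ : Measure α} {ν : Measure β} [SFinite μ] [SFinite ν] {f g : α × β → γ}
    (hf : AEStronglyMeasurable f (μ.prod ν)) (hg : AEStronglyMeasurable g (μ.prod ν))
    (h : ∀ᵐ a ∂μ, ∀ᵐ b ∂ν, f (a, b) = g (a, b)) : f =ᵐ[μ.prod ν] g := by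
  have h1 : ∀ᵐ z ∂μ.prod ν, hf.mk f z = hg.mk g z := by
    rw [Measure.ae_prod_iff_ae_ae
      (hf.stronglyMeasurable_mk.measurableSet_eq_fun hg.stronglyMeasurable_mk)]
    filter_upwards [h, Measure.ae_ae_of_ae_prod hf.ae_eq_mk, Measure.ae_ae_of_ae_prod hg.ae_eq_mk]
      with a h1 h2 h3
    filter_upwards [h1, h2, h3] with b e1 e2 e3
    rw [← e2, ← e3, e1]
  filter_upwards [h1, hf.ae_eq_mk, hg.ae_eq_mk] with z e1 e2 e3
  rw [e2, e1, e3]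

theorem ae_Ioi_of_forall_ae_Ioo {p : ℝ → Prop}
    (h : ∀ n : ℕ, ∀ᵐ s ∂(volume.restrict (Ioo (0 : ℝ) n)), p s) :
    ∀ᵐ s ∂(volume.restrict (Ioi (0 : ℝ))), p s := by
  have : Ioi (0 : ℝ) = ⋃ n : ℕ, Ioo (0 : ℝ) n := by
    ext s
    simp only [mem_Ioi, mem_iUnion, mem_Ioo]
    exact ⟨fun hs => (exists_nat_gt s).imp fun n hn => ⟨hs, hn⟩, fun ⟨n, hn⟩ => hn.1⟩
  rw [this, ae_restrict_iUnion_iff]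
  exact h

theorem ae_Ioo_of_ae_Ioi {p : ℝ → Prop} (T : ℝ) (h : ∀ᵐ s ∂(volume.restrict (Ioi (0 : ℝ))), p s) :
    ∀ᵐ s ∂(timeVol T), p s :=
  ae_restrict_of_ae_restrict_of_subset Ioo_subset_Ioi_self h

theorem HasL2Deriv.ae_tendsto_slope {f g : ℝ → ℝ} (h : HasL2Deriv f g) :
    ∀ᵐ x ∂unitVol, Tendsto (fun n : ℕ => ((n : ℝ) + 1) * (f (x + 1 / ((n : ℝ) + 1)) - f x)) atTop
      (𝓝 (g x)) := by
  rw [ae_restrict_iff' measurableSet_Ioo]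
  filter_upwards [h.isPrimitiveOn.1.ae_hasDerivAt_integral] with x hx hxI
  have h1 := (hx (by rw [uIcc_of_le zero_le_one]; exact Ioo_subset_Icc_self hxI) 0
    (by simp)).const_add (f 0)
  have h2 : HasDerivAt f (g x) x := by
    refine h1.congr_of_eventuallyEq ?_
    filter_upwards [Ioo_mem_nhds hxI.1 hxI.2] with y hy
    exact h.2 y (Ioo_subset_Icc_self hy)
  have h3 := h2.tendsto_slope_zero_right
  have h4 : Tendsto (fun n : ℕ => 1 / ((n : ℝ) + 1)) atTop (𝓝[>] 0) :=
    tendsto_nhdsWithin_iff.2 ⟨tendsto_one_div_add_atTop_nhds_zero_nat,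
      Eventually.of_forall fun n => by simp only [mem_Ioi]; positivity⟩
  simpa [Function.comp_def] using h3.comp h4

theorem HasL2Deriv.congr_ae {f g g' : ℝ → ℝ} (h : HasL2Deriv f g) (hg : g =ᵐ[unitVol] g') :
    HasL2Deriv f g' := by
  refine ⟨h.1.ae_eq hg, fun x hx => ?_⟩
  rw [h.2 x hx]
  congr 1
  rw [EventuallyEq, ae_restrict_iff' measurableSet_Ioo] at hg
  refine intervalIntegral.integral_congr_ae ?_
  have h1 : ∀ᵐ y : ℝ, y ≠ 1 := by simp [ae_iff, measure_singleton]
  filter_upwards [hg, h1] with y hy hy1 hyx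
  rw [uIoc_of_le hx.1] at hyx
  exact hy ⟨hyx.1, lt_of_le_of_ne (hyx.2.trans hx.2) hy1⟩

theorem HasL2Deriv.ae_eq {f g g' : ℝ → ℝ} (h : HasL2Deriv f g) (h' : HasL2Deriv f g') :
    g =ᵐ[unitVol] g' :=
  h.isPrimitiveOn.ae_eq h'.isPrimitiveOn

theorem integral_congr_ae_unit {f g : ℝ → ℝ} (h : f =ᵐ[unitVol] g) :
    ∫ x in (0 : ℝ)..1, f x = ∫ x in (0 : ℝ)..1, g x := by
  rw [intervalIntegral.integral_of_le zero_le_one, intervalIntegral.integral_of_le zero_le_one,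
    integral_Ioc_eq_integral_Ioo, integral_Ioc_eq_integral_Ioo]
  exact integral_congr_ae h

theorem HasL2Deriv.integral_add_le {f g : ℝ → ℝ} {C : ℝ} (h : HasL2Deriv f g)
    (hC : H1NormSqLE f C) :
    (∫ x in (0 : ℝ)..1, f x ^ 2) + (∫ x in (0 : ℝ)..1, g x ^ 2) ≤ C := by
  obtain ⟨g', h1, h2⟩ := hC
  rwa [integral_congr_ae_unit (f := fun x => g x ^ 2) (g := fun x => g' x ^ 2)
    ((h.ae_eq h1).fun_comp (· ^ 2))]

theorem HasL2Deriv.integral_sq_le {f g : ℝ → ℝ} {C : ℝ} (h : HasL2Deriv f g)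
    (hC : H1NormSqLE f C) : ∫ x in (0 : ℝ)..1, g x ^ 2 ≤ C := by
  have := h.integral_add_le hC
  have h0 : 0 ≤ ∫ x in (0 : ℝ)..1, f x ^ 2 :=
    intervalIntegral.integral_nonneg zero_le_one fun x _ => sq_nonneg _
  linarith

/-- Averaging `f(x)² ≤ 2 f(y)² + 2 ∫ g²` over `y` gives `f(x)² ≤ 2C`; the stated bound then follows
from `|f| ≤ 1 + f²`. -/
theorem H1NormSqLE.abs_le {f : ℝ → ℝ} {C : ℝ} (hC : H1NormSqLE f C) {x : ℝ}
    (hx : x ∈ Icc (0 : ℝ) 1) : |f x| ≤ 1 + 2 * C := by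
  obtain ⟨g, h, hle⟩ := hC
  have h1 : ∫ y in (0 : ℝ)..1, f x ^ 2 ≤
      ∫ y in (0 : ℝ)..1, (2 * f y ^ 2 + 2 * ∫ z in (0 : ℝ)..1, g z ^ 2) := by
    refine intervalIntegral.integral_mono_on zero_le_one (by simp)
      (((MemLp.intervalIntegrable_sq h.memLp).const_mul _).add (by simp)) fun y hy => ?_
    nlinarith [h.sq_sub_le hx hy, sq_nonneg (f x - 2 * f y)]
  rw [intervalIntegral.integral_add ((MemLp.intervalIntegrable_sq h.memLp).const_mul _) (by simp),
    intervalIntegral.integral_const_mul] at h1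
  simp only [intervalIntegral.integral_const, sub_zero, one_smul] at h1
  rw [_root_.abs_le]
  constructor <;> nlinarith [sq_nonneg (f x - 1), sq_nonneg (f x + 1)]

/-- The weak derivatives in `H1NormSqLE` are given one time at a time, with no joint measurability.
A limsup of difference quotients of a measurable modification is jointly measurable and equals the
derivative almost everywhere. -/
theorem MemLinftyLocH1.exists_deriv {f : ℝ≥0 → ℝ → ℝ} (h : MemLinftyLocH1 f) :
    ∃ g : ℝ → ℝ → ℝ, Measurable (Function.uncurry g) ∧
      ∀ᵐ s ∂(volume.restrict (Ioi (0 : ℝ))), HasL2Deriv (f s.toNNReal) (g s) := by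
  obtain ⟨hm, hC⟩ := h
  have hm' := hm
  rw [Measure.volume_eq_prod, ← Measure.prod_restrict] at hm'
  set F := hm'.mk _ with hF
  have hFm : Measurable F := hm'.stronglyMeasurable_mk.measurable
  have h1 := Measure.ae_ae_of_ae_prod hm'.ae_eq_mk
  have h2 : ∀ᵐ s ∂(volume.restrict (Ioi (0 : ℝ))), ∃ g, HasL2Deriv (f s.toNNReal) g := by
    refine ae_Ioi_of_forall_ae_Ioo fun n => ?_
    obtain ⟨C, hC⟩ := hC n
    filter_upwards [hC] with s ⟨g, hg, _⟩ using ⟨g, hg⟩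
  set q : ℕ → ℝ × ℝ → ℝ := fun n p =>
    ((n : ℝ) + 1) * (F (p.1, p.2 + 1 / ((n : ℝ) + 1)) - F p) with hq
  have hqm : ∀ n, Measurable (q n) := fun n => by
    refine Measurable.const_mul (Measurable.sub (hFm.comp ?_) hFm) _
    fun_prop
  refine ⟨fun s x => limsup (fun n => q n (s, x)) atTop, Measurable.limsup hqm, ?_⟩
  filter_upwards [h1, h2] with s hs ⟨g, hg⟩
  refine hg.congr_ae ?_
  have h3 : ∀ᵐ y : ℝ, y ∈ Ioo (0 : ℝ) 1 → f s.toNNReal y = F (s, y) := by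
    rw [← ae_restrict_iff' measurableSet_Ioo]; exact hs
  -- The modification agrees with `f` only up to a null set of points; translations preserve null
  -- sets, so countably many shifted null sets are discarded at once.
  have h4 : ∀ᵐ x : ℝ, ∀ n : ℕ, x + 1 / ((n : ℝ) + 1) ∈ Ioo (0 : ℝ) 1 →
      f s.toNNReal (x + 1 / ((n : ℝ) + 1)) = F (s, x + 1 / ((n : ℝ) + 1)) := by
    rw [ae_all_iff]
    intro n
    exact (measurePreserving_add_right volume (1 / ((n : ℝ) + 1))).quasiMeasurePreserving.ae h3
  filter_upwards [hg.ae_tendsto_slope, ae_restrict_of_ae h4, hs, ae_restrict_mem measurableSet_Ioo]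
    with x e1 e2 e3 hx
  refine (Tendsto.limsup_eq (e1.congr' ?_)).symm
  have h5 : ∀ᶠ n : ℕ in atTop, 1 / ((n : ℝ) + 1) < 1 - x :=
    tendsto_one_div_add_atTop_nhds_zero_nat.eventually_lt_const (by linarith [hx.2])
  filter_upwards [h5] with n hn
  have : 0 < 1 / ((n : ℝ) + 1) := by positivity
  rw [hq]
  simp only
  rw [e2 n ⟨by linarith [hx.1], by linarith⟩, e3]

/-- The regularity of a path of a strong solution on the time interval `(0,T)`, with explicit
space derivatives. -/
structure RegularOn (T C : ℝ) (ρ ρx u ux uxx : ℝ → ℝ → ℝ) : Prop where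
  nonneg : 0 ≤ C
  density : AEStronglyMeasurable (Function.uncurry ρ) (stripVol T)
  density_deriv : AEStronglyMeasurable (Function.uncurry ρx) (stripVol T)
  velocity : AEStronglyMeasurable (Function.uncurry u) (stripVol T)
  velocity_deriv : AEStronglyMeasurable (Function.uncurry ux) (stripVol T)
  velocity_deriv₂ : MemLp (Function.uncurry uxx) 2 (stripVol T)
  ae_time : ∀ᵐ s ∂timeVol T, HasL2Deriv (ρ s) (ρx s) ∧ HasL2Deriv (u s) (ux s) ∧
    HasL2Deriv (ux s) (uxx s) ∧ u s 0 = 0 ∧ u s 1 = 0 ∧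
    (∀ x ∈ Icc (0 : ℝ) 1, 0 < ρ s x ∧ ρ s x ≤ C ∧ |u s x| ≤ C) ∧
    ∫ x in (0 : ℝ)..1, ρx s x ^ 2 ≤ C ∧ ∫ x in (0 : ℝ)..1, ux s x ^ 2 ≤ C

theorem exists_regularOn {ρ u : ℝ≥0 → ℝ → ℝ} (hX : ∀ t, MemX (ρ t) (u t))
    (hρ : MemLinftyLocH1 ρ) (hu : MemLinftyLocH1 u) (hu₂ : MemL2LocH2 u) :
    ∃ ρx ux uxx : ℝ → ℝ → ℝ, ∀ T, ∃ C, RegularOn T C (fun s => ρ s.toNNReal) ρx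
      (fun s => u s.toNNReal) ux uxx := by
  obtain ⟨ρx, hρxm, hρx⟩ := hρ.exists_deriv
  obtain ⟨ux, uxx, hae, hL2⟩ := hu₂
  refine ⟨ρx, ux, uxx, fun T => ?_⟩
  obtain ⟨C₁, hC₁⟩ := hρ.2 T
  obtain ⟨C₂, hC₂⟩ := hu.2 T
  have hsub : Ioo (0 : ℝ) T ×ˢ Ioo (0 : ℝ) 1 ⊆ Ioi (0 : ℝ) ×ˢ Ioo (0 : ℝ) 1 :=
    prod_mono_left Ioo_subset_Ioi_self
  refine ⟨1 + 2 * |C₁| + 2 * |C₂|, by positivity, ?_, hρxm.aestronglyMeasurable, ?_, ?_, ?_, ?_⟩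
  · rw [← volume_restrict_strip]; exact hρ.1.mono_set hsub
  · rw [← volume_restrict_strip]; exact hu.1.mono_set hsub
  · rw [← volume_restrict_strip]; exact (hL2 T).2.1.1
  · rw [← volume_restrict_strip]; exact (hL2 T).2.2
  · filter_upwards [hC₁, hC₂, ae_Ioo_of_ae_Ioi T hρx, ae_Ioo_of_ae_Ioi T hae]
      with s h1 h2 h3 ⟨h4, h5⟩
    have a1 := le_abs_self C₁
    have a2 := le_abs_self C₂
    have b1 := abs_nonneg C₁
    have b2 := abs_nonneg C₂
    refine ⟨h3, h4, h5, (hX _).velocity_memH10.2.1, (hX _).velocity_memH10.2.2,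
      fun x hx => ⟨(hX _).pos x hx, ?_, ?_⟩, ?_, ?_⟩
    · have := (le_abs_self _).trans (h1.abs_le hx); linarith
    · have := h2.abs_le hx; linarith
    · have := h3.integral_sq_le h1; linarith
    · have := h4.integral_sq_le h2; linarith

/-! ### Integrability on the strip -/

theorem ae_prod_mem_of_ae_ae {α β γ : Type*} [MeasurableSpace α] [MeasurableSpace β]
    [TopologicalSpace γ] [TopologicalSpace.MetrizableSpace γ] [MeasurableSpace γ] [BorelSpace γ]
    {μ : Measure α} {ν : Measure β} [SFinite μ] [SFinite ν] {f : α × β → γ} {S : Set γ}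
    (hS : MeasurableSet S) (hf : AEStronglyMeasurable f (μ.prod ν))
    (h : ∀ᵐ a ∂μ, ∀ᵐ b ∂ν, f (a, b) ∈ S) : ∀ᵐ z ∂μ.prod ν, f z ∈ S := by
  have h1 : ∀ᵐ z ∂μ.prod ν, hf.mk f z ∈ S := by
    rw [Measure.ae_prod_iff_ae_ae (hf.stronglyMeasurable_mk.measurable hS)]
    filter_upwards [h, Measure.ae_ae_of_ae_prod hf.ae_eq_mk] with a h1 h2
    filter_upwards [h1, h2] with b e1 e2
    rwa [← e2]
  filter_upwards [h1, hf.ae_eq_mk] with z e1 e2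
  rwa [e2]

/-- A bound in `L^∞` in time with values in `L²` gives square integrability on the bounded strip, by
Fubini. -/
theorem memLp_strip_of_integral_sq_le {T C : ℝ} {g : ℝ → ℝ → ℝ}
    (hg : AEStronglyMeasurable (Function.uncurry g) (stripVol T))
    (h : ∀ᵐ s ∂timeVol T, MemLp (g s) 2 unitVol ∧ ∫ x in (0 : ℝ)..1, g s x ^ 2 ≤ C) :
    MemLp (Function.uncurry g) 2 (stripVol T) := by
  have hm : AEStronglyMeasurable (fun p => Function.uncurry g p ^ 2) (stripVol T) := hg.pow 2
  rw [memLp_two_iff_integrable_sq hg, integrable_prod_iff hm]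
  refine ⟨?_, ?_⟩
  · filter_upwards [h] with s hs using hs.1.integrable_sq
  · refine Integrable.of_bound (hm.norm.integral_prod_right') C ?_
    filter_upwards [h] with s hs
    simp only [Function.uncurry_apply_pair, norm_pow, Real.norm_eq_abs, sq_abs]
    rw [abs_of_nonneg (integral_nonneg fun x => sq_nonneg _), ← integral_Ioc_eq_integral_Ioo,
      ← intervalIntegral.integral_of_le zero_le_one]
    exact hs.2

theorem memLp_mul_of_bounded {α : Type*} [MeasurableSpace α] {μ : Measure α} {f g : α → ℝ} {C : ℝ}
    (hf : MemLp f 2 μ) (hg : AEStronglyMeasurable g μ) (hC : ∀ᵐ a ∂μ, |g a| ≤ C) :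
    MemLp (fun a => f a * g a) 2 μ :=
  (memLp_top_of_bound hg C hC).mul hf

namespace RegularOn

variable {T C : ℝ} {ρ ρx u ux uxx : ℝ → ℝ → ℝ}

theorem ae_abs_density_le (h : RegularOn T C ρ ρx u ux uxx) :
    ∀ᵐ p ∂stripVol T, |Function.uncurry ρ p| ≤ C := by
  refine (ae_prod_mem_of_ae_ae (S := Icc (-C) C) measurableSet_Icc h.density ?_).mono
    fun p hp => abs_le.2 hp
  filter_upwards [h.ae_time] with s hs
  filter_upwards [ae_restrict_mem measurableSet_Ioo] with x hx
  have := hs.2.2.2.2.2.1 x (Ioo_subset_Icc_self hx)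
  exact abs_le.1 (by rw [Function.uncurry_apply_pair, abs_of_pos this.1]; exact this.2.1)

theorem ae_abs_velocity_le (h : RegularOn T C ρ ρx u ux uxx) :
    ∀ᵐ p ∂stripVol T, |Function.uncurry u p| ≤ C := by
  refine (ae_prod_mem_of_ae_ae (S := Icc (-C) C) measurableSet_Icc h.velocity ?_).mono
    fun p hp => abs_le.2 hp
  filter_upwards [h.ae_time] with s hs
  filter_upwards [ae_restrict_mem measurableSet_Ioo] with x hx
  exact abs_le.1 (hs.2.2.2.2.2.1 x (Ioo_subset_Icc_self hx)).2.2

theorem memLp_density_deriv (h : RegularOn T C ρ ρx u ux uxx) :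
    MemLp (Function.uncurry ρx) 2 (stripVol T) :=
  memLp_strip_of_integral_sq_le h.density_deriv
    (h.ae_time.mono fun _ hs => ⟨hs.1.1, hs.2.2.2.2.2.2.1⟩)

theorem memLp_velocity_deriv (h : RegularOn T C ρ ρx u ux uxx) :
    MemLp (Function.uncurry ux) 2 (stripVol T) :=
  memLp_strip_of_integral_sq_le h.velocity_deriv
    (h.ae_time.mono fun _ hs => ⟨hs.2.1.1, hs.2.2.2.2.2.2.2⟩)

theorem memLp_flux (h : RegularOn T C ρ ρx u ux uxx) :
    MemLp (fun p : ℝ × ℝ => -(ρx p.1 p.2 * u p.1 p.2 + ρ p.1 p.2 * ux p.1 p.2)) 2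
      (stripVol T) := by
  have h1 := memLp_mul_of_bounded h.memLp_density_deriv h.velocity h.ae_abs_velocity_le
  have h2 := memLp_mul_of_bounded h.memLp_velocity_deriv h.density h.ae_abs_density_le
  refine (h1.add h2).neg.congr_norm ?_ (Eventually.of_forall fun p => ?_)
  · exact ((h.density_deriv.mul h.velocity).add (h.density.mul h.velocity_deriv)).neg
  · simp [Function.uncurry, mul_comm]

theorem memLp_force (h : RegularOn T C ρ ρx u ux uxx) (A : ℝ) :
    MemLp (fun p : ℝ × ℝ => -(ρx p.1 p.2 * u p.1 p.2 ^ 2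
      + 2 * ρ p.1 p.2 * u p.1 p.2 * ux p.1 p.2) - A ^ 2 * ρx p.1 p.2 + uxx p.1 p.2) 2
      (stripVol T) := by
  have h1 := memLp_mul_of_bounded (memLp_mul_of_bounded h.memLp_density_deriv h.velocity
    h.ae_abs_velocity_le) h.velocity h.ae_abs_velocity_le
  have h2 := memLp_mul_of_bounded (memLp_mul_of_bounded h.memLp_velocity_deriv h.density
    h.ae_abs_density_le) h.velocity h.ae_abs_velocity_le
  have := (((h1.add (h2.const_mul 2)).neg.sub (h.memLp_density_deriv.const_mul (A ^ 2))).add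
    h.velocity_deriv₂)
  refine (memLp_congr_ae (Eventually.of_forall fun p => ?_)).1 this
  simp only [Function.uncurry, Pi.add_apply, Pi.neg_apply, Pi.sub_apply]
  ring

end RegularOn

theorem integrable_strip_restrict {T t a b : ℝ} {G : ℝ → ℝ → ℝ} (ht : t ∈ Icc 0 T)
    (ha : a ∈ Icc (0 : ℝ) 1) (hb : b ∈ Icc (0 : ℝ) 1)
    (hG : Integrable (Function.uncurry G) (stripVol T)) :
    Integrable (Function.uncurry G)
      ((volume.restrict (Ioc 0 t)).prod (volume.restrict (Ioc a b))) := by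
  rw [Measure.restrict_congr_set (Ioo_ae_eq_Ioc (a := (0 : ℝ)) (b := t)).symm,
    Measure.restrict_congr_set (Ioo_ae_eq_Ioc (a := a) (b := b)).symm, Measure.prod_restrict]
  rw [stripVol, Measure.prod_restrict] at hG
  exact IntegrableOn.mono_set hG
    (prod_mono (Ioo_subset_Ioo_right ht.2) (Ioo_subset_Ioo ha.1 hb.2))

theorem integral_strip_swap {T t a b : ℝ} {G : ℝ → ℝ → ℝ} (ht : t ∈ Icc 0 T)
    (ha : a ∈ Icc (0 : ℝ) 1) (hb : b ∈ Icc (0 : ℝ) 1) (hab : a ≤ b)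
    (hG : Integrable (Function.uncurry G) (stripVol T)) :
    ∫ x in a..b, ∫ s in (0 : ℝ)..t, G s x = ∫ s in (0 : ℝ)..t, ∫ x in a..b, G s x := by
  simp_rw [intervalIntegral.integral_of_le hab, intervalIntegral.integral_of_le ht.1]
  exact (integral_integral_swap (integrable_strip_restrict ht ha hb hG)).symm

theorem intervalIntegrable_integral_strip {T a b : ℝ} {G : ℝ → ℝ → ℝ} (hT : 0 ≤ T)
    (ha : a ∈ Icc (0 : ℝ) 1) (hb : b ∈ Icc (0 : ℝ) 1) (hab : a ≤ b)
    (hG : Integrable (Function.uncurry G) (stripVol T)) :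
    IntervalIntegrable (fun s => ∫ x in a..b, G s x) volume 0 T := by
  rw [intervalIntegrable_iff_integrableOn_Ioc_of_le hT]
  simp_rw [intervalIntegral.integral_of_le hab]
  exact (integrable_strip_restrict ⟨hT, le_rfl⟩ ha hb hG).integral_prod_left

theorem intervalIntegrable_integral_time {T t : ℝ} {G : ℝ → ℝ → ℝ} (ht : t ∈ Icc 0 T)
    (hG : Integrable (Function.uncurry G) (stripVol T)) :
    IntervalIntegrable (fun x => ∫ s in (0 : ℝ)..t, G s x) volume 0 1 := by
  rw [intervalIntegrable_iff_integrableOn_Ioc_of_le zero_le_one]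
  simp_rw [intervalIntegral.integral_of_le ht.1]
  exact (integrable_strip_restrict ht ⟨le_rfl, zero_le_one⟩ ⟨zero_le_one, le_rfl⟩
    hG).integral_prod_right

theorem ae_intervalIntegrable_time {T : ℝ} {G : ℝ → ℝ → ℝ} (hT : 0 ≤ T)
    (hG : Integrable (Function.uncurry G) (stripVol T)) :
    ∀ᵐ x ∂unitVol, IntervalIntegrable (fun s => G s x) volume 0 T := by
  filter_upwards [hG.prod_left_ae] with x hx
  rwa [intervalIntegrable_iff_integrableOn_Ioo_of_le hT]

theorem ae_intervalIntegrable_space {T : ℝ} {G : ℝ → ℝ → ℝ}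
    (hG : Integrable (Function.uncurry G) (stripVol T)) :
    ∀ᵐ s ∂timeVol T, IntervalIntegrable (G s) volume 0 1 := by
  filter_upwards [hG.prod_right_ae] with s hs
  rwa [intervalIntegrable_iff_integrableOn_Ioo_of_le zero_le_one]

theorem integral_congr_ae_time {T t : ℝ} {f g : ℝ → ℝ} (ht : t ∈ Icc 0 T)
    (h : ∀ᵐ s ∂timeVol T, f s = g s) : ∫ s in (0 : ℝ)..t, f s = ∫ s in (0 : ℝ)..t, g s := by
  rw [intervalIntegral.integral_of_le ht.1, intervalIntegral.integral_of_le ht.1,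
    integral_Ioc_eq_integral_Ioo, integral_Ioc_eq_integral_Ioo]
  exact integral_congr_ae (ae_restrict_of_ae_restrict_of_subset (Ioo_subset_Ioo_right ht.2) h)

/-! ### A countable family of test functions -/

/-- Index set of the smooth plateau functions: the end points of the plateau and its steepness. -/
abbrev PlateauIndex : Type := {i : ℚ × ℚ × ℕ // 0 < i.1 ∧ i.1 < i.2.1 ∧ i.2.1 < 1}

/-- A smooth function supported in `[p,q]` which approximates the indicator of `(p,q)`. -/
noncomputable def plateau (i : PlateauIndex) (x : ℝ) : ℝ :=
  Real.smoothTransition (i.1.2.2 * (x - i.1.1)) * Real.smoothTransition (i.1.2.2 * (i.1.2.1 - x))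

theorem support_plateau_subset (i : PlateauIndex) :
    Function.support (plateau i) ⊆ Icc (i.1.1 : ℝ) i.1.2.1 := by
  intro x hx
  by_contra h
  refine hx ?_
  rw [mem_Icc, not_and_or, not_le, not_le] at h
  rw [plateau]
  rcases h with h | h
  · rw [Real.smoothTransition.zero_of_nonpos, zero_mul]
    exact mul_nonpos_of_nonneg_of_nonpos (Nat.cast_nonneg _) (by linarith)
  · rw [Real.smoothTransition.zero_of_nonpos (x := _ * (_ - x)), mul_zero]
    exact mul_nonpos_of_nonneg_of_nonpos (Nat.cast_nonneg _) (by linarith)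

theorem isTestFunction_plateau (i : PlateauIndex) : IsTestFunction (plateau i) := by
  have h0 : (0 : ℝ) < i.1.1 := by exact_mod_cast i.2.1
  have h1 : (i.1.2.1 : ℝ) < 1 := by exact_mod_cast i.2.2.2
  refine ⟨?_, HasCompactSupport.of_support_subset_isCompact isCompact_Icc
    (support_plateau_subset i), ?_⟩
  · have e : ContDiff ℝ ((⊤ : ℕ∞) : WithTop ℕ∞) Real.smoothTransition :=
      Real.smoothTransition.contDiff
    unfold plateau
    exact (e.comp (by fun_prop)).mul (e.comp (by fun_prop))
  · exact (closure_minimal (support_plateau_subset i) isClosed_Icc).trans fun x hx =>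
      ⟨h0.trans_le hx.1, hx.2.trans_lt h1⟩

theorem abs_plateau_le (i : PlateauIndex) (x : ℝ) : |plateau i x| ≤ 1 := by
  have h1 := Real.smoothTransition.nonneg (i.1.2.2 * (x - i.1.1))
  have h2 := Real.smoothTransition.nonneg (i.1.2.2 * (i.1.2.1 - x))
  rw [plateau, abs_of_nonneg (mul_nonneg h1 h2)]
  exact mul_le_one₀ (Real.smoothTransition.le_one _) h2 (Real.smoothTransition.le_one _)

theorem continuous_plateau (i : PlateauIndex) : Continuous (plateau i) :=
  (isTestFunction_plateau i).1.continuous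

theorem tendsto_plateau {p q : ℚ} (hp : 0 < p) (hpq : p < q) (hq : q < 1) (x : ℝ) :
    Tendsto (fun n : ℕ => plateau ⟨(p, q, n), hp, hpq, hq⟩ x) atTop
      (𝓝 ((Ioo (p : ℝ) q).indicator 1 x)) := by
  by_cases hx : x ∈ Ioo (p : ℝ) q
  · rw [indicator_of_mem hx, Pi.one_apply]
    refine tendsto_const_nhds.congr' ?_
    have h1 : Tendsto (fun n : ℕ => (n : ℝ) * (x - p)) atTop atTop :=
      tendsto_natCast_atTop_atTop.atTop_mul_const (by linarith [hx.1])
    have h2 : Tendsto (fun n : ℕ => (n : ℝ) * (q - x)) atTop atTop :=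
      tendsto_natCast_atTop_atTop.atTop_mul_const (by linarith [hx.2])
    filter_upwards [h1.eventually_ge_atTop 1, h2.eventually_ge_atTop 1] with n e1 e2
    rw [plateau, Real.smoothTransition.one_of_one_le e1, Real.smoothTransition.one_of_one_le e2,
      one_mul]
  · rw [indicator_of_notMem hx]
    refine tendsto_const_nhds.congr fun n => ?_
    rw [mem_Ioo, not_and_or, not_lt, not_lt] at hx
    rw [plateau]
    rcases hx with h | h
    · rw [Real.smoothTransition.zero_of_nonpos, zero_mul]
      exact mul_nonpos_of_nonneg_of_nonpos (Nat.cast_nonneg _) (by simp only; linarith)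
    · rw [Real.smoothTransition.zero_of_nonpos (x := _ * (_ - x)), mul_zero]
      exact mul_nonpos_of_nonneg_of_nonpos (Nat.cast_nonneg _) (by simp only; linarith)

/-- Letting the plateaus steepen gives `∫_p^q f = 0` for rational `p < q` in `(0,1)`. The primitive
of `f` is then constant, by density and continuity, and its derivative vanishes almost everywhere.
The index set is countable, so the exceptional null sets of paths attached to the test functions can
be united. -/
theorem ae_eq_zero_of_forall_plateau {f : ℝ → ℝ} (hf : IntervalIntegrable f volume 0 1)
    (h : ∀ i, ∫ x in (0 : ℝ)..1, f x * plateau i x = 0) : f =ᵐ[unitVol] 0 := by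
  set F : ℝ → ℝ := fun x => ∫ y in (0 : ℝ)..x, f y with hF
  have hP : IsPrimitiveOn 1 F f := by simpa [hF] using isPrimitiveOn_integral 0 hf
  have h1 : ∀ p q : ℚ, 0 < p → p < q → q < 1 → F p = F q := by
    intro p q hp hpq hq
    have hp' : (0 : ℝ) < p := by exact_mod_cast hp
    have hpq' : (p : ℝ) < q := by exact_mod_cast hpq
    have hq' : (q : ℝ) < 1 := by exact_mod_cast hq
    have e1 : Tendsto (fun n : ℕ => ∫ x in (0 : ℝ)..1, f x * plateau ⟨(p, q, n), hp, hpq, hq⟩ x)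
        atTop (𝓝 (∫ x in (0 : ℝ)..1, f x * (Ioo (p : ℝ) q).indicator 1 x)) := by
      refine intervalIntegral.tendsto_integral_filter_of_dominated_convergence (fun x => |f x|)
        (Eventually.of_forall fun n => ?_) (Eventually.of_forall fun n => ?_) hf.abs
        (Eventually.of_forall fun x _ => (tendsto_plateau hp hpq hq x).const_mul _)
      · exact hf.def'.aestronglyMeasurable.mul (continuous_plateau _).aestronglyMeasurable
      · refine Eventually.of_forall fun x _ => ?_
        rw [norm_mul]
        exact mul_le_of_le_one_right (norm_nonneg _) (abs_plateau_le _ _)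
    simp_rw [h] at e1
    have e2 := tendsto_nhds_unique e1 tendsto_const_nhds
    have e3 : ∀ x, f x * (Ioo (p : ℝ) q).indicator 1 x = (Ioo (p : ℝ) q).indicator f x :=
      fun x => by by_cases hx : x ∈ Ioo (p : ℝ) q <;> simp [hx]
    simp_rw [e3] at e2
    rw [intervalIntegral.integral_of_le zero_le_one, setIntegral_indicator measurableSet_Ioo,
      inter_eq_right.2 (show Ioo (p : ℝ) q ⊆ Ioc 0 1 from
        fun x hx => ⟨hp'.trans hx.1, (hx.2.trans hq').le⟩),
      ← integral_Ioc_eq_integral_Ioo, ← intervalIntegral.integral_of_le hpq'.le,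
      hP.integral_eq_sub ⟨hp'.le, (hpq'.trans hq').le⟩ ⟨(hp'.trans hpq').le, hq'.le⟩] at e2
    linarith
  have h2 : EqOn F (fun _ => F (1 / 2 : ℚ)) (Icc 0 1) := by
    have hcl : Icc (0 : ℝ) 1 ⊆ closure (Ioo (0 : ℝ) 1 ∩ range ((↑) : ℚ → ℝ)) := by
      rw [← closure_Ioo (zero_ne_one)]
      exact closure_minimal (Rat.denseRange_cast.open_subset_closure_inter isOpen_Ioo)
        isClosed_closure
    refine EqOn.of_subset_closure ?_ hP.continuousOn continuousOn_const
      (inter_subset_left.trans Ioo_subset_Icc_self) hcl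
    rintro _ ⟨hx, p, rfl⟩
    have hp0 : 0 < p := by exact_mod_cast hx.1
    have hp1 : p < 1 := by exact_mod_cast hx.2
    rcases lt_trichotomy p (1 / 2) with hlt | heq | hgt
    · exact h1 p _ hp0 hlt (by norm_num)
    · rw [heq]
    · exact (h1 _ p (by norm_num) hgt hp1).symm
  have hP0 : IsPrimitiveOn 1 F (fun _ => 0) := by
    refine ⟨by simp, fun x hx => ?_⟩
    rw [h2 hx, h2 (left_mem_Icc.2 zero_le_one)]
    simp
  exact hP.ae_eq hP0

/-- Fubini moves the time integral inside the space integral, after which the difference of the two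
sides is orthogonal to all plateaus. -/
theorem ae_eq_of_forall_plateau {T t : ℝ} {G : ℝ → ℝ → ℝ} {f f₀ : ℝ → ℝ} (ht : t ∈ Icc 0 T)
    (hG : Integrable (Function.uncurry G) (stripVol T)) (hf : IntervalIntegrable f volume 0 1)
    (hf₀ : IntervalIntegrable f₀ volume 0 1)
    (h : ∀ i, ∫ x in (0 : ℝ)..1, f x * plateau i x = (∫ x in (0 : ℝ)..1, f₀ x * plateau i x) +
      ∫ s in (0 : ℝ)..t, ∫ x in (0 : ℝ)..1, G s x * plateau i x) :
    ∀ᵐ x ∂unitVol, f x = f₀ x + ∫ s in (0 : ℝ)..t, G s x := by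
  have hGt := intervalIntegrable_integral_time ht hG
  have key := ae_eq_zero_of_forall_plateau ((hf.sub hf₀).sub hGt) fun i => by
    have hc := (continuous_plateau i).continuousOn (s := uIcc 0 1)
    have hGφ : Integrable (Function.uncurry fun s x => G s x * plateau i x) (stripVol T) := by
      have hφ : AEStronglyMeasurable (fun p : ℝ × ℝ => plateau i p.2) (stripVol T) :=
        ((continuous_plateau i).comp continuous_snd).aestronglyMeasurable
      exact hG.mul_bdd hφ (Eventually.of_forall fun p => abs_plateau_le i _)
    have e := integral_strip_swap ht (left_mem_Icc.2 zero_le_one) (right_mem_Icc.2 zero_le_one)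
      zero_le_one hGφ
    simp_rw [intervalIntegral.integral_mul_const] at e
    have := h i
    rw [← e] at this
    simp_rw [sub_mul]
    rw [intervalIntegral.integral_sub ((hf.mul_continuousOn hc).sub (hf₀.mul_continuousOn hc))
      (hGt.mul_continuousOn hc),
      intervalIntegral.integral_sub (hf.mul_continuousOn hc) (hf₀.mul_continuousOn hc)]
    linarith
  filter_upwards [key] with x hx
  simp only [Pi.zero_apply] at hx
  linarith

/-! ### The equations in pointwise form -/

namespace IsTestFunction

variable {φ : ℝ → ℝ}

theorem apply_zero (h : IsTestFunction φ) : φ 0 = 0 :=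
  image_eq_zero_of_notMem_tsupport fun h0 => lt_irrefl _ (h.2.2 h0).1

theorem apply_one (h : IsTestFunction φ) : φ 1 = 0 :=
  image_eq_zero_of_notMem_tsupport fun h0 => lt_irrefl _ (h.2.2 h0).2

theorem deriv (h : IsTestFunction φ) : IsTestFunction (deriv φ) :=
  ⟨(contDiff_infty_iff_deriv.1 h.1).2, h.2.1.deriv,
    (closure_minimal support_deriv_subset (isClosed_tsupport _)).trans h.2.2⟩

theorem isPrimitiveOn (h : IsTestFunction φ) : IsPrimitiveOn 1 φ (_root_.deriv φ) := by
  have hc : Continuous (_root_.deriv φ) := h.deriv.1.continuous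
  refine ⟨hc.intervalIntegrable _ _, fun x _ => ?_⟩
  rw [intervalIntegral.integral_deriv_eq_sub
    (fun y _ => (h.1.differentiable (by simp)).differentiableAt) (hc.intervalIntegrable _ _)]
  ring

theorem integral_mul_deriv {f f' : ℝ → ℝ} (h : IsTestFunction φ) (hf : IsPrimitiveOn 1 f f') :
    ∫ x in (0 : ℝ)..1, f x * _root_.deriv φ x = ∫ x in (0 : ℝ)..1, -f' x * φ x := by
  have h1 := (hf.mul zero_le_one h.isPrimitiveOn).integral_eq_sub (left_mem_Icc.2 zero_le_one)
    (right_mem_Icc.2 zero_le_one)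
  rw [h.apply_zero, h.apply_one, mul_zero, mul_zero, sub_zero, intervalIntegral.integral_add
    (hf.1.mul_continuousOn h.1.continuous.continuousOn)
    (h.isPrimitiveOn.1.continuousOn_mul (by
      rw [uIcc_of_le zero_le_one]; exact hf.continuousOn))] at h1
  simp_rw [neg_mul]
  rw [intervalIntegral.integral_neg]
  linarith

end IsTestFunction

/-- The time derivative `-(ρu)_x` of the density. -/
def densityRate (ρ ρx u ux : ℝ → ℝ → ℝ) (s x : ℝ) : ℝ :=
  -(ρx s x * u s x + ρ s x * ux s x)

/-- The deterministic part `-(ρu²)_x - A²ρ_x + u_xx` of the momentum balance. -/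
def momentumRate (A : ℝ) (ρ ρx u ux uxx : ℝ → ℝ → ℝ) (s x : ℝ) : ℝ :=
  -(ρx s x * u s x ^ 2 + 2 * ρ s x * u s x * ux s x) - A ^ 2 * ρx s x + uxx s x

namespace RegularOn

variable {T C : ℝ} {ρ ρx u ux uxx : ℝ → ℝ → ℝ}

theorem integrable_densityRate (h : RegularOn T C ρ ρx u ux uxx) :
    Integrable (Function.uncurry (densityRate ρ ρx u ux)) (stripVol T) :=
  h.memLp_flux.integrable (by norm_num)

theorem integrable_momentumRate (h : RegularOn T C ρ ρx u ux uxx) (A : ℝ) :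
    Integrable (Function.uncurry (momentumRate A ρ ρx u ux uxx)) (stripVol T) :=
  (h.memLp_force A).integrable (by norm_num)

theorem ae_integral_mul_deriv (h : RegularOn T C ρ ρx u ux uxx) {φ : ℝ → ℝ}
    (hφ : IsTestFunction φ) : ∀ᵐ s ∂timeVol T,
      ∫ x in (0 : ℝ)..1, ρ s x * u s x * deriv φ x =
        ∫ x in (0 : ℝ)..1, densityRate ρ ρx u ux s x * φ x := by
  filter_upwards [h.ae_time] with s hs
  exact hφ.integral_mul_deriv (hs.1.isPrimitiveOn.mul zero_le_one hs.2.1.isPrimitiveOn)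

theorem ae_integral_momentum (h : RegularOn T C ρ ρx u ux uxx) (A : ℝ) {φ : ℝ → ℝ}
    (hφ : IsTestFunction φ) : ∀ᵐ s ∂timeVol T,
      ∫ x in (0 : ℝ)..1, ((ρ s x * u s x ^ 2 + A ^ 2 * ρ s x) * deriv φ x +
        u s x * deriv (deriv φ) x) =
        ∫ x in (0 : ℝ)..1, momentumRate A ρ ρx u ux uxx s x * φ x := by
  filter_upwards [h.ae_time] with s hs
  have pρ := hs.1.isPrimitiveOn
  have pu := hs.2.1.isPrimitiveOn
  have pux := hs.2.2.1.isPrimitiveOn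
  have p1 := ((pρ.mul zero_le_one (pu.mul zero_le_one pu)).add (pρ.const_mul (A ^ 2))).sub pux
  have e1 := hφ.deriv.integral_mul_deriv pu
  have e2 := hφ.integral_mul_deriv p1
  have c0 : uIcc (0 : ℝ) 1 = Icc 0 1 := uIcc_of_le zero_le_one
  have cρ : ContinuousOn (ρ s) (uIcc 0 1) := c0 ▸ pρ.continuousOn
  have cu : ContinuousOn (u s) (uIcc 0 1) := c0 ▸ pu.continuousOn
  have cux : ContinuousOn (ux s) (uIcc 0 1) := c0 ▸ pux.continuousOn
  have cφ' : ContinuousOn (deriv φ) (uIcc 0 1) := hφ.deriv.1.continuous.continuousOn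
  have cφ'' : ContinuousOn (deriv (deriv φ)) (uIcc 0 1) := hφ.deriv.deriv.1.continuous.continuousOn
  have i1 : IntervalIntegrable (fun x => (ρ s x * u s x ^ 2 + A ^ 2 * ρ s x) * deriv φ x)
      volume 0 1 := by
    apply ContinuousOn.intervalIntegrable; fun_prop
  have i2 : IntervalIntegrable (fun x => u s x * deriv (deriv φ) x) volume 0 1 := by
    apply ContinuousOn.intervalIntegrable; fun_prop
  have i3 : IntervalIntegrable (fun x => -ux s x * deriv φ x) volume 0 1 := by
    apply ContinuousOn.intervalIntegrable; fun_prop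
  rw [intervalIntegral.integral_add i1 i2, e1, ← intervalIntegral.integral_add i1 i3]
  calc _ = ∫ x in (0 : ℝ)..1, (ρ s x * (u s x * u s x) + A ^ 2 * ρ s x - ux s x) * deriv φ x :=
        intervalIntegral.integral_congr fun x _ => by ring
    _ = _ := by
        rw [e2]
        exact intervalIntegral.integral_congr fun x _ => by simp only [momentumRate]; ring

end RegularOn

theorem MemX.density_intervalIntegrable {ρ u : ℝ → ℝ} (h : MemX ρ u) :
    IntervalIntegrable ρ volume 0 1 := by
  obtain ⟨g, hg⟩ := h.density_memH1
  exact MemLp.intervalIntegrable_unit hg.memLp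

theorem MemX.density_continuousOn {ρ u : ℝ → ℝ} (h : MemX ρ u) : ContinuousOn ρ (Icc 0 1) := by
  obtain ⟨g, hg⟩ := h.density_memH1
  exact hg.continuousOn

theorem MemX.velocity_continuousOn {ρ u : ℝ → ℝ} (h : MemX ρ u) : ContinuousOn u (Icc 0 1) := by
  obtain ⟨g, hg⟩ := h.velocity_memH10.1
  exact hg.continuousOn

/-- Valid at every `t`, although the regularity holds only at almost every time: the equation holds
at every `t`, and regularity is used only under the time integral. The null set of points depends on
`t`. -/
theorem ContinuityEquation.ae_density_eq {T C : ℝ} {ρ u : ℝ≥0 → ℝ → ℝ} {ρx ux uxx : ℝ → ℝ → ℝ}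
    (hc : ContinuityEquation ρ u) (hX : ∀ t, MemX (ρ t) (u t))
    (hr : RegularOn T C (fun s => ρ s.toNNReal) ρx (fun s => u s.toNNReal) ux uxx) {t : ℝ}
    (ht : t ∈ Icc 0 T) :
    ∀ᵐ x ∂unitVol, ρ t.toNNReal x = ρ 0 x + ∫ s in (0 : ℝ)..t,
      densityRate (fun s => ρ s.toNNReal) ρx (fun s => u s.toNNReal) ux s x := by
  refine ae_eq_of_forall_plateau ht hr.integrable_densityRate (hX _).density_intervalIntegrable
    (hX _).density_intervalIntegrable fun i => ?_
  have hφ := isTestFunction_plateau i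
  rw [hc _ hφ, Real.coe_toNNReal _ ht.1]
  congr 1
  exact integral_congr_ae_time ht (hr.ae_integral_mul_deriv hφ)

/-! ### Lower bound for the density -/

/-- Integrating `|g| ≤ lam g² + 1/lam` replaces the Hölder-1/2 modulus of continuity; `lam` stays
free so that the first term can be made small. -/
theorem HasL2Deriv.abs_sub_le {f g : ℝ → ℝ} (h : HasL2Deriv f g) {lam : ℝ} (hlam : 0 < lam)
    {x y : ℝ} (hx : x ∈ Icc (0 : ℝ) 1) (hy : y ∈ Icc (0 : ℝ) 1) :
    |f x - f y| ≤ lam * (∫ z in (0 : ℝ)..1, g z ^ 2) + |x - y| / lam := by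
  wlog hxy : y ≤ x generalizing x y
  · rw [abs_sub_comm, abs_sub_comm x]
    exact this hy hx (le_of_not_ge hxy)
  have hsq := MemLp.intervalIntegrable_sq h.1
  have hg := MemLp.intervalIntegrable_unit h.1
  have hsub : uIcc y x ⊆ uIcc 0 1 := by
    rw [uIcc_of_le hxy, uIcc_of_le zero_le_one]; exact Icc_subset_Icc hy.1 hx.2
  rw [← h.isPrimitiveOn.integral_eq_sub hy hx, abs_of_nonneg (sub_nonneg.2 hxy)]
  calc |∫ z in y..x, g z| ≤ ∫ z in y..x, |g z| :=
        intervalIntegral.abs_integral_le_integral_abs hxy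
    _ ≤ ∫ z in y..x, (lam * g z ^ 2 + 1 / lam) := by
        refine intervalIntegral.integral_mono_on hxy (hg.abs.mono_set hsub)
          (((hsq.mono_set hsub).const_mul _).add (by simp)) fun z _ => ?_
        have : 0 ≤ (lam * |g z| - 1) ^ 2 / lam := by positivity
        have e : (lam * |g z| - 1) ^ 2 / lam = lam * |g z| ^ 2 + 1 / lam - 2 * |g z| := by
          field_simp; ring
        rw [sq_abs] at e
        linarith [abs_nonneg (g z)]
    _ = lam * (∫ z in y..x, g z ^ 2) + (x - y) / lam := by
        rw [intervalIntegral.integral_add ((hsq.mono_set hsub).const_mul _) (by simp),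
          intervalIntegral.integral_const_mul, intervalIntegral.integral_const]
        simp [div_eq_mul_inv]
    _ ≤ _ := by
        have : ∫ z in y..x, g z ^ 2 ≤ ∫ z in (0 : ℝ)..1, g z ^ 2 :=
          intervalIntegral.integral_mono_interval hy.1 hxy hx.2
            (Eventually.of_forall fun z => sq_nonneg _) hsq
        gcongr

theorem ContinuityEquation.continuousOn_integral {T C : ℝ} {ρ u : ℝ≥0 → ℝ → ℝ}
    {ρx ux uxx : ℝ → ℝ → ℝ} (hc : ContinuityEquation ρ u) (hX : ∀ t, MemX (ρ t) (u t))
    (hr : RegularOn T C (fun s => ρ s.toNNReal) ρx (fun s => u s.toNNReal) ux uxx) {a b : ℝ}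
    (ha : a ∈ Icc (0 : ℝ) 1) (hb : b ∈ Icc (0 : ℝ) 1) (hab : a ≤ b) :
    ContinuousOn (fun t : ℝ => ∫ x in a..b, ρ t.toNNReal x) (Icc 0 T) := by
  rcases lt_or_ge T 0 with hT | hT
  · simp [Icc_eq_empty_of_lt hT]
  set G := densityRate (fun s => ρ s.toNNReal) ρx (fun s => u s.toNNReal) ux with hG
  have hGi := hr.integrable_densityRate
  have h1 := isPrimitiveOn_integral (∫ x in a..b, ρ 0 x)
    (intervalIntegrable_integral_strip hT ha hb hab hGi)
  refine h1.continuousOn.congr fun t ht => ?_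
  have hsub : uIcc a b ⊆ uIcc 0 1 := by
    rw [uIcc_of_le hab, uIcc_of_le zero_le_one]; exact Icc_subset_Icc ha.1 hb.2
  have e1 : ∫ x in a..b, ρ t.toNNReal x = ∫ x in a..b, (ρ 0 x + ∫ s in (0 : ℝ)..t, G s x) := by
    rw [intervalIntegral.integral_of_le hab, intervalIntegral.integral_of_le hab,
      integral_Ioc_eq_integral_Ioo, integral_Ioc_eq_integral_Ioo]
    exact integral_congr_ae (ae_restrict_of_ae_restrict_of_subset (Ioo_subset_Ioo ha.1 hb.2)
      (hc.ae_density_eq hX hr ht))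
  rw [e1, intervalIntegral.integral_add ((hX 0).density_intervalIntegrable.mono_set hsub)
    ((intervalIntegrable_integral_time ht hGi).mono_set hsub), integral_strip_swap ht ha hb hab hGi]

/-- The density is not assumed continuous in time in the sup norm, so positivity at each time gives
no uniform bound by itself. The mass of each small cell is continuous in time, however, and the `H¹`
bound controls the oscillation inside a cell, turning a lower bound for the mass into a pointwise
one. The `H¹` bound is available only at almost every time and therefore enters as a premise on `s`.
-/
theorem ContinuityEquation.exists_local_lower_bound {T C : ℝ} {ρ u : ℝ≥0 → ℝ → ℝ}
    {ρx ux uxx : ℝ → ℝ → ℝ} (hc : ContinuityEquation ρ u) (hX : ∀ t, MemX (ρ t) (u t))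
    (hr : RegularOn T C (fun s => ρ s.toNNReal) ρx (fun s => u s.toNNReal) ux uxx) {t : ℝ}
    (ht : t ∈ Icc 0 T) :
    ∃ δ > 0, ∀ᶠ s in 𝓝[Icc 0 T] t,
      HasL2Deriv (ρ s.toNNReal) (ρx s) → ∫ x in (0 : ℝ)..1, ρx s x ^ 2 ≤ C →
        ∀ x ∈ Icc (0 : ℝ) 1, δ ≤ ρ s.toNNReal x := by
  obtain ⟨x₀, hx₀, hmin⟩ := isCompact_Icc.exists_isMinOn (nonempty_Icc.2 zero_le_one)
    (hX t.toNNReal).density_continuousOn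
  set m := ρ t.toNNReal x₀ with hm
  have hm0 : 0 < m := (hX _).pos x₀ hx₀
  have hC := hr.nonneg
  -- With this `lam` and with `N` cells, both terms of `abs_sub_le` are at most `m/8`, so the
  -- density varies by at most `m/4` on a cell. Cell averages stay above `3m/4`, which leaves `m/2`.
  set lam := m / (8 * (C + 1)) with hlam
  have hlam0 : 0 < lam := by positivity
  obtain ⟨N, hN⟩ := exists_nat_gt (8 / (m * lam))
  have hN0 : (0 : ℝ) < N := lt_trans (by positivity) hN
  have hNm : 1 / (N : ℝ) / lam ≤ m / 8 := by
    rw [div_lt_iff₀ (by positivity)] at hN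
    rw [div_div, div_le_div_iff₀ (by positivity) (by norm_num)]
    linarith
  have hlamC : lam * C ≤ m / 8 := by
    rw [hlam, div_mul_eq_mul_div, div_le_div_iff₀ (by positivity) (by norm_num)]
    nlinarith
  have hj : ∀ j : ℕ, j < N → (j / N : ℝ) ∈ Icc (0 : ℝ) 1 ∧ ((j + 1) / N : ℝ) ∈ Icc (0 : ℝ) 1 ∧
      (j / N : ℝ) ≤ (j + 1) / N := by
    intro j hjN
    have : (j : ℝ) + 1 ≤ N := by exact_mod_cast hjN
    refine ⟨⟨by positivity, ?_⟩, ⟨by positivity, ?_⟩, ?_⟩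
    · rw [div_le_one hN0]; linarith
    · rw [div_le_one hN0]; linarith
    · gcongr; linarith
  have hlen : ∀ j : ℕ, ((j + 1) / N : ℝ) - j / N = 1 / N := fun j => by ring
  have hint : ∀ (s : ℝ) {j : ℕ}, j < N →
      IntervalIntegrable (ρ s.toNNReal) volume (j / N : ℝ) ((j + 1) / N) := fun s j hjN => by
    refine (hX _).density_intervalIntegrable.mono_set ?_
    rw [uIcc_of_le (hj j hjN).2.2, uIcc_of_le zero_le_one]
    exact Icc_subset_Icc (hj j hjN).1.1 (hj j hjN).2.1.2
  have hev : ∀ᶠ s in 𝓝[Icc 0 T] t, ∀ j ∈ Finset.range N,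
      3 / 4 * m / N < ∫ x in (j / N : ℝ)..((j + 1) / N), ρ s.toNNReal x := by
    rw [Filter.eventually_all_finset]
    intro j hjr
    have hjN := Finset.mem_range.1 hjr
    obtain ⟨h1, h2, h3⟩ := hj j hjN
    refine (hc.continuousOn_integral hX hr h1 h2 h3 t ht).eventually_const_lt ?_
    have : ∫ x in (j / N : ℝ)..((j + 1) / N), m ≤
        ∫ x in (j / N : ℝ)..((j + 1) / N), ρ t.toNNReal x :=
      intervalIntegral.integral_mono_on h3 (by simp) (hint t hjN) fun x hx =>
        hmin ⟨h1.1.trans hx.1, hx.2.trans h2.2⟩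
    rw [intervalIntegral.integral_const, hlen, smul_eq_mul] at this
    refine lt_of_lt_of_le ?_ this
    rw [one_div_mul_eq_div]
    gcongr
    linarith
  refine ⟨m / 2, by positivity, ?_⟩
  filter_upwards [hev] with s hs hd hle x hx
  obtain ⟨j, hjN, hxj⟩ : ∃ j : ℕ, j < N ∧ x ∈ Icc (j / N : ℝ) ((j + 1) / N) := by
    rcases hx.2.eq_or_lt with rfl | hx1
    · have hN1 : 1 ≤ N := Nat.one_le_iff_ne_zero.2 (by rintro rfl; simp at hN0)
      refine ⟨N - 1, by omega, ?_⟩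
      rw [Nat.cast_sub hN1, mem_Icc, div_le_one hN0, le_div_iff₀ hN0]
      simp
    · refine ⟨⌊x * N⌋₊, ?_, ?_, ?_⟩
      · rw [Nat.floor_lt (mul_nonneg hx.1 hN0.le)]; nlinarith
      · rw [div_le_iff₀ hN0]; exact Nat.floor_le (mul_nonneg hx.1 hN0.le)
      · rw [le_div_iff₀ hN0]; exact (Nat.lt_floor_add_one _).le
  obtain ⟨h1, h2, h3⟩ := hj j hjN
  have h4 := hs j (Finset.mem_range.2 hjN)
  have h5 : ∫ y in (j / N : ℝ)..((j + 1) / N), ρ s.toNNReal y ≤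
      ∫ y in (j / N : ℝ)..((j + 1) / N), (ρ s.toNNReal x + m / 4) := by
    refine intervalIntegral.integral_mono_on h3 (hint s hjN) (by simp) fun y hy => ?_
    have e := hd.abs_sub_le hlam0 (x := y) (y := x) ⟨h1.1.trans hy.1, hy.2.trans h2.2⟩ hx
    have e1 : |y - x| ≤ 1 / N := by
      rw [← hlen j, abs_le]; constructor <;> linarith [hy.1, hy.2, hxj.1, hxj.2]
    have e2 : |y - x| / lam ≤ 1 / N / lam := by gcongr
    have e3 : lam * (∫ x in (0 : ℝ)..1, ρx s x ^ 2) ≤ lam * C := by gcongr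
    linarith [(abs_le.1 e).2]
  rw [intervalIntegral.integral_const, hlen, smul_eq_mul, div_mul_eq_mul_div, one_mul] at h5
  have h6 := h4.trans_le h5
  rw [div_lt_div_iff_of_pos_right hN0] at h6
  linarith

/-- Compactness of `[0,T]` makes the local bounds uniform; this keeps `1/ρ` bounded in
`velocityRate`. -/
theorem ContinuityEquation.exists_lower_bound {T C : ℝ} {ρ u : ℝ≥0 → ℝ → ℝ}
    {ρx ux uxx : ℝ → ℝ → ℝ} (hc : ContinuityEquation ρ u) (hX : ∀ t, MemX (ρ t) (u t))
    (hr : RegularOn T C (fun s => ρ s.toNNReal) ρx (fun s => u s.toNNReal) ux uxx) :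
    ∃ δ > 0, ∀ᵐ s ∂timeVol T, ∀ x ∈ Icc (0 : ℝ) 1, δ ≤ ρ s.toNNReal x := by
  have key : ∃ δ > 0, ∀ s ∈ Icc 0 T, HasL2Deriv (ρ s.toNNReal) (ρx s) →
      ∫ x in (0 : ℝ)..1, ρx s x ^ 2 ≤ C → ∀ x ∈ Icc (0 : ℝ) 1, δ ≤ ρ s.toNNReal x := by
    refine isCompact_Icc.induction_on (p := fun S => ∃ δ > 0, ∀ s ∈ S,
      HasL2Deriv (ρ s.toNNReal) (ρx s) → ∫ x in (0 : ℝ)..1, ρx s x ^ 2 ≤ C →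
        ∀ x ∈ Icc (0 : ℝ) 1, δ ≤ ρ s.toNNReal x) ⟨1, one_pos, by simp⟩ ?_ ?_ ?_
    · rintro S S' hS ⟨δ, hδ, h⟩
      exact ⟨δ, hδ, fun s hs => h s (hS hs)⟩
    · rintro S S' ⟨δ, hδ, h⟩ ⟨δ', hδ', h'⟩
      refine ⟨min δ δ', lt_min hδ hδ', ?_⟩
      rintro s (hs | hs) h1 h2 x hx
      · exact (min_le_left _ _).trans (h s hs h1 h2 x hx)
      · exact (min_le_right _ _).trans (h' s hs h1 h2 x hx)
    · intro t ht
      obtain ⟨δ, hδ, h⟩ := hc.exists_local_lower_bound hX hr ht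
      exact ⟨_, h, δ, hδ, fun s hs => hs⟩
  obtain ⟨δ, hδ, h⟩ := key
  refine ⟨δ, hδ, ?_⟩
  filter_upwards [hr.ae_time, ae_restrict_mem measurableSet_Ioo] with s hs hsT
  exact h s (Ioo_subset_Icc_self hsT) hs.1 hs.2.2.2.2.2.2.1

/-! ### Primitives in time on the strip -/

theorem ae_ae_swap_of_ae_prod {α β : Type*} [MeasurableSpace α] [MeasurableSpace β]
    {μ : Measure α} {ν : Measure β} [SFinite μ] [SFinite ν] {p : α × β → Prop}
    (h : ∀ᵐ z ∂μ.prod ν, p z) : ∀ᵐ b ∂ν, ∀ᵐ a ∂μ, p (a, b) := by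
  have h1 : ∀ᵐ z ∂ν.prod μ, p z.swap := by
    have := Measure.measurePreserving_swap (μ := ν) (ν := μ)
    exact this.quasiMeasurePreserving.ae h
  exact Measure.ae_ae_of_ae_prod h1

theorem ae_eq_prod_of_ae_ae_swap {α β γ : Type*} [MeasurableSpace α] [MeasurableSpace β]
    [TopologicalSpace γ] [TopologicalSpace.MetrizableSpace γ]
    {μ : Measure α} {ν : Measure β} [SFinite μ] [SFinite ν] {f g : α × β → γ}
    (hf : AEStronglyMeasurable f (μ.prod ν)) (hg : AEStronglyMeasurable g (μ.prod ν))
    (h : ∀ᵐ b ∂ν, ∀ᵐ a ∂μ, f (a, b) = g (a, b)) : f =ᵐ[μ.prod ν] g := by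
  have h1 := ae_eq_prod_of_ae_ae hf.prod_swap hg.prod_swap h
  exact (Measure.measurePreserving_swap (μ := μ) (ν := ν)).quasiMeasurePreserving.ae h1

theorem ae_strip_fst {T : ℝ} {p : ℝ → Prop} (h : ∀ᵐ s ∂timeVol T, p s) :
    ∀ᵐ z ∂stripVol T, p z.1 :=
  Measure.quasiMeasurePreserving_fst.ae h

theorem ae_strip_snd {T : ℝ} {p : ℝ → Prop} (h : ∀ᵐ x ∂unitVol, p x) :
    ∀ᵐ z ∂stripVol T, p z.2 :=
  Measure.quasiMeasurePreserving_snd.ae h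

theorem aestronglyMeasurable_integral_time {T : ℝ} {G : ℝ → ℝ → ℝ}
    (hG : AEStronglyMeasurable (Function.uncurry G) (stripVol T)) :
    AEStronglyMeasurable (fun p : ℝ × ℝ => ∫ s in (0 : ℝ)..p.1, G s p.2) (stripVol T) := by
  set F := hG.mk _ with hF
  have hFm : StronglyMeasurable F := hG.stronglyMeasurable_mk
  refine ⟨fun p => ∫ s, (Ioc 0 p.1).indicator (fun s => F (s, p.2)) s, ?_, ?_⟩
  · have : StronglyMeasurable (fun q : (ℝ × ℝ) × ℝ =>
        {q : (ℝ × ℝ) × ℝ | 0 < q.2 ∧ q.2 ≤ q.1.1}.indicator (fun q => F (q.2, q.1.2)) q) := by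
      refine StronglyMeasurable.indicator (hFm.comp_measurable (by fun_prop)) ?_
      exact (measurableSet_lt measurable_const measurable_snd).inter
        (measurableSet_le measurable_snd (by fun_prop))
    exact this.integral_prod_right'
  · have h1 := ae_strip_snd (T := T) (ae_ae_swap_of_ae_prod hG.ae_eq_mk)
    have h2 := ae_strip_fst (T := T) (ae_restrict_mem measurableSet_Ioo)
    filter_upwards [h1, h2] with p hp ht
    rw [integral_indicator measurableSet_Ioc, ← intervalIntegral.integral_of_le ht.1.le]
    exact integral_congr_ae_time (Ioo_subset_Icc_self ht) hp

theorem ae_strip_eq_primitive {T : ℝ} {f G : ℝ → ℝ → ℝ} {f₀ : ℝ → ℝ}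
    (hf : AEStronglyMeasurable (Function.uncurry f) (stripVol T))
    (hf₀ : AEStronglyMeasurable f₀ unitVol)
    (hG : AEStronglyMeasurable (Function.uncurry G) (stripVol T))
    (h : ∀ᵐ t ∂timeVol T, ∀ᵐ x ∂unitVol, f t x = f₀ x + ∫ s in (0 : ℝ)..t, G s x) :
    ∀ᵐ p ∂stripVol T, f p.1 p.2 = f₀ p.2 + ∫ s in (0 : ℝ)..p.1, G s p.2 :=
  ae_eq_prod_of_ae_ae hf ((hf₀.comp_snd).add (aestronglyMeasurable_integral_time hG)) h

/-! ### The equation for the velocity -/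

/-- The rate of change `-u u_x - A²ρ_x/ρ + u_xx/ρ` of the velocity, without the noise. -/
noncomputable def velocityRate (A : ℝ) (ρ ρx u ux uxx : ℝ → ℝ → ℝ) (s x : ℝ) : ℝ :=
  -(u s x * ux s x) - A ^ 2 * ρx s x / ρ s x + uxx s x / ρ s x

namespace RegularOn

variable {T C δ A : ℝ} {ρ ρx u ux uxx : ℝ → ℝ → ℝ}

theorem ae_le_density (h : RegularOn T C ρ ρx u ux uxx)
    (hlow : ∀ᵐ s ∂timeVol T, ∀ x ∈ Icc (0 : ℝ) 1, δ ≤ ρ s x) :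
    ∀ᵐ p ∂stripVol T, δ ≤ ρ p.1 p.2 := by
  refine ae_prod_mem_of_ae_ae (f := Function.uncurry ρ) measurableSet_Ici h.density ?_
  filter_upwards [hlow] with s hs
  filter_upwards [ae_restrict_mem measurableSet_Ioo] with x hx
  exact hs x (Ioo_subset_Icc_self hx)

theorem memLp_velocityRate (h : RegularOn T C ρ ρx u ux uxx) (hδ : 0 < δ)
    (hlow : ∀ᵐ s ∂timeVol T, ∀ x ∈ Icc (0 : ℝ) 1, δ ≤ ρ s x) :
    MemLp (fun p : ℝ × ℝ => velocityRate A ρ ρx u ux uxx p.1 p.2) 2 (stripVol T) := by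
  have hinv : AEStronglyMeasurable (fun p : ℝ × ℝ => (ρ p.1 p.2)⁻¹) (stripVol T) :=
    h.density.aemeasurable.inv.aestronglyMeasurable
  have hb : ∀ᵐ p ∂stripVol T, |(ρ p.1 p.2)⁻¹| ≤ δ⁻¹ := by
    filter_upwards [h.ae_le_density hlow] with p hp
    rw [abs_of_pos (inv_pos.2 (hδ.trans_le hp))]
    exact inv_anti₀ hδ hp
  have h1 := memLp_mul_of_bounded h.memLp_velocity_deriv h.velocity h.ae_abs_velocity_le
  have h2 := memLp_mul_of_bounded (h.memLp_density_deriv.const_mul (A ^ 2)) hinv hb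
  have h3 := memLp_mul_of_bounded h.velocity_deriv₂ hinv hb
  refine (memLp_congr_ae (Eventually.of_forall fun p => ?_)).1 ((h1.neg.sub h2).add h3)
  simp only [Function.uncurry, Pi.add_apply, Pi.neg_apply, Pi.sub_apply, velocityRate,
    div_eq_mul_inv, mul_comm (ux p.1 p.2)]

/-- Division by the density without a quotient rule. For fixed `x`, let `R` and `a` be the
primitives representing `ρ` and `ρ(u - U)`, and let `Y` be the candidate for `u - U`. The defect `R
Y - a` vanishes at time 0 and solves a linear equation with coefficient `d/ρ`, which is integrable
in time because `ρ ≥ δ`. Gronwall gives `R Y = a`. -/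
theorem ae_velocity_eq (h : RegularOn T C ρ ρx u ux uxx) (hT : 0 ≤ T) (hδ : 0 < δ)
    (hlow : ∀ᵐ s ∂timeVol T, ∀ x ∈ Icc (0 : ℝ) 1, δ ≤ ρ s x) {U : ℝ → ℝ → ℝ}
    {ρ₀ u₀ : ℝ → ℝ}
    (hdU : Integrable (fun p : ℝ × ℝ => densityRate ρ ρx u ux p.1 p.2 * U p.1 p.2) (stripVol T))
    (hρ : ∀ᵐ p ∂stripVol T,
      ρ p.1 p.2 = ρ₀ p.2 + ∫ s in (0 : ℝ)..p.1, densityRate ρ ρx u ux s p.2)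
    (hm : ∀ᵐ p ∂stripVol T,
      ρ p.1 p.2 * (u p.1 p.2 - U p.1 p.2) = ρ₀ p.2 * u₀ p.2 + ∫ s in (0 : ℝ)..p.1,
        (momentumRate A ρ ρx u ux uxx s p.2 - densityRate ρ ρx u ux s p.2 * U s p.2)) :
    ∀ᵐ x ∂unitVol, ∀ᵐ t ∂timeVol T, u t x - U t x =
      u₀ x + ∫ s in (0 : ℝ)..t, velocityRate A ρ ρx u ux uxx s x := by
  have hv := (h.memLp_velocityRate (A := A) hδ hlow).integrable (by norm_num : (1 : ℝ≥0∞) ≤ 2)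
  have hd := h.integrable_densityRate
  have hmi := (h.integrable_momentumRate A).sub hdU
  filter_upwards [ae_ae_swap_of_ae_prod hρ, ae_ae_swap_of_ae_prod hm,
    ae_ae_swap_of_ae_prod (h.ae_le_density hlow),
    ae_intervalIntegrable_time hT hd, ae_intervalIntegrable_time (G := fun s x =>
      momentumRate A ρ ρx u ux uxx s x - densityRate ρ ρx u ux s x * U s x) hT hmi,
    ae_intervalIntegrable_time (G := velocityRate A ρ ρx u ux uxx) hT hv]
    with x e1 e2 e3 i1 i2 i3
  have p1 := isPrimitiveOn_integral (ρ₀ x) i1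
  have p2 := isPrimitiveOn_integral (ρ₀ x * u₀ x) i2
  have p3 := isPrimitiveOn_integral (u₀ x) i3
  have pD := (p1.mul hT p3).sub p2
  set R : ℝ → ℝ := fun t => ρ₀ x + ∫ s in (0 : ℝ)..t, densityRate ρ ρx u ux s x with hR
  set Y : ℝ → ℝ := fun t => u₀ x + ∫ s in (0 : ℝ)..t, velocityRate A ρ ρx u ux uxx s x with hY
  set a : ℝ → ℝ := fun t => ρ₀ x * u₀ x + ∫ s in (0 : ℝ)..t,
    (momentumRate A ρ ρx u ux uxx s x - densityRate ρ ρx u ux s x * U s x) with ha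
  set d : ℝ → ℝ := fun s => densityRate ρ ρx u ux s x with hd'
  have hD0 : R 0 * Y 0 - a 0 = 0 := by simp [hR, hY, ha]
  have hcont : ContinuousOn (fun t => |R t * Y t - a t|) (uIcc 0 T) := by
    rw [uIcc_of_le hT]; exact pD.continuousOn.abs
  have hci : IntervalIntegrable (fun s => |d s| / δ) volume 0 T := i1.abs.div_const δ
  have hcE : IntervalIntegrable (fun s => |d s| / δ * |R s * Y s - a s|) volume 0 T :=
    hci.mul_continuousOn hcont
  have hder : ∀ᵐ s ∂timeVol T, |d s * Y s + R s * velocityRate A ρ ρx u ux uxx s x -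
      (momentumRate A ρ ρx u ux uxx s x - d s * U s x)| ≤ |d s| / δ * |R s * Y s - a s| := by
    filter_upwards [e1, e2, e3] with s f1 f2 f3
    have hρ0 : 0 < ρ s x := hδ.trans_le f3
    have g1 : R s = ρ s x := f1.symm
    have g2 : a s = ρ s x * (u s x - U s x) := f2.symm
    -- This rests on `momentumRate = ρ · velocityRate + u · densityRate`; the contributions of `U`
    -- cancel inside the defect.
    have g3 : d s * Y s + R s * velocityRate A ρ ρx u ux uxx s x -
        (momentumRate A ρ ρx u ux uxx s x - d s * U s x) = d s / ρ s x * (R s * Y s - a s) := by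
      rw [g1, g2, hd']
      simp only [velocityRate, momentumRate, densityRate]
      field_simp
      ring
    rw [g3, abs_mul, abs_div, abs_of_pos hρ0]
    gcongr
  have hzero := ae_eq_zero_of_le_integral hT hci
    (Eventually.of_forall fun s => by positivity) hcE (Eventually.of_forall fun s => abs_nonneg _)
    (by
      filter_upwards [ae_restrict_mem measurableSet_Ioo] with t ht
      have htI := Ioo_subset_Icc_self ht
      have h0T : (0 : ℝ) ∈ Icc 0 T := ⟨le_rfl, hT⟩
      have e := pD.2 t htI
      simp only at e
      rw [hD0, zero_add] at e
      rw [e]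
      refine (intervalIntegral.abs_integral_le_integral_abs ht.1.le).trans ?_
      rw [intervalIntegral.integral_of_le ht.1.le, intervalIntegral.integral_of_le ht.1.le,
        integral_Ioc_eq_integral_Ioo, integral_Ioc_eq_integral_Ioo]
      have hsubset : Ioo 0 t ⊆ Ioc 0 T := fun s hs => ⟨hs.1, hs.2.le.trans htI.2⟩
      refine setIntegral_mono_ae_restrict (pD.1.1.mono_set hsubset).norm
        (hcE.1.mono_set hsubset) ?_
      exact ae_restrict_of_ae_restrict_of_subset (Ioo_subset_Ioo_right htI.2) hder)
  filter_upwards [hzero, e1, e2, e3] with s f0 f1 f2 f3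
  have hρ0 : 0 < ρ s x := hδ.trans_le f3
  have g0 : R s * Y s - a s = 0 := abs_eq_zero.1 f0
  have g1 : R s = ρ s x := f1.symm
  have g2 : a s = ρ s x * (u s x - U s x) := f2.symm
  rw [g1, g2, ← mul_sub] at g0
  have := (mul_eq_zero.1 g0).resolve_left hρ0.ne'
  simp only [hY] at this
  linarith

end RegularOn

/-! ### Uniqueness along a path -/

theorem eqOn_of_integral_energy_eq_zero {ρ r u v : ℝ → ℝ} {δ : ℝ} (hδ : 0 < δ)
    (hρ : ContinuousOn ρ (Icc 0 1)) (hr : ContinuousOn r (Icc 0 1))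
    (hu : ContinuousOn u (Icc 0 1)) (hv : ContinuousOn v (Icc 0 1))
    (hlow : ∀ x ∈ Icc (0 : ℝ) 1, δ ≤ ρ x)
    (h : ∫ x in (0 : ℝ)..1, (ρ x * (u x - v x) ^ 2 / 2 + (ρ x - r x) ^ 2 / 2) = 0) :
    ∀ x ∈ Icc (0 : ℝ) 1, ρ x = r x ∧ u x = v x := by
  set e : ℝ → ℝ := fun x => ρ x * (u x - v x) ^ 2 / 2 + (ρ x - r x) ^ 2 / 2 with he
  have hc : ContinuousOn e (Icc 0 1) := by fun_prop
  have he0 : ∀ x ∈ Icc (0 : ℝ) 1, 0 ≤ e x := fun x hx => by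
    have := hδ.le.trans (hlow x hx)
    simp only [he]
    positivity
  intro x hx
  have hex : e x = 0 := by
    by_contra hne
    have hpos : 0 < e x := lt_of_le_of_ne (he0 x hx) (Ne.symm hne)
    have := intervalIntegral.integral_pos (a := 0) (b := 1) zero_lt_one hc
      (fun y hy => he0 y (Ioc_subset_Icc_self hy)) ⟨x, hx, hpos⟩
    linarith
  have hρ0 := hδ.trans_le (hlow x hx)
  have h1 : 0 ≤ ρ x * (u x - v x) ^ 2 / 2 := by positivity
  have h2 : 0 ≤ (ρ x - r x) ^ 2 / 2 := by positivity
  simp only [he] at hex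
  have h3 : ρ x * (u x - v x) ^ 2 / 2 = 0 := by linarith
  have h4 : (ρ x - r x) ^ 2 / 2 = 0 := by linarith
  constructor
  · have : (ρ x - r x) ^ 2 = 0 := by linarith
    linarith [pow_eq_zero_iff (two_ne_zero) |>.1 this]
  · have : ρ x * (u x - v x) ^ 2 = 0 := by linarith
    have := (mul_eq_zero.1 this).resolve_left hρ0.ne'
    linarith [pow_eq_zero_iff (two_ne_zero) |>.1 this]

/-- The common term `U` drops out of `u - v`. For almost every `x`, both `w` and `η` are then
primitives in time, so the energy balance is the product rule at fixed `x` followed by integration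
over `x`. -/
theorem RegularOn.unique {T C₁ C₂ δ A : ℝ} {ρ ρx u ux uxx r rx v vx vxx : ℝ → ℝ → ℝ}
    (h : RegularOn T C₁ ρ ρx u ux uxx) (h' : RegularOn T C₂ r rx v vx vxx) (hT : 0 ≤ T)
    (hδ : 0 < δ)
    (hlow : ∀ᵐ s ∂timeVol T, ∀ x ∈ Icc (0 : ℝ) 1, δ ≤ ρ s x)
    (hlow' : ∀ᵐ s ∂timeVol T, ∀ x ∈ Icc (0 : ℝ) 1, δ ≤ r s x) {ρ₀ u₀ : ℝ → ℝ} {U : ℝ → ℝ → ℝ}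
    (hρ : ∀ᵐ p ∂stripVol T,
      ρ p.1 p.2 = ρ₀ p.2 + ∫ s in (0 : ℝ)..p.1, densityRate ρ ρx u ux s p.2)
    (hr : ∀ᵐ p ∂stripVol T,
      r p.1 p.2 = ρ₀ p.2 + ∫ s in (0 : ℝ)..p.1, densityRate r rx v vx s p.2)
    (hu : ∀ᵐ x ∂unitVol, ∀ᵐ t ∂timeVol T, u t x - U t x =
      u₀ x + ∫ s in (0 : ℝ)..t, velocityRate A ρ ρx u ux uxx s x)
    (hv : ∀ᵐ x ∂unitVol, ∀ᵐ t ∂timeVol T, v t x - U t x =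
      u₀ x + ∫ s in (0 : ℝ)..t, velocityRate A r rx v vx vxx s x) :
    ∀ᵐ s ∂timeVol T, ∀ x ∈ Icc (0 : ℝ) 1, ρ s x = r s x ∧ u s x = v s x := by
  set d := densityRate ρ ρx u ux with hd
  set d' := densityRate r rx v vx with hd'
  set l := velocityRate A ρ ρx u ux uxx with hl
  set l' := velocityRate A r rx v vx vxx with hl'
  have hdm : MemLp (fun p : ℝ × ℝ => d p.1 p.2) 2 (stripVol T) := h.memLp_flux
  have hdm' : MemLp (fun p : ℝ × ℝ => d' p.1 p.2) 2 (stripVol T) := h'.memLp_flux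
  have hlm : MemLp (fun p : ℝ × ℝ => l p.1 p.2) 2 (stripVol T) := h.memLp_velocityRate hδ hlow
  have hlm' : MemLp (fun p : ℝ × ℝ => l' p.1 p.2) 2 (stripVol T) :=
    h'.memLp_velocityRate hδ hlow'
  have one_le : (1 : ℝ≥0∞) ≤ 2 := by norm_num
  have hdi : Integrable (Function.uncurry d) (stripVol T) := hdm.integrable one_le
  have hdi' : Integrable (Function.uncurry d') (stripVol T) := hdm'.integrable one_le
  have hli : Integrable (Function.uncurry l) (stripVol T) := hlm.integrable one_le
  have hli' : Integrable (Function.uncurry l') (stripVol T) := hlm'.integrable one_le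
  have hlsub : Integrable (Function.uncurry fun s x => l s x - l' s x) (stripVol T) :=
    hli.sub hli'
  have hdsub : Integrable (Function.uncurry fun s x => d s x - d' s x) (stripVol T) :=
    hdi.sub hdi'
  have mw : AEStronglyMeasurable (fun p : ℝ × ℝ => u p.1 p.2 - v p.1 p.2) (stripVol T) :=
    h.velocity.sub h'.velocity
  have mη : AEStronglyMeasurable (fun p : ℝ × ℝ => ρ p.1 p.2 - r p.1 p.2) (stripVol T) :=
    h.density.sub h'.density
  have bw : ∀ᵐ p ∂stripVol T, |u p.1 p.2 - v p.1 p.2| ≤ C₁ + C₂ := by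
    filter_upwards [h.ae_abs_velocity_le, h'.ae_abs_velocity_le] with p e1 e2
    exact (abs_sub _ _).trans (add_le_add e1 e2)
  have bη : ∀ᵐ p ∂stripVol T, |ρ p.1 p.2 - r p.1 p.2| ≤ C₁ + C₂ := by
    filter_upwards [h.ae_abs_density_le, h'.ae_abs_density_le] with p e1 e2
    exact (abs_sub _ _).trans (add_le_add e1 e2)
  -- the difference of the velocities as a primitive in time
  have hw : ∀ᵐ p ∂stripVol T, u p.1 p.2 - v p.1 p.2 =
      ∫ s in (0 : ℝ)..p.1, (l s p.2 - l' s p.2) := by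
    refine ae_eq_prod_of_ae_ae_swap mw
      (aestronglyMeasurable_integral_time hlsub.aestronglyMeasurable) ?_
    filter_upwards [hu, hv, ae_intervalIntegrable_time hT hli, ae_intervalIntegrable_time hT hli']
      with x e1 e2 i1 i2
    filter_upwards [e1, e2, ae_restrict_mem measurableSet_Ioo] with t f1 f2 ht
    have hsub : uIcc 0 t ⊆ uIcc 0 T := by
      rw [uIcc_of_le ht.1.le, uIcc_of_le hT]; exact Icc_subset_Icc_right ht.2.le
    rw [intervalIntegral.integral_sub (i1.mono_set hsub) (i2.mono_set hsub)]
    linarith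
  have hη : ∀ᵐ p ∂stripVol T, ρ p.1 p.2 - r p.1 p.2 =
      ∫ s in (0 : ℝ)..p.1, (d s p.2 - d' s p.2) := by
    filter_upwards [hρ, hr, ae_strip_snd (ae_intervalIntegrable_time hT hdi),
      ae_strip_snd (ae_intervalIntegrable_time hT hdi'),
      ae_strip_fst (ae_restrict_mem measurableSet_Ioo)] with p e1 e2 i1 i2 ht
    have hsub : uIcc 0 p.1 ⊆ uIcc 0 T := by
      rw [uIcc_of_le ht.1.le, uIcc_of_le hT]; exact Icc_subset_Icc_right ht.2.le
    rw [intervalIntegral.integral_sub (i1.mono_set hsub) (i2.mono_set hsub), e1, e2]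
    ring
  -- production of energy
  set prd : ℝ → ℝ → ℝ := fun s x => d s x * (u s x - v s x) ^ 2 / 2 +
    ρ s x * (u s x - v s x) * (l s x - l' s x) + (ρ s x - r s x) * (d s x - d' s x) with hprd
  have hprdi : Integrable (Function.uncurry prd) (stripVol T) := by
    have m1 := (memLp_mul_of_bounded (memLp_mul_of_bounded hdm mw bw) mw bw).const_mul (1 / 2)
    have m2 := memLp_mul_of_bounded (memLp_mul_of_bounded (hlm.sub hlm') mw bw) h.density
      h.ae_abs_density_le
    have m3 := memLp_mul_of_bounded (hdm.sub hdm') mη bη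
    refine (((m1.add m2).add m3).integrable one_le).congr (Eventually.of_forall fun p => ?_)
    simp only [hprd, Function.uncurry, Pi.add_apply, Pi.sub_apply]
    ring
  set E : ℝ → ℝ := fun s => ∫ x in (0 : ℝ)..1,
    (ρ s x * (u s x - v s x) ^ 2 / 2 + (ρ s x - r s x) ^ 2 / 2) with hE
  -- The balance is stated for the primitives, which are continuous in time, so it holds at every
  -- `t` for almost every `x`; the functions themselves are substituted only almost everywhere.
  have hq : ∀ᵐ x ∂unitVol, ∀ t ∈ Icc 0 T,
      (ρ₀ x + ∫ s in (0 : ℝ)..t, d s x) * (∫ s in (0 : ℝ)..t, (l s x - l' s x)) ^ 2 / 2 +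
        (∫ s in (0 : ℝ)..t, (d s x - d' s x)) ^ 2 / 2 = ∫ s in (0 : ℝ)..t, prd s x := by
    filter_upwards [ae_ae_swap_of_ae_prod hρ, ae_ae_swap_of_ae_prod hw, ae_ae_swap_of_ae_prod hη,
      ae_intervalIntegrable_time hT hdi, ae_intervalIntegrable_time hT hlsub,
      ae_intervalIntegrable_time hT hdsub] with x e1 e2 e3 i1 i2 i3 t ht
    have p1 := isPrimitiveOn_integral (ρ₀ x) i1
    have p2 := isPrimitiveOn_integral 0 i2
    have p3 := isPrimitiveOn_integral 0 i3
    have p := (((p1.mul hT p2).mul hT p2).add (p3.mul hT p3)).const_mul (1 / 2)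
    have e := p.2 t ht
    simp only [intervalIntegral.integral_same, add_zero, zero_add, mul_zero] at e
    calc _ = _ := by ring
      _ = _ := e
      _ = _ := ?_
    refine integral_congr_ae_time ht ?_
    filter_upwards [e1, e2, e3] with s f1 f2 f3
    simp only [← f1, ← f2, ← f3, hprd]
    ring
  have hEeq : ∀ᵐ t ∂timeVol T, E t = ∫ s in (0 : ℝ)..t, ∫ x in (0 : ℝ)..1, prd s x := by
    filter_upwards [Measure.ae_ae_of_ae_prod hρ, Measure.ae_ae_of_ae_prod hw,
      Measure.ae_ae_of_ae_prod hη, ae_restrict_mem measurableSet_Ioo] with t e1 e2 e3 ht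
    have htI := Ioo_subset_Icc_self ht
    rw [← integral_strip_swap htI (left_mem_Icc.2 zero_le_one) (right_mem_Icc.2 zero_le_one)
      zero_le_one hprdi]
    refine integral_congr_ae_unit ?_
    filter_upwards [e1, e2, e3, hq] with x f1 f2 f3 f4
    rw [← f4 t htI, ← f2, ← f3, ← f1]
  have hprdt := intervalIntegrable_integral_strip hT (left_mem_Icc.2 zero_le_one)
    (right_mem_Icc.2 zero_le_one) zero_le_one hprdi
  -- Only the bounds on `r` and its derivative enter `energy_production_le`, hence the constant of
  -- the second solution.
  set C := C₂ with hC
  set K := 8 + 4 * A ^ 4 + 6 * A ^ 4 * C / δ ^ 2 + 6 * C + 6 / δ ^ 2 + 4 * C ^ 2 with hK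
  have hK0 : 0 ≤ K := by have := h'.nonneg; positivity
  set c : ℝ → ℝ := fun s => K * (1 + (∫ x in (0 : ℝ)..1, uxx s x ^ 2) +
    ∫ x in (0 : ℝ)..1, vxx s x ^ 2) with hc
  have hci : IntervalIntegrable c volume 0 T := by
    have i1 := intervalIntegrable_integral_strip (G := fun s x => uxx s x ^ 2) hT
      (left_mem_Icc.2 zero_le_one) (right_mem_Icc.2 zero_le_one) zero_le_one
      h.velocity_deriv₂.integrable_sq
    have i2 := intervalIntegrable_integral_strip (G := fun s x => vxx s x ^ 2) hT
      (left_mem_Icc.2 zero_le_one) (right_mem_Icc.2 zero_le_one) zero_le_one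
      h'.velocity_deriv₂.integrable_sq
    exact (((by simp : IntervalIntegrable (fun _ => (1 : ℝ)) volume 0 T).add i1).add i2).const_mul K
  have hc0 : ∀ s, 0 ≤ c s := fun s => by
    have h1 : 0 ≤ ∫ x in (0 : ℝ)..1, uxx s x ^ 2 :=
      intervalIntegral.integral_nonneg zero_le_one fun x _ => sq_nonneg _
    have h2 : 0 ≤ ∫ x in (0 : ℝ)..1, vxx s x ^ 2 :=
      intervalIntegral.integral_nonneg zero_le_one fun x _ => sq_nonneg _
    simp only [hc]
    positivity
  -- The energy agrees almost everywhere with a continuous primitive, and an integrable function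
  -- times a continuous one is integrable.
  have hcE : IntervalIntegrable (fun s => c s * E s) volume 0 T := by
    have hΦ := isPrimitiveOn_integral 0 hprdt
    have hcont := hΦ.continuousOn
    rw [← uIcc_of_le hT] at hcont
    have := hci.mul_continuousOn hcont
    rw [intervalIntegrable_iff_integrableOn_Ioo_of_le hT] at this ⊢
    refine this.congr ?_
    filter_upwards [hEeq] with s hs
    simp only [zero_add]
    rw [hs]
  have hprod : ∀ᵐ s ∂timeVol T, ∫ x in (0 : ℝ)..1, prd s x ≤ c s * E s := by
    filter_upwards [h.ae_time, h'.ae_time, hlow, hlow'] with s hs hs' hl1 hl2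
    exact energy_production_le hδ h'.nonneg hs.1 hs'.1 hs.2.1 hs.2.2.1 hs'.2.1 hs'.2.2.1
      hs.2.2.2.1 hs.2.2.2.2.1 hs'.2.2.2.1 hs'.2.2.2.2.1 hl1
      (fun x hx => ⟨hl2 x hx, (hs'.2.2.2.2.2.1 x hx).2.1⟩) hs'.2.2.2.2.2.2.1
  have hE0 : ∀ᵐ s ∂timeVol T, 0 ≤ E s := by
    filter_upwards [hlow] with s hs
    refine intervalIntegral.integral_nonneg zero_le_one fun x hx => ?_
    have := hδ.le.trans (hs x hx)
    positivity
  have hzero := ae_eq_zero_of_le_integral hT hci (Eventually.of_forall hc0) hcE hE0 (by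
    filter_upwards [hEeq, ae_restrict_mem measurableSet_Ioo] with t ht htT
    have htI := Ioo_subset_Icc_self htT
    have hsubset : Ioo 0 t ⊆ Ioc 0 T := fun s hs => ⟨hs.1, hs.2.le.trans htI.2⟩
    rw [ht, intervalIntegral.integral_of_le htT.1.le, intervalIntegral.integral_of_le htT.1.le,
      integral_Ioc_eq_integral_Ioo, integral_Ioc_eq_integral_Ioo]
    exact setIntegral_mono_ae_restrict (hprdt.1.mono_set hsubset) (hcE.1.mono_set hsubset)
      (ae_restrict_of_ae_restrict_of_subset (Ioo_subset_Ioo_right htI.2) hprod))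
  filter_upwards [hzero, h.ae_time, h'.ae_time, hlow] with s hs0 hs hs' hl1
  exact eqOn_of_integral_energy_eq_zero hδ hs.1.continuousOn hs'.1.continuousOn
    hs.2.1.continuousOn hs'.2.1.continuousOn hl1 hs0

/-! ### The noise -/

theorem IsNoiseCoeff.continuousOn {σ : ℕ → ℝ → ℝ} (h : IsNoiseCoeff σ) (k : ℕ) :
    ContinuousOn (σ k) (Icc 0 1) := by
  obtain ⟨σ', σ'', h1, _⟩ := h
  exact (h1 k).1.continuousOn

/-- Since `σ_k` vanishes at both endpoints, applying the sup bound to `σ_k` and then to its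
derivative gives `sup σ_k² ≤ ∫ |σ_k''|²`, which is summable in `k`. -/
theorem IsNoiseCoeff.exists_summable {σ : ℕ → ℝ → ℝ} (h : IsNoiseCoeff σ) :
    ∃ b : ℕ → ℝ, Summable b ∧ (∀ k, 0 ≤ b k) ∧ ∀ k, ∀ x ∈ Icc (0 : ℝ) 1, σ k x ^ 2 ≤ b k := by
  obtain ⟨σ', σ'', h1, h2⟩ := h
  have hb0 : ∀ k, 0 ≤ ∫ x in (0 : ℝ)..1, σ'' k x ^ 2 := fun k =>
    intervalIntegral.integral_nonneg zero_le_one fun x _ => sq_nonneg _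
  refine ⟨fun k => ∫ x in (0 : ℝ)..1, σ'' k x ^ 2, ?_, hb0, fun k x hx => ?_⟩
  · rw [lintegral_tsum fun k => ((h1 k).2.1.1.1.aemeasurable.enorm.pow_const 2)] at h2
    have e : ∀ k, ∫⁻ x in Ioo (0 : ℝ) 1, ‖σ'' k x‖ₑ ^ 2 =
        ENNReal.ofReal (∫ x in (0 : ℝ)..1, σ'' k x ^ 2) := fun k => by
      rw [intervalIntegral.integral_of_le zero_le_one, integral_Ioc_eq_integral_Ioo,
        ofReal_integral_eq_lintegral_ofReal (h1 k).2.1.1.integrable_sq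
          (Eventually.of_forall fun x => sq_nonneg _)]
      refine lintegral_congr fun x => ?_
      rw [← sq_abs, ← Real.norm_eq_abs, ENNReal.ofReal_pow (norm_nonneg _), ofReal_norm]
    simp_rw [e] at h2
    have := ENNReal.summable_toReal h2.ne
    simpa only [ENNReal.toReal_ofReal (hb0 _)] using this
  · obtain ⟨d1, d2, z0, z1⟩ := h1 k
    refine (d1.sq_le z0 hx).trans ?_
    calc ∫ z in (0 : ℝ)..1, σ' k z ^ 2 ≤
        ∫ _ in (0 : ℝ)..1, (∫ x in (0 : ℝ)..1, σ'' k x ^ 2) :=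
          intervalIntegral.integral_mono_on zero_le_one (MemLp.intervalIntegrable_sq d1.1) (by simp)
            fun z hz => d1.sq_deriv_le d2 z0 z1 hz
      _ = _ := by simp

/-- The cut points make the later blocks of the series decay like `4^(-j)`, so a weight `2^j` can be
afforded. The condition `N 0 = 0` lets the blocks telescope exactly to the partial sums. -/
theorem exists_fast_subsequence {b : ℕ → ℝ} (hb : Summable b) (hb0 : ∀ k, 0 ≤ b k) :
    ∃ N : ℕ → ℕ, StrictMono N ∧ N 0 = 0 ∧
      Summable fun j => 2 ^ j * ∑ k ∈ Finset.Ico (N j) (N (j + 1)), b k := by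
  have hev : ∀ j : ℕ, ∀ᶠ n in atTop, 1 ≤ n ∧ ∀ m, n ≤ m →
      ∑ k ∈ Finset.Ico n m, b k ≤ (1 / 4 : ℝ) ^ j := by
    intro j
    have ht := tendsto_sum_nat_add b
    refine (eventually_ge_atTop 1).and ?_
    filter_upwards [ht.eventually_le_const (by positivity : (0 : ℝ) < (1 / 4) ^ j)] with n hn m hm
    refine le_trans ?_ hn
    rw [Finset.sum_Ico_eq_sum_range]
    simp_rw [add_comm n]
    exact ((summable_nat_add_iff n).2 hb).sum_le_tsum _ fun k _ => hb0 _
  obtain ⟨φ, hφ, hp⟩ := extraction_forall_of_eventually hev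
  refine ⟨fun j => Nat.casesOn j 0 φ, strictMono_nat_of_lt_succ ?_, rfl, ?_⟩
  · rintro (_ | j)
    · exact (hp 0).1
    · exact hφ (Nat.lt_succ_self j)
  · rw [← summable_nat_add_iff 1]
    have hs : Summable fun j : ℕ => (2 : ℝ) * (1 / 2) ^ j :=
      (summable_geometric_of_lt_one (by norm_num) (by norm_num)).mul_left 2
    refine hs.of_nonneg_of_le (fun j => mul_nonneg (by positivity)
      (Finset.sum_nonneg fun k _ => hb0 k)) fun j => ?_
    have h1 := (hp j).2 (φ (j + 1)) (hφ (Nat.lt_succ_self j)).le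
    calc _ ≤ (2 : ℝ) ^ (j + 1) * (1 / 4) ^ j := by
          exact mul_le_mul_of_nonneg_left h1 (by positivity)
      _ = 2 * (2 * (1 / 4)) ^ j := by rw [mul_pow]; ring
      _ = _ := by norm_num

/-- A process with almost surely continuous paths is jointly measurable up to a null set. -/
theorem aemeasurable_of_ae_continuous {Ω β : Type*} [MeasurableSpace Ω] [MeasurableSpace β]
    {P : Measure Ω} [SFinite P] {ν : Measure β} [SFinite ν] {X : ℝ≥0 → Ω → ℝ}
    (hX : ∀ t, AEMeasurable (X t) P) (hc : ∀ᵐ ω ∂P, Continuous fun t => X t ω) {τ : β → ℝ≥0}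
    (hτ : Measurable τ) : AEMeasurable (fun q : Ω × β => X (τ q.2) q.1) (P.prod ν) := by
  -- The times are discretised to `⌊τ n⌋/n`. Only countably many fixed times occur, so one null set
  -- covers all the modifications, and continuity of the paths recovers the limit.
  refine aemeasurable_of_tendsto_metrizable_ae atTop (f := fun (n : ℕ) (q : Ω × β) =>
    (hX ((⌊(τ q.2 : ℝ≥0) * n⌋₊ : ℝ≥0) / n)).mk _ q.1) (fun n => ?_) ?_
  · have h1 : Measurable (fun z : ℕ × Ω => (hX ((z.1 : ℝ≥0) / n)).mk _ z.2) :=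
      measurable_from_prod_countable_right fun k =>
        (hX ((k : ℝ≥0) / n)).measurable_mk
    have h2 : Measurable fun q : Ω × β => ((⌊(τ q.2 : ℝ≥0) * n⌋₊, q.1) : ℕ × Ω) :=
      (Nat.measurable_floor.comp ((hτ.comp measurable_snd).mul_const _)).prodMk measurable_fst
    exact (h1.comp h2).aemeasurable
  · have h1 : ∀ᵐ ω ∂P, (∀ k n : ℕ, X ((k : ℝ≥0) / n) ω = (hX ((k : ℝ≥0) / n)).mk _ ω) ∧
        Continuous fun t => X t ω := by
      refine Eventually.and ?_ hc
      rw [ae_all_iff]; intro k; rw [ae_all_iff]; intro n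
      exact (hX _).ae_eq_mk
    filter_upwards [Measure.quasiMeasurePreserving_fst.ae h1] with q ⟨e1, e2⟩
    simp_rw [← e1]
    have h2 : Tendsto (fun n : ℕ => (⌊(τ q.2 : ℝ≥0) * n⌋₊ : ℝ≥0) / n) atTop (𝓝 (τ q.2)) := by
      rw [← NNReal.tendsto_coe]
      have := (tendsto_nat_floor_mul_div_atTop (R := ℝ) (τ q.2).coe_nonneg).comp
        tendsto_natCast_atTop_atTop
      refine this.congr fun n => ?_
      simp only [Function.comp_apply, NNReal.coe_div, NNReal.coe_natCast]
      congr 2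
    exact (e2.tendsto _).comp h2

/-! ### Square integrable domination of the noise series -/

section Noise

variable {Ω : Type*} [mΩ : MeasurableSpace Ω] {P : Measure Ω}
  {F : Filtration ℝ≥0 mΩ} {W : ℕ → ℝ≥0 → Ω → ℝ} {σ : ℕ → ℝ → ℝ}

/-- The partial sums of the noise `∑ σ_k W^k`. -/
def noiseSum (σ : ℕ → ℝ → ℝ) (W : ℕ → ℝ≥0 → Ω → ℝ) (s : Finset ℕ) (ω : Ω) (p : ℝ × ℝ) : ℝ :=
  ∑ k ∈ s, σ k p.2 * W k p.1.toNNReal ω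

/-- At a fixed time the summands are independent and centred, so their variances `t c_k²` add up. -/
theorem IsStochasticBasis.lintegral_sq_sum_le [IsProbabilityMeasure P]
    (hW : IsStochasticBasis P F W) (c : ℕ → ℝ) (t : ℝ≥0) (s : Finset ℕ) :
    ∫⁻ ω, ‖∑ k ∈ s, c k * W k t ω‖ₑ ^ 2 ∂P = ENNReal.ofReal (t * ∑ k ∈ s, c k ^ 2) := by
  have hL : ∀ k, MemLp (W k t) 2 P := fun k =>
    ((hW.brownian k).hasLaw_eval t).hasGaussianLaw.memLp_two
  have hX : ∀ k, MemLp (fun ω => c k * W k t ω) 2 P := fun k => (hL k).const_mul _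
  have hS : MemLp (∑ k ∈ s, fun ω => c k * W k t ω) 2 P := memLp_finsetSum' _ fun k _ => hX k
  have hvar : Var[∑ k ∈ s, fun ω => c k * W k t ω; P] = t * ∑ k ∈ s, c k ^ 2 := by
    rw [IndepFun.variance_sum (fun k _ => hX k), Finset.mul_sum]
    · refine Finset.sum_congr rfl fun k _ => ?_
      rw [variance_const_mul, ← covariance_self (hL k).aemeasurable,
        (hW.brownian k).covariance_eval, min_self, mul_comm]
    · intro i _ j _ hij
      have := hW.indep.indepFun hij
      exact this.comp (φ := fun f : ℝ≥0 → ℝ => c i * f t) (ψ := fun f : ℝ≥0 → ℝ => c j * f t)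
        (by fun_prop) (by fun_prop)
  have hmean : P[∑ k ∈ s, fun ω => c k * W k t ω] = 0 := by
    simp only [Finset.sum_apply]
    rw [integral_finsetSum _ fun k _ => (hX k).integrable (by norm_num)]
    refine Finset.sum_eq_zero fun k _ => ?_
    rw [integral_const_mul, (hW.brownian k).integral_eval, mul_zero]
  rw [variance_eq_integral hS.aemeasurable, hmean] at hvar
  simp only [sub_zero, Finset.sum_apply] at hvar
  rw [← hvar, ofReal_integral_eq_lintegral_ofReal]
  · refine lintegral_congr fun ω => ?_
    rw [← sq_abs, ← Real.norm_eq_abs, ENNReal.ofReal_pow (norm_nonneg _), ofReal_norm]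
  · have := hS.integrable_sq
    simpa only [Finset.sum_apply] using this
  · exact Eventually.of_forall fun ω => sq_nonneg _

theorem aemeasurable_noiseSum [IsProbabilityMeasure P] (hW : IsStochasticBasis P F W)
    (hσ : IsNoiseCoeff σ) (T : ℝ) (s : Finset ℕ) :
    AEMeasurable (fun q : Ω × ℝ × ℝ => noiseSum σ W s q.1 q.2) (P.prod (stripVol T)) := by
  unfold noiseSum
  refine Finset.aemeasurable_fun_sum _ fun k _ => AEMeasurable.mul ?_ ?_
  · have h1 : AEStronglyMeasurable (σ k) unitVol :=
      ((hσ.continuousOn k).mono Ioo_subset_Icc_self).aestronglyMeasurable measurableSet_Ioo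
    have h2 : AEStronglyMeasurable (fun p : ℝ × ℝ => σ k p.2) (stripVol T) := h1.comp_snd
    exact h2.comp_snd.aemeasurable
  · exact aemeasurable_of_ae_continuous (τ := fun p : ℝ × ℝ => p.1.toNNReal)
      (fun t => (hW.brownian k).aemeasurable t) (hW.brownian k).cont (by fun_prop)

theorem ae_aestronglyMeasurable_noiseSum (hW : IsStochasticBasis P F W)
    (hσ : IsNoiseCoeff σ) : ∀ᵐ ω ∂P, ∀ T s,
      AEStronglyMeasurable (noiseSum σ W s ω) (stripVol T) := by
  have hc : ∀ᵐ ω ∂P, ∀ k, Continuous fun t => W k t ω := by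
    rw [ae_all_iff]; exact fun k => (hW.brownian k).cont
  filter_upwards [hc] with ω hω T s
  unfold noiseSum
  refine Finset.aestronglyMeasurable_fun_sum _ fun k _ => AEStronglyMeasurable.mul ?_ ?_
  · have h1 : AEStronglyMeasurable (σ k) unitVol :=
      ((hσ.continuousOn k).mono Ioo_subset_Icc_self).aestronglyMeasurable measurableSet_Ioo
    exact h1.comp_snd
  · have := hω k
    exact Continuous.aestronglyMeasurable (by fun_prop)

/-- Cauchy–Schwarz with the weights `2^(-j)` and `2^j`; the factor 2 is `∑ 2^(-j)`. -/
theorem abs_sum_le_sqrt {a : ℕ → ℝ} (ha : Summable fun j => 2 ^ j * a j ^ 2) (J : ℕ) :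
    |∑ j ∈ Finset.range J, a j| ≤ √(2 * ∑' j, 2 ^ j * a j ^ 2) := by
  refine Real.abs_le_sqrt ?_
  have h1 : (∑ j ∈ Finset.range J, a j) ^ 2 ≤ (∑ j ∈ Finset.range J, (1 / 2 : ℝ) ^ j) *
      ∑ j ∈ Finset.range J, 2 ^ j * a j ^ 2 := by
    refine Finset.sum_sq_le_sum_mul_sum_of_sq_le_mul _ (fun j _ => by positivity)
      (fun j _ => by positivity) fun j _ => le_of_eq ?_
    rw [← mul_assoc, ← mul_pow]
    norm_num
  refine h1.trans (mul_le_mul ?_ (ha.sum_le_tsum _ fun j _ => by positivity)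
    (Finset.sum_nonneg fun j _ => by positivity) (by norm_num))
  have := (summable_geometric_of_lt_one (r := (1 / 2 : ℝ)) (by norm_num)
    (by norm_num)).sum_le_tsum (Finset.range J) fun j _ => by positivity
  rwa [tsum_geometric_of_lt_one (by norm_num) (by norm_num),
    show (1 - 1 / 2 : ℝ)⁻¹ = 2 by norm_num] at this

/-- Compare with `2 |a_j| ≤ 2^(-j) + 2^j a_j²`. -/
theorem summable_of_weighted_sq {a : ℕ → ℝ} (ha : Summable fun j => 2 ^ j * a j ^ 2) :
    Summable a := by
  have h1 := (summable_geometric_of_lt_one (r := (1 / 2 : ℝ)) (by norm_num) (by norm_num)).add ha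
  refine Summable.of_norm (h1.of_nonneg_of_le (fun j => norm_nonneg _) fun j => ?_)
  have e : (1 / 2 : ℝ) ^ j + 2 ^ j * a j ^ 2 - 2 * |a j| = 2 ^ j * (|a j| - (1 / 2) ^ j) ^ 2 := by
    have h2 : (2 : ℝ) ^ j * (1 / 2) ^ j = 1 := by rw [← mul_pow]; norm_num
    rw [← sq_abs (a j)]
    linear_combination (2 * |a j| - (1 / 2) ^ j) * h2
  have : 0 ≤ (2 : ℝ) ^ j * (|a j| - (1 / 2) ^ j) ^ 2 := by positivity
  rw [Real.norm_eq_abs]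
  linarith [abs_nonneg (a j)]

/-- Along a suitable subsequence the noise series converges almost everywhere, dominated by a
square integrable function. -/
theorem IsStochasticBasis.exists_noise_dominated [IsProbabilityMeasure P]
    (hW : IsStochasticBasis P F W) (hσ : IsNoiseCoeff σ) :
    ∃ N : ℕ → ℕ, StrictMono N ∧ ∀ T : ℝ, ∀ᵐ ω ∂P, ∃ D : ℝ × ℝ → ℝ,
      MemLp D 2 (stripVol T) ∧ ∀ᵐ p ∂stripVol T,
        (∀ j, |noiseSum σ W (Finset.range (N j)) ω p| ≤ D p) ∧
        ∃ l, Tendsto (fun j => noiseSum σ W (Finset.range (N j)) ω p) atTop (𝓝 l) := by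
  obtain ⟨b, hb, hb0, hσb⟩ := hσ.exists_summable
  obtain ⟨N, hN, hN0, hsum⟩ := exists_fast_subsequence hb hb0
  refine ⟨N, hN, fun T => ?_⟩
  set a : ℕ → Ω → ℝ × ℝ → ℝ := fun j ω p =>
    noiseSum σ W (Finset.Ico (N j) (N (j + 1))) ω p with ha
  have htel : ∀ J ω p, ∑ j ∈ Finset.range J, a j ω p =
      noiseSum σ W (Finset.range (N J)) ω p := by
    intro J ω p
    induction J with
    | zero => simp [hN0, noiseSum]
    | succ J ih =>
      rw [Finset.sum_range_succ, ih]
      simp only [ha, noiseSum]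
      exact Finset.sum_range_add_sum_Ico _ (hN (Nat.lt_succ_self J)).le
  -- The weighted square sum of the blocks has finite integral over paths, time and space. For
  -- almost every path it is therefore integrable on the strip; where it is finite the series
  -- converges, and `√(2Q)` dominates all the partial sums.
  set Q : Ω × ℝ × ℝ → ℝ≥0∞ := fun q => ∑' j, 2 ^ j * ‖a j q.1 q.2‖ₑ ^ 2 with hQ
  have ham : ∀ j, AEMeasurable (fun q : Ω × ℝ × ℝ => (2 : ℝ≥0∞) ^ j * ‖a j q.1 q.2‖ₑ ^ 2)
      (P.prod (stripVol T)) := fun j =>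
    ((aemeasurable_noiseSum hW hσ T _).enorm.pow_const 2).const_mul _
  have hQm : AEMeasurable Q (P.prod (stripVol T)) := AEMeasurable.tsum ham
  set β : ℕ → ℝ := fun j => ∑ k ∈ Finset.Ico (N j) (N (j + 1)), b k with hβ
  have hE : ∀ j, ∀ᵐ p ∂stripVol T, ∫⁻ ω, (2 : ℝ≥0∞) ^ j * ‖a j ω p‖ₑ ^ 2 ∂P ≤
      ENNReal.ofReal (2 ^ j * (T * β j)) := by
    intro j
    filter_upwards [ae_strip_fst (T := T) (ae_restrict_mem measurableSet_Ioo),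
      ae_strip_snd (T := T) (ae_restrict_mem measurableSet_Ioo)] with p hp1 hp2
    rw [lintegral_const_mul' _ _ (by simp), ENNReal.ofReal_mul (by positivity),
      ENNReal.ofReal_pow (by norm_num)]
    simp only [ha, noiseSum]
    rw [hW.lintegral_sq_sum_le]
    simp only [ENNReal.ofReal_ofNat]
    gcongr
    · exact hp1.1.le.trans hp1.2.le
    · rw [Real.coe_toNNReal _ hp1.1.le]; exact hp1.2.le
    · exact Finset.sum_le_sum fun k _ => hσb k _ (Ioo_subset_Icc_self hp2)
  have hQi : ∫⁻ q, Q q ∂(P.prod (stripVol T)) < ∞ := by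
    rw [lintegral_tsum ham]
    have h1 : ∀ j, ∫⁻ q, (2 : ℝ≥0∞) ^ j * ‖a j q.1 q.2‖ₑ ^ 2 ∂(P.prod (stripVol T)) ≤
        ENNReal.ofReal (2 ^ j * (T * β j)) * stripVol T univ := by
      intro j
      rw [lintegral_prod_symm _ (ham j), ← lintegral_const]
      exact lintegral_mono_ae (hE j)
    refine (ENNReal.tsum_le_tsum h1).trans_lt ?_
    rw [ENNReal.tsum_mul_right]
    refine ENNReal.mul_lt_top ?_ (measure_lt_top _ _)
    rcases le_or_gt 0 T with hT | hT
    · have hs : Summable fun j => 2 ^ j * (T * β j) := by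
        refine (hsum.mul_left T).congr fun j => by simp only [hβ]; ring
      rw [← ENNReal.ofReal_tsum_of_nonneg (fun j => ?_) hs]
      · exact ENNReal.ofReal_lt_top
      · exact mul_nonneg (by positivity) (mul_nonneg hT (Finset.sum_nonneg fun k _ => hb0 k))
    · have : ∀ j, ENNReal.ofReal (2 ^ j * (T * β j)) = 0 := fun j => by
        refine ENNReal.ofReal_of_nonpos (mul_nonpos_of_nonneg_of_nonpos (by positivity)
          (mul_nonpos_of_nonpos_of_nonneg hT.le (Finset.sum_nonneg fun k _ => hb0 k)))
      simp [this]
  rw [lintegral_prod _ hQm] at hQi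
  have hfin := ae_lt_top' hQm.lintegral_prod_right' hQi.ne
  filter_upwards [hfin, hQm.aestronglyMeasurable.prodMk_left] with ω hω hmω'
  have hmω := hmω'.aemeasurable
  refine ⟨fun p => √(2 * (Q (ω, p)).toReal), ?_, ?_⟩
  · have hm : AEMeasurable (fun p => √(2 * (Q (ω, p)).toReal)) (stripVol T) :=
      (hmω.ennreal_toReal.const_mul 2).sqrt
    rw [memLp_two_iff_integrable_sq hm.aestronglyMeasurable]
    refine ((integrable_toReal_of_lintegral_ne_top hmω hω.ne).const_mul 2).congr
      (Eventually.of_forall fun p => ?_)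
    simp only
    rw [Real.sq_sqrt (by positivity)]
  · filter_upwards [ae_lt_top' hmω hω.ne] with p hp
    have hconv : ∀ j, ((2 : ℝ≥0∞) ^ j * ‖a j ω p‖ₑ ^ 2).toReal = 2 ^ j * a j ω p ^ 2 :=
      fun j => by simp
    have hs : Summable fun j => 2 ^ j * a j ω p ^ 2 := by
      have := ENNReal.summable_toReal hp.ne
      simpa only [hconv] using this
    have hQp : (Q (ω, p)).toReal = ∑' j, 2 ^ j * a j ω p ^ 2 := by
      simp only [hQ]
      rw [ENNReal.tsum_toReal_eq fun j => by finiteness]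
      simp only [hconv]
    refine ⟨fun J => ?_, ∑' j, a j ω p, ?_⟩
    · rw [← htel, hQp]
      exact abs_sum_le_sqrt hs J
    · simp_rw [← htel]
      exact (summable_of_weighted_sq hs).hasSum.tendsto_sum_nat

end Noise

/-! ### The Itô integral of an absolutely continuous integrand -/

theorem sum_mul_sub_eq (h b : ℕ → ℝ) (n : ℕ) :
    ∑ i ∈ Finset.range n, h i * (b (i + 1) - b i) =
      h n * b n - h 0 * b 0 - ∑ i ∈ Finset.range n, (h (i + 1) - h i) * b (i + 1) := by
  induction n with
  | zero => simp
  | succ n ih => rw [Finset.sum_range_succ, Finset.sum_range_succ, ih]; ring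

/-- Abel summation moves the increments onto `h`. The remaining sum is `∑ ∫ h' β(x_{i+1})` over the
cells, which tends to `∫ h' β` by uniform continuity of `β`. No variation bound on `β` is needed, so
a Brownian path is allowed. -/
theorem tendsto_sum_mul_sub {t : ℝ} {h h' β : ℝ → ℝ} (ht : 0 ≤ t) (hh : IsPrimitiveOn t h h')
    (hβ : ContinuousOn β (Icc 0 t)) :
    Tendsto (fun n : ℕ => ∑ i ∈ Finset.range n,
      h (t * i / n) * (β (t * (i + 1) / n) - β (t * i / n))) atTop
      (𝓝 (h t * β t - h 0 * β 0 - ∫ s in (0 : ℝ)..t, h' s * β s)) := by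
  set V := ∫ s in (0 : ℝ)..t, |h' s| with hV
  have hV0 : 0 ≤ V := intervalIntegral.integral_nonneg ht fun s _ => abs_nonneg _
  have hβi : IntervalIntegrable (fun s => h' s * β s) volume 0 t :=
    hh.1.mul_continuousOn (by rwa [uIcc_of_le ht])
  rw [Metric.tendsto_atTop]
  intro ε hε
  have hunif := isCompact_Icc.uniformContinuousOn_of_continuous hβ
  rw [Metric.uniformContinuousOn_iff_le] at hunif
  -- The total error is this modulus times `V = ∫ |h'|`, hence less than `ε`; the `+ 1` covers `V =
  -- 0`.
  obtain ⟨η, hη, hun⟩ := hunif (ε / (2 * (V + 1))) (by positivity)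
  obtain ⟨n₀, hn₀⟩ := exists_nat_gt (t / η)
  refine ⟨n₀ + 1, fun n hn => ?_⟩
  have hn1 : (0 : ℝ) < n := by exact_mod_cast (by omega : 0 < n)
  have hnη : t / n ≤ η := by
    rw [div_le_iff₀ hn1, mul_comm]
    rw [div_lt_iff₀ hη] at hn₀
    have : (n₀ : ℝ) ≤ n := by exact_mod_cast (by omega : n₀ ≤ n)
    nlinarith
  set x : ℕ → ℝ := fun i => t * i / n with hx
  have hx1 : ∀ i : ℕ, t * ((i : ℝ) + 1) / n = x (i + 1) := fun i => by simp [hx]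
  have hx0 : x 0 = 0 := by simp [hx]
  have hxn : x n = t := by simp only [hx]; field_simp
  have hmono : ∀ i, x i ≤ x (i + 1) := fun i => by
    simp only [hx]; push_cast; gcongr; linarith
  have hstep : ∀ i, x (i + 1) - x i = t / n := fun i => by
    simp only [hx]; push_cast; ring
  have hmem : ∀ i ≤ n, x i ∈ Icc 0 t := fun i hi => by
    have : (i : ℝ) ≤ n := by exact_mod_cast hi
    refine ⟨by positivity, ?_⟩
    simp only [hx]
    rw [div_le_iff₀ hn1]
    gcongr
  have e1 := sum_mul_sub_eq (fun i => h (x i)) (fun i => β (x i)) n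
  simp only [hx0, hxn] at e1
  simp only [hx1]
  rw [e1, Real.dist_eq]
  have hsubi : ∀ i < n, IntervalIntegrable h' volume (x i) (x (i + 1)) := fun i hi =>
    hh.intervalIntegrable (hmem i hi.le) (hmem (i + 1) hi)
  have hsubi' : ∀ i < n, IntervalIntegrable (fun s => h' s * β s) volume (x i) (x (i + 1)) :=
    fun i hi => hβi.mono_set (by
      rw [uIcc_of_le (hmono i), uIcc_of_le ht]
      exact Icc_subset_Icc (hmem i hi.le).1 (hmem (i + 1) hi).2)
  have e2 : ∫ s in (0 : ℝ)..t, h' s * β s =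
      ∑ i ∈ Finset.range n, ∫ s in x i..x (i + 1), h' s * β s := by
    rw [intervalIntegral.sum_integral_adjacent_intervals hsubi', hx0, hxn]
  have e3 : V = ∑ i ∈ Finset.range n, ∫ s in x i..x (i + 1), |h' s| := by
    rw [intervalIntegral.sum_integral_adjacent_intervals fun i hi => (hsubi i hi).abs, hx0, hxn]
  have e4 : ∀ a b c : ℝ, a - b - c - (a - b - (∫ s in (0 : ℝ)..t, h' s * β s)) =
      (∫ s in (0 : ℝ)..t, h' s * β s) - c := fun a b c => by ring
  rw [e4, e2, ← Finset.sum_sub_distrib]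
  have hbound : ∀ i ∈ Finset.range n,
      |(∫ s in x i..x (i + 1), h' s * β s) - (h (x (i + 1)) - h (x i)) * β (x (i + 1))| ≤
        ε / (2 * (V + 1)) * ∫ s in x i..x (i + 1), |h' s| := by
    intro i hi
    have hi' := Finset.mem_range.1 hi
    rw [← hh.integral_eq_sub (hmem i hi'.le) (hmem (i + 1) hi'),
      ← intervalIntegral.integral_mul_const,
      ← intervalIntegral.integral_sub (hsubi' i hi') ((hsubi i hi').mul_const _),
      ← intervalIntegral.integral_const_mul]
    refine (intervalIntegral.abs_integral_le_integral_abs (hmono i)).trans ?_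
    refine intervalIntegral.integral_mono_on (hmono i)
      ((hsubi' i hi').sub ((hsubi i hi').mul_const _)).abs ((hsubi i hi').abs.const_mul _)
      fun s hs => ?_
    have hsI : s ∈ Icc 0 t := ⟨(hmem i hi'.le).1.trans hs.1, hs.2.trans (hmem (i + 1) hi').2⟩
    have hd : |β s - β (x (i + 1))| ≤ ε / (2 * (V + 1)) := by
      refine hun s hsI _ (hmem (i + 1) hi') ?_
      rw [Real.dist_eq, abs_le]
      have := hstep i
      constructor <;> linarith [hs.1, hs.2]
    rw [← mul_sub, abs_mul, mul_comm]
    gcongr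
  refine (Finset.abs_sum_le_sum_abs _ _).trans_lt ((Finset.sum_le_sum hbound).trans_lt ?_)
  rw [← Finset.mul_sum, ← e3, div_mul_eq_mul_div, div_lt_iff₀ (by positivity)]
  nlinarith

theorem tendsto_itoSum {Ω : Type*} {H B : ℝ≥0 → Ω → ℝ} {ω : Ω} {H' : ℝ → ℝ} {t : ℝ≥0}
    (hB : Continuous fun t => B t ω)
    (hH : IsPrimitiveOn t (fun s => H s.toNNReal ω) H') :
    Tendsto (fun n => itoSum H B t n ω) atTop
      (𝓝 (H t ω * B t ω - H 0 ω * B 0 ω - ∫ s in (0 : ℝ)..t, H' s * B s.toNNReal ω)) := by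
  have hβ : Continuous fun s : ℝ => B s.toNNReal ω := hB.comp continuous_real_toNNReal
  have h1 := tendsto_sum_mul_sub t.coe_nonneg hH hβ.continuousOn
  simp only [Real.toNNReal_coe, Real.toNNReal_zero] at h1
  refine h1.congr fun n => ?_
  unfold itoSum
  have e : ∀ c : ℝ≥0, ((t : ℝ) * c / n).toNNReal = t * c / n := fun c => by
    rw [← Real.toNNReal_coe (r := t * c / n)]
    congr 1
  refine Finset.sum_congr rfl fun i _ => ?_
  have e1 := e i
  have e2 := e (i + 1)
  push_cast at e1 e2
  rw [e1, e2]

section Ito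

variable {Ω : Type*} [mΩ : MeasurableSpace Ω] {P : Measure Ω}

theorem TendstoInMeasure.ae_eq_of_tendsto {f : ℕ → Ω → ℝ} {g : Ω → ℝ}
    (h : TendstoInMeasure P f atTop g) :
    ∀ᵐ ω ∂P, ∀ l, Tendsto (fun n => f n ω) atTop (𝓝 l) → l = g ω := by
  obtain ⟨ns, hns, hae⟩ := h.exists_seq_tendsto_ae
  filter_upwards [hae] with ω hω l hl
  exact tendsto_nhds_unique (hl.comp hns.tendsto_atTop) hω

/-- The pathwise limit of the Riemann sums must agree with their limit in probability. This holds
almost surely at the countably many times `k/n`, and continuity of both sides gives all times. -/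
theorem IsItoIntegral.ae_eq {H B I : ℝ≥0 → Ω → ℝ} (hI : IsItoIntegral P H B I)
    (hB : ∀ᵐ ω ∂P, Continuous fun t => B t ω) (hB0 : ∀ᵐ ω ∂P, B 0 ω = 0) {H' : Ω → ℝ → ℝ}
    (hH : ∀ᵐ ω ∂P, ∀ T, 0 ≤ T → IsPrimitiveOn T (fun s => H s.toNNReal ω) (H' ω)) :
    ∀ᵐ ω ∂P, ∀ t : ℝ≥0, I t ω =
      H t ω * B t ω - ∫ s in (0 : ℝ)..t, H' ω s * B s.toNNReal ω := by
  have h1 : ∀ᵐ ω ∂P, ∀ k : ℕ, ∀ n : ℕ, I ((k : ℝ≥0) / n) ω =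
      H ((k : ℝ≥0) / n) ω * B ((k : ℝ≥0) / n) ω -
        ∫ s in (0 : ℝ)..((k : ℝ≥0) / n : ℝ≥0), H' ω s * B s.toNNReal ω := by
    rw [ae_all_iff]; intro k; rw [ae_all_iff]; intro n
    filter_upwards [TendstoInMeasure.ae_eq_of_tendsto (hI.2 ((k : ℝ≥0) / n)), hB, hB0, hH]
      with ω e1 e2 e3 e4
    have := e1 _ (tendsto_itoSum e2 (e4 _ (NNReal.coe_nonneg _)))
    rw [← this, e3]
    ring
  filter_upwards [h1, hI.1, hB, hH] with ω e1 e2 e3 e4 t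
  have hβ : Continuous fun s : ℝ => B s.toNNReal ω := e3.comp continuous_real_toNNReal
  have hcont : ContinuousOn (fun s : ℝ => H s.toNNReal ω * B s.toNNReal ω -
      ∫ z in (0 : ℝ)..s, H' ω z * B z.toNNReal ω) (Icc 0 (t + 1)) := by
    have h2 := e4 (t + 1) (by positivity)
    have h3 : IntervalIntegrable (fun z => H' ω z * B z.toNNReal ω) volume 0 (t + 1) :=
      h2.1.mul_continuousOn hβ.continuousOn
    have h4 := (isPrimitiveOn_integral 0 h3).continuousOn
    simp only [zero_add] at h4
    exact (h2.continuousOn.mul hβ.continuousOn).sub h4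
  have hseq : Tendsto (fun n : ℕ => ((⌊(t : ℝ≥0) * n⌋₊ : ℝ≥0) / n : ℝ≥0)) atTop (𝓝 t) := by
    rw [← NNReal.tendsto_coe]
    refine ((tendsto_nat_floor_mul_div_atTop (R := ℝ) t.coe_nonneg).comp
      tendsto_natCast_atTop_atTop).congr fun n => ?_
    simp only [Function.comp_apply, NNReal.coe_div, NNReal.coe_natCast]
    congr 2
  have hseq' : Tendsto (fun n : ℕ => (((⌊(t : ℝ≥0) * n⌋₊ : ℝ≥0) / n : ℝ≥0) : ℝ)) atTop
      (𝓝[Icc 0 ((t : ℝ) + 1)] t) := by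
    refine tendsto_nhdsWithin_iff.2 ⟨NNReal.tendsto_coe.2 hseq, ?_⟩
    filter_upwards [(NNReal.tendsto_coe.2 hseq).eventually_lt_const
      (lt_add_one (t : ℝ))] with n hn using ⟨NNReal.coe_nonneg _, hn.le⟩
  have l1 := (e2.tendsto t).comp hseq
  have l2 := (hcont t ⟨t.coe_nonneg, by linarith⟩).tendsto.comp hseq'
  simp only [Real.toNNReal_coe] at l2
  refine tendsto_nhds_unique l1 (l2.congr fun n => ?_)
  simp only [Function.comp_apply, Real.toNNReal_coe]
  exact (e1 _ _).symm

/-- At each `t` the identification of limits costs a null set of paths depending on `t`. Exchanging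
the quantifiers requires a measurable event, so the claim is recast as "if the sequence converges,
its difference with `M` tends to 0". -/
theorem ae_ae_limit_unique [SFinite P] {ν : Measure ℝ} [SFinite ν] {X : ℕ → Ω × ℝ → ℝ}
    {M : Ω × ℝ → ℝ} (hX : ∀ j, AEMeasurable (X j) (P.prod ν)) (hM : AEMeasurable M (P.prod ν))
    (h : ∀ᵐ t ∂ν, TendstoInMeasure P (fun j ω => X j (ω, t)) atTop fun ω => M (ω, t)) :
    ∀ᵐ ω ∂P, ∀ᵐ t ∂ν, ∀ l, Tendsto (fun j => X j (ω, t)) atTop (𝓝 l) → l = M (ω, t) := by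
  have hae : ∀ᵐ q ∂P.prod ν, (∀ j, X j q = (hX j).mk _ q) ∧ M q = hM.mk _ q :=
    (ae_all_iff.2 fun j => (hX j).ae_eq_mk).and hM.ae_eq_mk
  have hS : MeasurableSet {q : Ω × ℝ |
      (∃ l, Tendsto (fun j => (hX j).mk _ q) atTop (𝓝 l)) →
        Tendsto (fun j => (hX j).mk _ q - hM.mk _ q) atTop (𝓝 0)} := by
    have h1 := measurableSet_exists_tendsto (l := atTop) fun j => (hX j).measurable_mk
    have h2 := measurableSet_tendsto (l := atTop) (𝓝 (0 : ℝ)) fun j =>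
      (hX j).measurable_mk.sub hM.measurable_mk
    exact h1.imp h2
  have key : ∀ᵐ ω ∂P, ∀ᵐ t ∂ν, (∃ l, Tendsto (fun j => (hX j).mk _ (ω, t)) atTop (𝓝 l)) →
        Tendsto (fun j => (hX j).mk _ (ω, t) - hM.mk _ (ω, t)) atTop (𝓝 0) := by
    rw [Measure.ae_ae_comm hS]
    filter_upwards [h, ae_ae_swap_of_ae_prod hae] with t ht1 ht2
    filter_upwards [TendstoInMeasure.ae_eq_of_tendsto ht1, ht2] with ω e1 ⟨e2, e3⟩ ⟨l, hl⟩
    have := e1 l (by simpa only [e2] using hl)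
    rw [← e3, ← this, ← sub_self l]
    exact hl.sub_const l
  filter_upwards [key, Measure.ae_ae_of_ae_prod hae] with ω h1 h2
  filter_upwards [h1, h2] with t e1 ⟨e2, e3⟩ l hl
  simp only [e2] at hl
  rw [e3]
  have h4 := e1 ⟨l, hl⟩
  have h5 := tendsto_nhds_unique h4 (hl.sub_const _)
  linarith

end Ito

/-! ### The momentum equation along a path -/

theorem stripVol_mono {t T : ℝ} (h : t ≤ T) : stripVol t ≤ stripVol T := by
  rw [stripVol, stripVol, Measure.prod_restrict, Measure.prod_restrict]
  exact Measure.restrict_mono_set _ (prod_mono_left (Ioo_subset_Ioo_right h))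

theorem integral_strip_eq {t : ℝ} (ht : 0 ≤ t) {G : ℝ → ℝ → ℝ}
    (hG : Integrable (Function.uncurry G) (stripVol t)) :
    ∫ s in (0 : ℝ)..t, ∫ x in (0 : ℝ)..1, G s x = ∫ p, Function.uncurry G p ∂stripVol t := by
  simp_rw [intervalIntegral.integral_of_le ht, intervalIntegral.integral_of_le zero_le_one,
    integral_Ioc_eq_integral_Ioo]
  exact (integral_prod _ hG).symm

theorem tendsto_integral_strip {T t : ℝ} (ht : t ∈ Icc 0 T) {G : ℕ → ℝ → ℝ → ℝ}
    {G₀ : ℝ → ℝ → ℝ} {B : ℝ × ℝ → ℝ} (hB : Integrable B (stripVol T))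
    (hm : ∀ j, AEStronglyMeasurable (Function.uncurry (G j)) (stripVol T))
    (hle : ∀ᵐ p ∂stripVol T, ∀ j, |G j p.1 p.2| ≤ B p)
    (hlim : ∀ᵐ p ∂stripVol T, Tendsto (fun j => G j p.1 p.2) atTop (𝓝 (G₀ p.1 p.2))) :
    Tendsto (fun j => ∫ s in (0 : ℝ)..t, ∫ x in (0 : ℝ)..1, G j s x) atTop
      (𝓝 (∫ s in (0 : ℝ)..t, ∫ x in (0 : ℝ)..1, G₀ s x)) := by
  have hle' : ∀ᵐ p ∂stripVol T, ∀ j, ‖Function.uncurry (G j) p‖ ≤ B p := hle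
  have hlim' : ∀ᵐ p ∂stripVol T, Tendsto (fun j => Function.uncurry (G j) p) atTop
      (𝓝 (Function.uncurry G₀ p)) := hlim
  have hi : ∀ j, Integrable (Function.uncurry (G j)) (stripVol T) := fun j =>
    hB.mono' (hm j) (hle'.mono fun p hp => hp j)
  have hi₀ : Integrable (Function.uncurry G₀) (stripVol T) := by
    refine hB.mono' (aestronglyMeasurable_of_tendsto_ae atTop hm hlim') ?_
    filter_upwards [hle', hlim'] with p h1 h2
    exact le_of_tendsto h2.norm (Eventually.of_forall h1)
  have hmono := stripVol_mono ht.2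
  rw [integral_strip_eq ht.1 (hi₀.mono_measure hmono)]
  simp_rw [fun j => integral_strip_eq ht.1 ((hi j).mono_measure hmono)]
  exact tendsto_integral_of_dominated_convergence B (fun j => (hm j).mono_measure hmono)
    (hB.mono_measure hmono) (fun j => ae_mono hmono (hle'.mono fun p hp => hp j))
    (ae_mono hmono hlim')

theorem integrable_strip_mul {T : ℝ} {G : ℝ → ℝ → ℝ} {ψ : ℝ → ℝ}
    (hG : Integrable (Function.uncurry G) (stripVol T)) (hψ : ContinuousOn ψ (Icc 0 1)) :
    Integrable (Function.uncurry fun s x => G s x * ψ x) (stripVol T) := by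
  obtain ⟨c, hc⟩ := isCompact_Icc.exists_bound_of_continuousOn hψ
  have h1 : AEStronglyMeasurable ψ unitVol :=
    (hψ.mono Ioo_subset_Icc_self).aestronglyMeasurable measurableSet_Ioo
  have h2 : AEStronglyMeasurable (fun p : ℝ × ℝ => ψ p.2) (stripVol T) := h1.comp_snd
  refine hG.mul_bdd (c := c) h2 ?_
  filter_upwards [ae_strip_snd (T := T) (ae_restrict_mem measurableSet_Ioo)] with p hp
  exact hc _ (Ioo_subset_Icc_self hp)

/-- This makes the Itô integrands absolutely continuous in time. The weight will be `σ_k φ`, which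
is merely continuous, so the argument uses the pointwise form of the continuity equation. -/
theorem ContinuityEquation.isPrimitiveOn_integral_mul {T C : ℝ} {ρ u : ℝ≥0 → ℝ → ℝ}
    {ρx ux uxx : ℝ → ℝ → ℝ} (hc : ContinuityEquation ρ u) (hX : ∀ t, MemX (ρ t) (u t))
    (hr : RegularOn T C (fun s => ρ s.toNNReal) ρx (fun s => u s.toNNReal) ux uxx) (hT : 0 ≤ T)
    {ψ : ℝ → ℝ} (hψ : ContinuousOn ψ (Icc 0 1)) :
    IsPrimitiveOn T (fun t => ∫ x in (0 : ℝ)..1, ρ t.toNNReal x * ψ x) (fun s =>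
      ∫ x in (0 : ℝ)..1, densityRate (fun s => ρ s.toNNReal) ρx (fun s => u s.toNNReal) ux s x
        * ψ x) := by
  have hG := hr.integrable_densityRate
  have hGψ := integrable_strip_mul hG hψ
  have h0 : (0 : ℝ) ∈ Icc (0 : ℝ) 1 := left_mem_Icc.2 zero_le_one
  have h1 : (1 : ℝ) ∈ Icc (0 : ℝ) 1 := right_mem_Icc.2 zero_le_one
  have hψ' : ContinuousOn ψ (uIcc 0 1) := by rwa [uIcc_of_le zero_le_one]
  refine ⟨intervalIntegrable_integral_strip hT h0 h1 zero_le_one hGψ, fun t ht => ?_⟩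
  rw [← integral_strip_swap ht h0 h1 zero_le_one hGψ]
  simp_rw [intervalIntegral.integral_mul_const, Real.toNNReal_zero]
  rw [← intervalIntegral.integral_add ((hX 0).density_intervalIntegrable.mul_continuousOn hψ')
    ((intervalIntegrable_integral_time ht hG).mul_continuousOn hψ')]
  refine integral_congr_ae_unit ?_
  filter_upwards [hc.ae_density_eq hX hr ht] with x hx
  rw [hx]
  ring

theorem sum_integral_mul_eq {g φ : ℝ → ℝ} {σ : ℕ → ℝ → ℝ} (hg : IntervalIntegrable g volume 0 1)
    (hσ : ∀ k, ContinuousOn (σ k) (Icc 0 1)) (hφ : ContinuousOn φ (Icc 0 1)) (c : ℕ → ℝ)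
    (s : Finset ℕ) :
    ∑ k ∈ s, (∫ x in (0 : ℝ)..1, g x * (σ k x * φ x)) * c k =
      ∫ x in (0 : ℝ)..1, g x * φ x * ∑ k ∈ s, σ k x * c k := by
  have hm : ∀ k, ContinuousOn (fun x => σ k x * φ x) (uIcc 0 1) := fun k => by
    rw [uIcc_of_le zero_le_one]; exact (hσ k).mul hφ
  simp_rw [← intervalIntegral.integral_mul_const]
  have hi : ∀ k ∈ s, IntervalIntegrable (fun x => g x * (σ k x * φ x) * c k) volume 0 1 :=
    fun k _ => (hg.mul_continuousOn (hm k)).mul_const _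
  rw [← intervalIntegral.integral_finsetSum hi]
  refine intervalIntegral.integral_congr fun x _ => ?_
  rw [Finset.mul_sum]
  exact Finset.sum_congr rfl fun k _ => by ring

/-- The stochastic integral of the density against the noise `S`, integrated by parts in time. -/
noncomputable def noiseFunctional (ρ : ℝ≥0 → ℝ → ℝ) (d : ℝ → ℝ → ℝ) (φ : ℝ → ℝ) (S : ℝ × ℝ → ℝ)
    (t : ℝ) : ℝ :=
  (∫ x in (0 : ℝ)..1, ρ t.toNNReal x * φ x * S (t, x)) -
    ∫ s in (0 : ℝ)..t, ∫ x in (0 : ℝ)..1, d s x * φ x * S (s, x)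

theorem sum_ito_eq_noiseFunctional {Ω : Type*} {W : ℕ → ℝ≥0 → Ω → ℝ} {ω : Ω} {T : ℝ}
    {ρ : ℝ≥0 → ℝ → ℝ} {d : ℝ → ℝ → ℝ} {σ : ℕ → ℝ → ℝ} {φ : ℝ → ℝ}
    (hW : ∀ k, Continuous fun t => W k t ω)
    (hd : Integrable (Function.uncurry d) (stripVol T))
    (hρ : ∀ t, ContinuousOn (ρ t) (Icc 0 1)) (hσ : ∀ k, ContinuousOn (σ k) (Icc 0 1))
    (hφ : ContinuousOn φ (Icc 0 1)) (s : Finset ℕ) {t : ℝ} (ht : t ∈ Icc 0 T) :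
    ∑ k ∈ s, ((∫ x in (0 : ℝ)..1, ρ t.toNNReal x * (σ k x * φ x)) * W k t.toNNReal ω -
      ∫ z in (0 : ℝ)..t, (∫ x in (0 : ℝ)..1, d z x * (σ k x * φ x)) * W k z.toNNReal ω) =
    noiseFunctional ρ d φ (noiseSum σ W s ω) t := by
  have hT : 0 ≤ T := ht.1.trans ht.2
  have hi : ∀ k, IntervalIntegrable (fun z => (∫ x in (0 : ℝ)..1, d z x * (σ k x * φ x)) *
      W k z.toNNReal ω) volume 0 t := fun k => by
    have h1 := intervalIntegrable_integral_strip hT (left_mem_Icc.2 zero_le_one)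
      (right_mem_Icc.2 zero_le_one) zero_le_one (integrable_strip_mul hd ((hσ k).mul hφ))
    have h2 := hW k
    have h3 : Continuous fun z : ℝ => W k z.toNNReal ω := by fun_prop
    refine (h1.mono_set ?_).mul_continuousOn h3.continuousOn
    rw [uIcc_of_le ht.1, uIcc_of_le hT]
    exact Icc_subset_Icc_right ht.2
  rw [Finset.sum_sub_distrib, noiseFunctional]
  congr 1
  · refine sum_integral_mul_eq ?_ hσ hφ _ s
    exact ContinuousOn.intervalIntegrable (by rw [uIcc_of_le zero_le_one]; exact hρ _)
  · rw [← intervalIntegral.integral_finsetSum fun k _ => hi k]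
    refine integral_congr_ae_time ht ?_
    filter_upwards [ae_intervalIntegrable_space hd] with z hz
    exact sum_integral_mul_eq hz hσ hφ (fun k => W k z.toNNReal ω) s

/-- Dominated convergence in both terms: `C · D` at a fixed generic time, and `|d| · D` on the
strip, integrable as a product of two square integrable functions. -/
theorem ae_tendsto_noiseFunctional {T C : ℝ} {ρ : ℝ≥0 → ℝ → ℝ} {d : ℝ → ℝ → ℝ} {φ : ℝ → ℝ}
    {S : ℕ → ℝ × ℝ → ℝ} {U D : ℝ × ℝ → ℝ}
    (hd : MemLp (fun p : ℝ × ℝ => d p.1 p.2) 2 (stripVol T))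
    (hρ : ∀ t, ContinuousOn (ρ t) (Icc 0 1))
    (hρC : ∀ᵐ t ∂timeVol T, ∀ x ∈ Icc (0 : ℝ) 1, |ρ t.toNNReal x| ≤ C)
    (hφ : Continuous φ) (hφ1 : ∀ x, |φ x| ≤ 1)
    (hS : ∀ j, AEStronglyMeasurable (S j) (stripVol T)) (hD : MemLp D 2 (stripVol T))
    (hle : ∀ᵐ p ∂stripVol T, ∀ j, |S j p| ≤ D p)
    (hlim : ∀ᵐ p ∂stripVol T, Tendsto (fun j => S j p) atTop (𝓝 (U p))) :
    ∀ᵐ t ∂timeVol T, Tendsto (fun j => noiseFunctional ρ d φ (S j) t) atTop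
      (𝓝 (noiseFunctional ρ d φ U t)) := by
  have hDi : Integrable D (stripVol T) := hD.integrable (by norm_num)
  have hSt : ∀ᵐ t ∂timeVol T, ∀ j, AEStronglyMeasurable (fun x => S j (t, x)) unitVol :=
    ae_all_iff.2 fun j => (hS j).prodMk_left
  filter_upwards [hρC, hSt, hDi.prod_right_ae, Measure.ae_ae_of_ae_prod hle,
    Measure.ae_ae_of_ae_prod hlim, ae_restrict_mem measurableSet_Ioo] with t h1 h2 h3 h4 h5 ht
  refine Tendsto.sub ?_ ?_
  · simp_rw [intervalIntegral.integral_of_le zero_le_one, integral_Ioc_eq_integral_Ioo]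
    refine tendsto_integral_of_dominated_convergence (fun x => C * D (t, x)) (fun j => ?_)
      (h3.const_mul C) (fun j => ?_) ?_
    · have e1 : AEStronglyMeasurable (ρ t.toNNReal) unitVol :=
        ((hρ _).mono Ioo_subset_Icc_self).aestronglyMeasurable measurableSet_Ioo
      exact (e1.mul hφ.aestronglyMeasurable).mul (h2 j)
    · filter_upwards [h4, ae_restrict_mem measurableSet_Ioo] with x e1 hx
      have e2 := h1 x (Ioo_subset_Icc_self hx)
      rw [norm_mul, norm_mul]
      refine mul_le_mul ?_ (e1 j) (norm_nonneg _) ((abs_nonneg _).trans e2)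
      exact (mul_le_of_le_one_right (norm_nonneg _) (hφ1 x)).trans e2
    · filter_upwards [h5] with x e1 using e1.const_mul _
  · refine tendsto_integral_strip (Ioo_subset_Icc_self ht)
      (B := fun p => |d p.1 p.2| * D p) (G := fun j s x => d s x * φ x * S j (s, x))
      (G₀ := fun s x => d s x * φ x * U (s, x)) (hd.norm.integrable_mul hD) (fun j => ?_) ?_ ?_
    · have e1 : AEStronglyMeasurable (fun p : ℝ × ℝ => φ p.2) (stripVol T) :=
        (hφ.comp continuous_snd).aestronglyMeasurable
      exact (hd.1.mul e1).mul (hS j)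
    · filter_upwards [hle] with p hp j
      rw [abs_mul, abs_mul]
      refine mul_le_mul ?_ (hp j) (abs_nonneg _) (abs_nonneg _)
      exact mul_le_of_le_one_right (abs_nonneg _) (hφ1 _)
    · filter_upwards [hlim] with p hp using hp.const_mul _

/-! ### Identification of the stochastic integral and the resulting equations along a path -/

section Path

variable {Ω : Type*} [mΩ : MeasurableSpace Ω] {P : Measure Ω}
  {F : Filtration ℝ≥0 mΩ} {W : ℕ → ℝ≥0 → Ω → ℝ} {A : ℝ} {σ : ℕ → ℝ → ℝ} {ρ₀ u₀ : ℝ → ℝ}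
  {ρ u : ℝ≥0 → Ω → ℝ → ℝ}

/-- Adaptedness gives measurability only at fixed points of `[0,1]`. Continuity in `x` yields joint
measurability through `aemeasurable_of_ae_continuous`, with the space variable, clipped to `[0,1]`,
in the role of time. -/
theorem IsStrongSolution.aemeasurable_integral_density [IsProbabilityMeasure P]
    (hs : IsStrongSolution P F W A σ ρ₀ u₀ ρ u) (t : ℝ≥0) {ψ : ℝ → ℝ}
    (hψ : ContinuousOn ψ (Icc 0 1)) :
    AEMeasurable (fun ω => ∫ x in (0 : ℝ)..1, ρ t ω x * ψ x) P := by
  have hmem : ∀ y : ℝ≥0, ((min y 1 : ℝ≥0) : ℝ) ∈ Icc (0 : ℝ) 1 := fun y =>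
    ⟨NNReal.coe_nonneg _, by exact_mod_cast min_le_right y 1⟩
  have h1 : AEMeasurable (fun q : Ω × ℝ => ρ t q.1 ((min q.2.toNNReal 1 : ℝ≥0) : ℝ))
      (P.prod unitVol) := by
    refine aemeasurable_of_ae_continuous (X := fun y ω => ρ t ω ((min y 1 : ℝ≥0) : ℝ))
      (τ := Real.toNNReal) (fun y => ?_) ?_ measurable_real_toNNReal
    · exact ((hs.adapted_density _ (hmem y) t).mono (F.le t) le_rfl).aemeasurable
    · filter_upwards [hs.mem_phaseSpace] with ω hω
      exact (hω t).density_continuousOn.comp_continuous (by fun_prop) hmem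
  have h2 : AEStronglyMeasurable (fun q : Ω × ℝ => ψ q.2) (P.prod unitVol) := by
    have : AEStronglyMeasurable ψ unitVol :=
      (hψ.mono Ioo_subset_Icc_self).aestronglyMeasurable measurableSet_Ioo
    exact this.comp_snd
  have h3 := (h1.aestronglyMeasurable.mul h2).integral_prod_right'.aemeasurable
  refine h3.congr (Eventually.of_forall fun ω => ?_)
  simp only
  rw [intervalIntegral.integral_of_le zero_le_one, integral_Ioc_eq_integral_Ioo]
  refine setIntegral_congr_fun measurableSet_Ioo fun x hx => ?_
  have : ((min x.toNNReal 1 : ℝ≥0) : ℝ) = x := by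
    rw [NNReal.coe_min, Real.coe_toNNReal _ hx.1.le, NNReal.coe_one, min_eq_left hx.2.le]
  simp only [this, Pi.mul_apply]

theorem IsItoIntegral.aemeasurable {H B I : ℝ≥0 → Ω → ℝ} (hI : IsItoIntegral P H B I)
    (hH : ∀ t, AEMeasurable (H t) P) (hB : ∀ t, AEMeasurable (B t) P) (t : ℝ≥0) :
    AEMeasurable (I t) P := by
  refine (hI.2 t).aemeasurable fun n => ?_
  exact Finset.aemeasurable_fun_sum _ fun i _ => (hH _).mul ((hB _).sub (hB _))

/-- The derivatives are chosen path by path; no measurability in `ω` is asserted. -/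
theorem IsStrongSolution.exists_derivatives [IsProbabilityMeasure P]
    (hs : IsStrongSolution P F W A σ ρ₀ u₀ ρ u) :
    ∃ ρx ux uxx : Ω → ℝ → ℝ → ℝ, ∀ᵐ ω ∂P, ∀ T, ∃ C, RegularOn T C (fun s => ρ s.toNNReal ω)
      (ρx ω) (fun s => u s.toNNReal ω) (ux ω) (uxx ω) := by
  have h : ∀ᵐ ω ∂P, ∃ d : (ℝ → ℝ → ℝ) × (ℝ → ℝ → ℝ) × (ℝ → ℝ → ℝ), ∀ T, ∃ C,
      RegularOn T C (fun s => ρ s.toNNReal ω) d.1 (fun s => u s.toNNReal ω) d.2.1 d.2.2 := by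
    filter_upwards [hs.mem_phaseSpace, hs.density_regularity, hs.velocity_regularity]
      with ω h1 h2 h3
    obtain ⟨ρx, ux, uxx, h⟩ := exists_regularOn h1 h2 h3.1 h3.2
    exact ⟨(ρx, ux, uxx), h⟩
  obtain ⟨d, hd⟩ := h.choice
  exact ⟨fun ω => (d ω).1, fun ω => (d ω).2.1, fun ω => (d ω).2.2, hd⟩

end Path

section Path

variable {Ω : Type*} [mΩ : MeasurableSpace Ω] {P : Measure Ω} [IsProbabilityMeasure P]
  {F : Filtration ℝ≥0 mΩ} {W : ℕ → ℝ≥0 → Ω → ℝ} {A : ℝ} {σ : ℕ → ℝ → ℝ} {ρ₀ u₀ : ℝ → ℝ}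
  {ρ u : ℝ≥0 → Ω → ℝ → ℝ} {ρx ux uxx : Ω → ℝ → ℝ → ℝ}

/-- The stochastic convolution `∑_k σ_k W^k`, as a limit along the partial sums `N`. -/
noncomputable def noiseLimit (σ : ℕ → ℝ → ℝ) (W : ℕ → ℝ≥0 → Ω → ℝ) (N : ℕ → ℕ) (ω : Ω)
    (p : ℝ × ℝ) : ℝ :=
  limUnder atTop fun j => noiseSum σ W (Finset.range (N j)) ω p

theorem IsStochasticBasis.exists_noiseLimit (hW : IsStochasticBasis P F W)
    (hσ : IsNoiseCoeff σ) :
    ∃ N : ℕ → ℕ, StrictMono N ∧ ∀ T : ℝ, ∀ᵐ ω ∂P, ∃ D : ℝ × ℝ → ℝ,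
      MemLp D 2 (stripVol T) ∧
        (∀ᵐ p ∂stripVol T, ∀ j, |noiseSum σ W (Finset.range (N j)) ω p| ≤ D p) ∧
        (∀ᵐ p ∂stripVol T, Tendsto (fun j => noiseSum σ W (Finset.range (N j)) ω p) atTop
          (𝓝 (noiseLimit σ W N ω p))) ∧
        MemLp (noiseLimit σ W N ω) 2 (stripVol T) := by
  obtain ⟨N, hN, h⟩ := hW.exists_noise_dominated hσ
  refine ⟨N, hN, fun T => ?_⟩
  filter_upwards [h T, ae_aestronglyMeasurable_noiseSum hW hσ] with ω ⟨D, hD, hω⟩ hm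
  have hlim : ∀ᵐ p ∂stripVol T, Tendsto (fun j => noiseSum σ W (Finset.range (N j)) ω p) atTop
      (𝓝 (noiseLimit σ W N ω p)) := by
    filter_upwards [hω] with p hp using tendsto_nhds_limUnder hp.2
  refine ⟨D, hD, hω.mono fun p hp => hp.1, hlim, ?_⟩
  refine hD.of_le (aestronglyMeasurable_of_tendsto_ae atTop (fun j => hm T _) hlim) ?_
  filter_upwards [hω, hlim] with p hp hl
  exact le_of_tendsto hl.norm (Eventually.of_forall fun j => (hp.1 j).trans (le_abs_self _))

theorem IsStrongSolution.ae_ito_eq (hW : IsStochasticBasis P F W) (hσ : IsNoiseCoeff σ)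
    (hs : IsStrongSolution P F W A σ ρ₀ u₀ ρ u)
    (hr : ∀ᵐ ω ∂P, ∀ T, ∃ C, RegularOn T C (fun s => ρ s.toNNReal ω)
      (ρx ω) (fun s => u s.toNNReal ω) (ux ω) (uxx ω))
    {φ : ℝ → ℝ} (hφ : Continuous φ) {k : ℕ} {I : ℝ≥0 → Ω → ℝ}
    (hI : IsItoIntegral P (fun s ω => ∫ x in (0 : ℝ)..1, ρ s ω x * σ k x * φ x) (W k) I) :
    (∀ t, AEMeasurable (I t) P) ∧ ∀ᵐ ω ∂P, ∀ t : ℝ≥0, I t ω =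
      (∫ x in (0 : ℝ)..1, ρ t ω x * (σ k x * φ x)) * W k t ω - ∫ s in (0 : ℝ)..t,
        (∫ x in (0 : ℝ)..1, densityRate (fun s => ρ s.toNNReal ω) (ρx ω)
          (fun s => u s.toNNReal ω) (ux ω) s x * (σ k x * φ x)) * W k s.toNNReal ω := by
  simp_rw [mul_assoc] at hI
  have hψ : ContinuousOn (fun x => σ k x * φ x) (Icc 0 1) :=
    (hσ.continuousOn k).mul hφ.continuousOn
  refine ⟨hI.aemeasurable (fun t => hs.aemeasurable_integral_density t hψ)
    fun t => (hW.brownian k).aemeasurable t, ?_⟩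
  refine hI.ae_eq (hW.brownian k).cont (hW.brownian k).eval_zero_ae_eq_zero ?_
  filter_upwards [hs.mem_phaseSpace, hs.continuity, hr] with ω h1 h2 h3 T hT
  obtain ⟨C, hC⟩ := h3 T
  exact h2.isPrimitiveOn_integral_mul h1 hC hT hψ

/-- The partial sums of Itô integrals converge to `M` in probability at each time. Once integrated
by parts, they also converge pathwise along `N`, to the functional of the limiting noise, and the
two limits agree by `ae_ae_limit_unique`. -/
theorem IsStrongSolution.ae_series_eq (hW : IsStochasticBasis P F W) (hσ : IsNoiseCoeff σ)
    (hs : IsStrongSolution P F W A σ ρ₀ u₀ ρ u)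
    (hr : ∀ᵐ ω ∂P, ∀ T, ∃ C, RegularOn T C (fun s => ρ s.toNNReal ω)
      (ρx ω) (fun s => u s.toNNReal ω) (ux ω) (uxx ω)) {N : ℕ → ℕ} (hN : StrictMono N)
    (hU : ∀ T : ℝ, ∀ᵐ ω ∂P, ∃ D : ℝ × ℝ → ℝ, MemLp D 2 (stripVol T) ∧
        (∀ᵐ p ∂stripVol T, ∀ j, |noiseSum σ W (Finset.range (N j)) ω p| ≤ D p) ∧
        (∀ᵐ p ∂stripVol T, Tendsto (fun j => noiseSum σ W (Finset.range (N j)) ω p) atTop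
          (𝓝 (noiseLimit σ W N ω p))) ∧ MemLp (noiseLimit σ W N ω) 2 (stripVol T))
    {φ : ℝ → ℝ} (hφ : Continuous φ) (hφ1 : ∀ x, |φ x| ≤ 1) {M : ℝ≥0 → Ω → ℝ}
    (hM : IsItoSeries P (fun k s ω => ∫ x in (0 : ℝ)..1, ρ s ω x * σ k x * φ x) W M) (T : ℝ) :
    ∀ᵐ ω ∂P, ∀ᵐ t ∂timeVol T, M t.toNNReal ω = noiseFunctional (fun t => ρ t ω)
      (densityRate (fun s => ρ s.toNNReal ω) (ρx ω) (fun s => u s.toNNReal ω) (ux ω)) φ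
      (noiseLimit σ W N ω) t := by
  obtain ⟨hMc, I, hI, hlim⟩ := hM
  have hIt := fun k => hs.ae_ito_eq hW hσ hr hφ (hI k)
  have hMm : ∀ t, AEMeasurable (M t) P := fun t =>
    (hlim t).aemeasurable fun n => Finset.aemeasurable_fun_sum _ fun k _ => (hIt k).1 t
  have key := ae_ae_limit_unique (P := P) (ν := timeVol T)
    (X := fun j q => ∑ k ∈ Finset.range (N j), I k q.2.toNNReal q.1)
    (M := fun q => M q.2.toNNReal q.1)
    (fun j => Finset.aemeasurable_fun_sum _ fun k _ =>
      aemeasurable_of_ae_continuous (hIt k).1 (hI k).1 measurable_real_toNNReal)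
    (aemeasurable_of_ae_continuous hMm hMc measurable_real_toNNReal)
    (Eventually.of_forall fun t => (hlim t.toNNReal).comp hN.tendsto_atTop)
  filter_upwards [key, ae_all_iff.2 fun k => (hIt k).2, hU T, hr, hs.mem_phaseSpace,
    ae_aestronglyMeasurable_noiseSum hW hσ, ae_all_iff.2 fun k => (hW.brownian k).cont]
    with ω h1 h2 ⟨D, hD, hle, hl, _⟩ h4 h5 h6 h7
  obtain ⟨C, hC⟩ := h4 T
  have hρC : ∀ᵐ t ∂timeVol T, ∀ x ∈ Icc (0 : ℝ) 1, |ρ t.toNNReal ω x| ≤ C := by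
    filter_upwards [hC.ae_time] with s hs x hx
    have := hs.2.2.2.2.2.1 x hx
    rw [abs_of_pos this.1]
    exact this.2.1
  have hconv := ae_tendsto_noiseFunctional (ρ := fun t => ρ t ω)
    (d := densityRate (fun s => ρ s.toNNReal ω) (ρx ω) (fun s => u s.toNNReal ω) (ux ω)) hC.memLp_flux
    (fun t => (h5 t).density_continuousOn) hρC hφ hφ1 (fun j => h6 T _) hD hle hl
  filter_upwards [h1, hconv, ae_restrict_mem measurableSet_Ioo] with t e1 e2 ht
  refine (e1 _ (e2.congr fun j => ?_)).symm
  rw [← sum_ito_eq_noiseFunctional (T := T) h7 hC.integrable_densityRate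
    (fun t => (h5 t).density_continuousOn) hσ.continuousOn hφ.continuousOn _
    (Ioo_subset_Icc_self ht)]
  refine Finset.sum_congr rfl fun k _ => ?_
  rw [h2 k, Real.coe_toNNReal _ ht.1.le]

end Path

theorem integral_strip_sub {T t : ℝ} (ht : t ∈ Icc 0 T) {G G' : ℝ → ℝ → ℝ}
    (hG : Integrable (Function.uncurry G) (stripVol T))
    (hG' : Integrable (Function.uncurry G') (stripVol T)) :
    ∫ s in (0 : ℝ)..t, ∫ x in (0 : ℝ)..1, (G s x - G' s x) =
      (∫ s in (0 : ℝ)..t, ∫ x in (0 : ℝ)..1, G s x) -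
        ∫ s in (0 : ℝ)..t, ∫ x in (0 : ℝ)..1, G' s x := by
  have h := hG.mono_measure (stripVol_mono ht.2)
  have h' := hG'.mono_measure (stripVol_mono ht.2)
  rw [integral_strip_eq ht.1 h, integral_strip_eq ht.1 h', ← integral_sub h h']
  exact integral_strip_eq (G := fun s x => G s x - G' s x) ht.1 (h.sub h')

section Path

variable {Ω : Type*} [mΩ : MeasurableSpace Ω] {P : Measure Ω} [IsProbabilityMeasure P]
  {F : Filtration ℝ≥0 mΩ} {W : ℕ → ℝ≥0 → Ω → ℝ} {A : ℝ} {σ : ℕ → ℝ → ℝ} {ρ₀ u₀ : ℝ → ℝ}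
  {ρ u r v : ℝ≥0 → Ω → ℝ → ℝ} {ρx ux uxx : Ω → ℝ → ℝ → ℝ}

/-- Since the noise term equals `ρ U - ∫ d U` after integration by parts, moving `ρ U` to the left
makes `ρ (u - U)` a primitive in time with rate `m - d U`; `ae_velocity_eq` then divides by `ρ`. -/
theorem IsStrongSolution.ae_equations (hW : IsStochasticBasis P F W) (hσ : IsNoiseCoeff σ)
    (hs : IsStrongSolution P F W A σ ρ₀ u₀ ρ u)
    (hr : ∀ᵐ ω ∂P, ∀ T, ∃ C, RegularOn T C (fun s => ρ s.toNNReal ω)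
      (ρx ω) (fun s => u s.toNNReal ω) (ux ω) (uxx ω)) {N : ℕ → ℕ} (hN : StrictMono N)
    (hU : ∀ T : ℝ, ∀ᵐ ω ∂P, ∃ D : ℝ × ℝ → ℝ, MemLp D 2 (stripVol T) ∧
        (∀ᵐ p ∂stripVol T, ∀ j, |noiseSum σ W (Finset.range (N j)) ω p| ≤ D p) ∧
        (∀ᵐ p ∂stripVol T, Tendsto (fun j => noiseSum σ W (Finset.range (N j)) ω p) atTop
          (𝓝 (noiseLimit σ W N ω p))) ∧ MemLp (noiseLimit σ W N ω) 2 (stripVol T))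
    {T : ℝ} (hT : 0 ≤ T) :
    ∀ᵐ ω ∂P, ∃ δ > 0, (∀ᵐ s ∂timeVol T, ∀ x ∈ Icc (0 : ℝ) 1, δ ≤ ρ s.toNNReal ω x) ∧
      (∀ᵐ p ∂stripVol T, ρ p.1.toNNReal ω p.2 = ρ₀ p.2 + ∫ s in (0 : ℝ)..p.1,
        densityRate (fun s => ρ s.toNNReal ω) (ρx ω) (fun s => u s.toNNReal ω) (ux ω) s p.2) ∧
      ∀ᵐ x ∂unitVol, ∀ᵐ t ∂timeVol T, u t.toNNReal ω x - noiseLimit σ W N ω (t, x) =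
        u₀ x + ∫ s in (0 : ℝ)..t, velocityRate A (fun s => ρ s.toNNReal ω) (ρx ω)
          (fun s => u s.toNNReal ω) (ux ω) (uxx ω) s x := by
  choose M hM hMeq using fun i : PlateauIndex => hs.momentum _ (isTestFunction_plateau i)
  have hser := fun i : PlateauIndex => hs.ae_series_eq hW hσ hr hN hU (continuous_plateau i)
    (abs_plateau_le i) (hM i) T
  filter_upwards [ae_all_iff.2 hser, ae_all_iff.2 hMeq, hU T, hr, hs.mem_phaseSpace,
    hs.continuity, hs.initial] with ω h1 h2 ⟨_, _, _, _, hUm⟩ h4 hX hc hi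
  obtain ⟨C, hC⟩ := h4 T
  obtain ⟨δ, hδ, hlow⟩ := hc.exists_lower_bound hX hC
  set d := densityRate (fun s => ρ s.toNNReal ω) (ρx ω) (fun s => u s.toNNReal ω) (ux ω) with hd
  set m := momentumRate A (fun s => ρ s.toNNReal ω) (ρx ω) (fun s => u s.toNNReal ω) (ux ω)
    (uxx ω) with hm
  have hdi : Integrable (Function.uncurry d) (stripVol T) := hC.integrable_densityRate
  have hmi : Integrable (Function.uncurry m) (stripVol T) := hC.integrable_momentumRate A
  have hdm : MemLp (Function.uncurry d) 2 (stripVol T) := hC.memLp_flux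
  have hdU : Integrable (Function.uncurry fun s x => d s x * noiseLimit σ W N ω (s, x))
    (stripVol T) := hdm.integrable_mul hUm
  have h0 : ∀ᵐ x ∂unitVol, ρ 0 ω x = ρ₀ x ∧ u 0 ω x = u₀ x := by
    filter_upwards [ae_restrict_mem measurableSet_Ioo] with x hx
    exact hi x (Ioo_subset_Icc_self hx)
  have hsm : ∀ {f : ℝ → ℝ}, ContinuousOn f (Icc 0 1) → AEStronglyMeasurable f unitVol :=
    fun hf => (hf.mono Ioo_subset_Icc_self).aestronglyMeasurable measurableSet_Ioo
  have hρ0 := (hX 0).density_continuousOn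
  have hu0 := (hX 0).velocity_continuousOn
  have hρ : ∀ᵐ p ∂stripVol T, ρ p.1.toNNReal ω p.2 = ρ₀ p.2 + ∫ s in (0 : ℝ)..p.1, d s p.2 := by
    have e := ae_strip_eq_primitive (f := fun s => ρ s.toNNReal ω) (f₀ := ρ 0 ω) (G := d)
      hC.density (hsm hρ0) hdi.1 <| by
      filter_upwards [ae_restrict_mem measurableSet_Ioo] with t ht
      exact hc.ae_density_eq hX hC (Ioo_subset_Icc_self ht)
    filter_upwards [e, ae_strip_snd h0] with p e1 e2
    rw [e1, e2.1]
  refine ⟨δ, hδ, hlow, hρ, ?_⟩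
  refine hC.ae_velocity_eq (U := fun t x => noiseLimit σ W N ω (t, x)) (ρ₀ := ρ₀) hT hδ hlow
    hdU hρ ?_
  have hmom : ∀ i, ∀ t ∈ Icc 0 T, ∫ s in (0 : ℝ)..t, ∫ x in (0 : ℝ)..1,
      ((ρ s.toNNReal ω x * u s.toNNReal ω x ^ 2 + A ^ 2 * ρ s.toNNReal ω x) * deriv (plateau i) x
        + u s.toNNReal ω x * deriv (deriv (plateau i)) x) =
      ∫ s in (0 : ℝ)..t, ∫ x in (0 : ℝ)..1, m s x * plateau i x := fun i t ht =>
    integral_congr_ae_time ht (hC.ae_integral_momentum A (isTestFunction_plateau i))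
  have key : ∀ᵐ t ∂timeVol T, ∀ᵐ x ∂unitVol,
      ρ t.toNNReal ω x * (u t.toNNReal ω x - noiseLimit σ W N ω (t, x)) =
        ρ 0 ω x * u 0 ω x + ∫ s in (0 : ℝ)..t, (m s x - d s x * noiseLimit σ W N ω (s, x)) := by
    filter_upwards [ae_all_iff.2 h1, ae_restrict_mem measurableSet_Ioo,
      (hUm.integrable (by norm_num)).prod_right_ae] with t e1 ht hUt
    have ht' := Ioo_subset_Icc_self ht
    have hρt := (hX t.toNNReal).density_continuousOn
    have hut := (hX t.toNNReal).velocity_continuousOn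
    have hUt' : IntervalIntegrable (fun x => noiseLimit σ W N ω (t, x)) volume 0 1 := by
      rwa [intervalIntegrable_iff_integrableOn_Ioo_of_le zero_le_one]
    rw [← uIcc_of_le zero_le_one] at hρt hut hρ0 hu0
    refine ae_eq_of_forall_plateau ht' (hmi.sub hdU)
      ((hut.intervalIntegrable.sub hUt').continuousOn_mul hρt)
      (hρ0.mul hu0).intervalIntegrable fun i => ?_
    have hp := (continuous_plateau i).continuousOn (s := uIcc 0 1)
    have e2 := h2 i t.toNNReal
    rw [Real.coe_toNNReal _ ht.1.le, hmom i t ht', e1 i, noiseFunctional] at e2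
    have e3 : ∫ x in (0 : ℝ)..1, ρ t.toNNReal ω x *
        (u t.toNNReal ω x - noiseLimit σ W N ω (t, x)) * plateau i x =
        (∫ x in (0 : ℝ)..1, ρ t.toNNReal ω x * u t.toNNReal ω x * plateau i x) -
        ∫ x in (0 : ℝ)..1, ρ t.toNNReal ω x * plateau i x * noiseLimit σ W N ω (t, x) := by
      have i1 : IntervalIntegrable (fun x => ρ t.toNNReal ω x * u t.toNNReal ω x * plateau i x)
        volume 0 1 := ((hρt.mul hut).mul hp).intervalIntegrable
      have i2 : IntervalIntegrable (fun x => ρ t.toNNReal ω x * plateau i x *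
        noiseLimit σ W N ω (t, x)) volume 0 1 := hUt'.continuousOn_mul (hρt.mul hp)
      rw [← intervalIntegral.integral_sub i1 i2]
      exact intervalIntegral.integral_congr fun x _ => by ring
    have e4 : ∫ s in (0 : ℝ)..t, ∫ x in (0 : ℝ)..1,
        (m s x - d s x * noiseLimit σ W N ω (s, x)) * plateau i x =
        (∫ s in (0 : ℝ)..t, ∫ x in (0 : ℝ)..1, m s x * plateau i x) -
        ∫ s in (0 : ℝ)..t, ∫ x in (0 : ℝ)..1, d s x * plateau i x * noiseLimit σ W N ω (s, x) := by
      have hp' := (continuous_plateau i).continuousOn (s := Icc 0 1)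
      have := integral_strip_sub ht' (integrable_strip_mul hmi hp') (integrable_strip_mul hdU hp')
      simp_rw [sub_mul, this, mul_right_comm]
    rw [e3, e4, e2]
    ring
  have e := ae_strip_eq_primitive (f := fun t x => ρ t.toNNReal ω x *
      (u t.toNNReal ω x - noiseLimit σ W N ω (t, x))) (f₀ := fun x => ρ 0 ω x * u 0 ω x)
    (G := fun s x => m s x - d s x * noiseLimit σ W N ω (s, x))
    (hC.density.mul (hC.velocity.sub hUm.1)) (hsm (hρ0.mul hu0)) (hmi.sub hdU).1 key
  filter_upwards [e, ae_strip_snd h0] with p e1 e2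
  rw [e1, e2.1, e2.2]

theorem IsStrongSolution.ae_time_eq (hW : IsStochasticBasis P F W) (hσ : IsNoiseCoeff σ)
    (hs : IsStrongSolution P F W A σ ρ₀ u₀ ρ u) (hs' : IsStrongSolution P F W A σ ρ₀ u₀ r v) :
    ∀ᵐ ω ∂P, ∀ n : ℕ, ∀ᵐ s ∂timeVol n, ∀ x ∈ Icc (0 : ℝ) 1,
      ρ s.toNNReal ω x = r s.toNNReal ω x ∧ u s.toNNReal ω x = v s.toNNReal ω x := by
  obtain ⟨N, hN, hU⟩ := hW.exists_noiseLimit hσ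
  obtain ⟨ρx, ux, uxx, hr⟩ := hs.exists_derivatives
  obtain ⟨rx, vx, vxx, hr'⟩ := hs'.exists_derivatives
  rw [ae_all_iff]
  intro n
  have hn : (0 : ℝ) ≤ n := n.cast_nonneg
  filter_upwards [hs.ae_equations hW hσ hr hN hU hn, hs'.ae_equations hW hσ hr' hN hU hn, hr, hr']
    with ω ⟨δ, hδ, hlow, hρ, hu⟩ ⟨δ', hδ', hlow', hρ', hu'⟩ h h'
  obtain ⟨C, hC⟩ := h n
  obtain ⟨C', hC'⟩ := h' n
  exact hC.unique hC' hn (lt_min hδ hδ')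
    (hlow.mono fun s hs x hx => (min_le_left _ _).trans (hs x hx))
    (hlow'.mono fun s hs x hx => (min_le_right _ _).trans (hs x hx)) hρ hρ' hu hu'

end Path

/-! ### From almost every time to every time -/

theorem eqOn_Icc_of_forall_plateau {f g : ℝ → ℝ} (hf : ContinuousOn f (Icc 0 1))
    (hg : ContinuousOn g (Icc 0 1))
    (h : ∀ i, ∫ x in (0 : ℝ)..1, f x * plateau i x = ∫ x in (0 : ℝ)..1, g x * plateau i x) :
    EqOn f g (Icc 0 1) := by
  have hf' := hf
  have hg' := hg
  rw [← uIcc_of_le zero_le_one] at hf' hg'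
  have key := ae_eq_zero_of_forall_plateau (hf'.sub hg').intervalIntegrable fun i => by
    have hc := (continuous_plateau i).continuousOn (s := uIcc 0 1)
    have i1 : IntervalIntegrable (fun x => f x * plateau i x) volume 0 1 :=
      (hf'.mul hc).intervalIntegrable
    have i2 : IntervalIntegrable (fun x => g x * plateau i x) volume 0 1 :=
      (hg'.mul hc).intervalIntegrable
    simp_rw [Pi.sub_apply, sub_mul]
    rw [intervalIntegral.integral_sub i1 i2, h i, sub_self]
  have h1 : f =ᵐ[volume.restrict (Ioo 0 1)] g := by
    filter_upwards [key] with x hx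
    exact sub_eq_zero.1 hx
  have h2 : EqOn f g (Ioo 0 1) := Measure.eqOn_open_of_ae_eq h1 isOpen_Ioo
    (hf.mono Ioo_subset_Icc_self) (hg.mono Ioo_subset_Icc_self)
  exact h2.of_subset_closure hf hg Ioo_subset_Icc_self
    (closure_Ioo (zero_ne_one (α := ℝ))).ge

/-- Pathwise uniqueness of strong solutions. -/
theorem IsStrongSolution.ae_eq {Ω : Type*} [MeasurableSpace Ω] {P : Measure Ω}
    [IsProbabilityMeasure P] {F : Filtration ℝ≥0 ‹_›} {W : ℕ → ℝ≥0 → Ω → ℝ} {A : ℝ}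
    {σ : ℕ → ℝ → ℝ} {ρ₀ u₀ : ℝ → ℝ} {ρ u r v : ℝ≥0 → Ω → ℝ → ℝ}
    (hW : IsStochasticBasis P F W) (hσ : IsNoiseCoeff σ)
    (hρu : IsStrongSolution P F W A σ ρ₀ u₀ ρ u) (hrv : IsStrongSolution P F W A σ ρ₀ u₀ r v) :
    ∀ᵐ ω ∂P, ∀ t : ℝ≥0, ∀ x ∈ Icc (0 : ℝ) 1, ρ t ω x = r t ω x ∧ u t ω x = v t ω x := by
  choose M hM hMeq using fun i : PlateauIndex => hρu.momentum _ (isTestFunction_plateau i)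
  choose M' hM' hMeq' using fun i : PlateauIndex => hrv.momentum _ (isTestFunction_plateau i)
  filter_upwards [hρu.ae_time_eq hW hσ hrv, ae_all_iff.2 hMeq, ae_all_iff.2 hMeq',
    ae_all_iff.2 fun i => (hM i).1, ae_all_iff.2 fun i => (hM' i).1, hρu.mem_phaseSpace,
    hrv.mem_phaseSpace, hρu.continuity, hrv.continuity, hρu.initial, hrv.initial]
    with ω hae h1 h1' hc hc' hX hX' he he' hi hi'
  have hcongr : ∀ {f g : ℝ → ℝ} (t : ℝ≥0), (∀ s, (∀ x ∈ Icc (0 : ℝ) 1,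
      ρ s.toNNReal ω x = r s.toNNReal ω x ∧ u s.toNNReal ω x = v s.toNNReal ω x) → f s = g s) →
      ∫ s in (0 : ℝ)..t, f s = ∫ s in (0 : ℝ)..t, g s := fun {f g} t h => by
    obtain ⟨n, hn⟩ := exists_nat_ge (t : ℝ)
    exact integral_congr_ae_time ⟨t.coe_nonneg, hn⟩ ((hae n).mono h)
  have hint : ∀ {f g : ℝ → ℝ}, EqOn f g (Icc 0 1) →
      ∫ x in (0 : ℝ)..1, f x = ∫ x in (0 : ℝ)..1, g x := fun h =>
    intervalIntegral.integral_congr (by rwa [uIcc_of_le zero_le_one])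
  have hini : ∀ x ∈ Icc (0 : ℝ) 1, ρ 0 ω x = r 0 ω x ∧ u 0 ω x = v 0 ω x := fun x hx =>
    ⟨(hi x hx).1.trans (hi' x hx).1.symm, (hi x hx).2.trans (hi' x hx).2.symm⟩
  -- The continuity equation determines the density at every `t` from the initial datum and a time
  -- integral that ignores null sets of times.
  have hden : ∀ t, EqOn (ρ t ω) (r t ω) (Icc 0 1) := fun t => by
    refine eqOn_Icc_of_forall_plateau (hX t).density_continuousOn (hX' t).density_continuousOn
      fun i => ?_
    rw [he _ (isTestFunction_plateau i), he' _ (isTestFunction_plateau i)]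
    refine congrArg₂ (· + ·) (hint fun x hx => ?_) (hcongr t fun s hs => hint fun x hx => ?_)
    · simp only [(hini x hx).1]
    · simp only [(hs x hx).1, (hs x hx).2]
  have hmass : ∀ i t, (∫ x in (0 : ℝ)..1, ρ t ω x * u t ω x * plateau i x) -
      ∫ x in (0 : ℝ)..1, r t ω x * v t ω x * plateau i x = M i t ω - M' i t ω := fun i t => by
    rw [h1 i t, h1' i t, add_sub_add_comm]
    refine add_eq_right.2 (sub_eq_zero.2 (congrArg₂ (· + ·) (hint fun x hx => ?_)
      (hcongr t fun s hs => hint fun x hx => ?_)))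
    · simp only [(hini x hx).1, (hini x hx).2]
    · simp only [(hs x hx).1, (hs x hx).2]
  -- The stochastic terms are tied to different solutions and are compared only through the momentum
  -- balance: it makes them equal at almost every time, and their continuity at every time. Momenta
  -- then agree at every time, and `ρ > 0` gives the velocities.
  have hMM : ∀ i t, M i t ω = M' i t ω := fun i => by
    have hae' : ∀ᵐ s ∂(volume.restrict (Ioi (0 : ℝ))),
        M i s.toNNReal ω = M' i s.toNNReal ω := by
      refine ae_Ioi_of_forall_ae_Ioo fun n => ?_
      filter_upwards [hae n] with s hs
      rw [← sub_eq_zero, ← hmass, sub_eq_zero]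
      exact hint fun x hx => by simp only [(hs x hx).1, (hs x hx).2]
    have e1 : Continuous fun s : ℝ => M i s.toNNReal ω := (hc i).comp continuous_real_toNNReal
    have e2 : Continuous fun s : ℝ => M' i s.toNNReal ω := (hc' i).comp continuous_real_toNNReal
    have e3 : EqOn (fun s : ℝ => M i s.toNNReal ω) (fun s => M' i s.toNNReal ω) (Ioi 0) :=
      Measure.eqOn_open_of_ae_eq hae' isOpen_Ioi e1.continuousOn e2.continuousOn
    intro t
    have e4 := e3.closure e1 e2
    rw [closure_Ioi] at e4
    have := e4 t.coe_nonneg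
    simpa only [Real.toNNReal_coe] using this
  intro t x hx
  refine ⟨hden t hx, ?_⟩
  have hprod : EqOn (fun x => ρ t ω x * u t ω x) (fun x => r t ω x * v t ω x) (Icc 0 1) := by
    refine eqOn_Icc_of_forall_plateau
      ((hX t).density_continuousOn.mul (hX t).velocity_continuousOn)
      ((hX' t).density_continuousOn.mul (hX' t).velocity_continuousOn) fun i => ?_
    rw [← sub_eq_zero, hmass, hMM, sub_self]
  have e := hprod hx
  simp only [← hden t hx] at e
  exact mul_left_cancel₀ ((hX t).pos x hx).ne' e

end StochCNS

theorem mainTheorem4 {Ω : Type*} [mΩ : MeasurableSpace Ω] (P : Measure Ω)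
    [IsProbabilityMeasure P] (F : Filtration ℝ≥0 mΩ) (W : ℕ → ℝ≥0 → Ω → ℝ)
    (hW : StochCNS.IsStochasticBasis P F W)
    (A : ℝ) (hA : 0 < A) (σ : ℕ → ℝ → ℝ) (hσ : StochCNS.IsNoiseCoeff σ)
    (ρ₀ u₀ : ℝ → ℝ) (h₀ : StochCNS.MemX ρ₀ u₀)
    (ρ u r v : ℝ≥0 → Ω → ℝ → ℝ)
    (hρu : StochCNS.IsStrongSolution P F W A σ ρ₀ u₀ ρ u)
    (hrv : StochCNS.IsStrongSolution P F W A σ ρ₀ u₀ r v) :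
    ∀ᵐ ω ∂P, ∀ t : ℝ≥0, ∀ x ∈ Set.Icc (0 : ℝ) 1,
      ρ t ω x = r t ω x ∧ u t ω x = v t ω x :=
  hρu.ae_eq hW hσ hrv
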